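/- All rings are associative and unital. For parallel ring homomorphisms $\alpha,\beta:S\to T$ put $\mathrm{Hom}(\alpha,\beta)=\{t\in T\mid t\alpha(s)=\beta(s)t\ \ \forall s\in S\}$ and $\mathrm{End}(\alpha)=\mathrm{Hom}(\alpha,\alpha)$. For a ring $B$ let $\mathsf{Ring}(B,B)$ be the strict monoidal category of ring endomorphisms of $B$ and intertwiners, with vertical composition the multiplication of $B$, $\alpha\otimes\beta=\alpha\beta$, and $t\otimes s=t\,\alpha(s)$ for $t:\alpha\to\alpha'$, $s:\beta\to\beta'$. Let $\lambda:A\to B$, $\rho:B\to A$ be ring homomorphisms with an adjunction $\lambda\dashv\rho$, i.e. elements $e\in\mathrm{Hom}(\lambda\rho,\mathrm{id}_B)$ and $m\in\mathrm{Hom}(\mathrm{id}_A,\rho\lambda)$ with $\rho(e)m=1_A$ and $e\lambda(m)=1_B$. An endomorphism $\sigma$ of $B$ is implementable in $\rho$ if there are $f^1,\dots,f^n\in\mathrm{Hom}(\rho,\rho\sigma)$ and $\bar f^1,\dots,\bar f^n\in\mathrm{Hom}(\rho\sigma,\rho)$ with $\rho(\sigma(b))=\sum_i f^i\rho(b)\bar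 f^i$ for all $b\in B$. Let $\mathcal C$ be a full monoidal subcategory of $\mathsf{Ring}(B,B)$ all of whose objects are implementable in $\rho$ and which contains the object $\lambda\rho$. Put $R=\mathrm{End}(\rho)$, and let $F:\mathcal C\to\mathsf{Ab}$, $F(\alpha)=\mathrm{Hom}(\rho,\rho\alpha)$, $F(t)x=\rho(t)x$, with monoidal structure $x\otimes y\mapsto xy$, $1\mapsto 1_A$. Let $F^l:\mathcal C^{op}\to\mathsf{Ab}$, $F^l(\alpha)=\mathrm{Hom}(\rho\alpha,\rho)$, $F^l(t)f=f\rho(t)$, with monoidal structure $f\otimes g\mapsto gf$, and $\Upsilon:\mathcal C^{op}\to\mathsf{Ab}$, $\Upsilon(\alpha)=B$, $\Upsilon(t)b=bt$, with monoidal structure $b\otimes b'\mapsto b\,\alpha(b')$ on $\Upsilon(\alpha)\otimes\Upsilon(\beta)$. For monoidal functors $G:\mathcal C^{op}\to\mathsf{Ab}$ and $F':\mathcal C\to\mathsf{Ab}$ let $G\otimes_{\mathcal C}F'$ be the ring $\bigoplus_\alpha G(\alpha)\otimes F'(\alpha)$ modulo $G(t)y\otimes x=y\otimes F'(t)x$,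 with factorwise multiplication; write $y\otimes_\alpha x$ for its generators. For a monoidal functor $F':\mathcal C\to\mathsf{Ab}$ with unit element $1\in F'(\mathrm{id}_B)$, the field algebra extension is the ring homomorphism $\rho_{F'}:B\to\Upsilon\otimes_{\mathcal C}F'$, $b\mapsto b\otimes 1$, and $\eta_{F'}:F'\to\mathrm{Hom}(\rho_{F'},\rho_{F'}-)$ is the natural map $x\mapsto 1\otimes_\alpha x$. For $\alpha\in\mathcal C$, a direct summand diagram consists of $p_i\in\mathrm{Hom}(\rho\alpha,\rho)$, $q_i\in\mathrm{Hom}(\rho,\rho\alpha)$ ($1\le i\le n$) with $\sum_i q_ip_i=1_A$. Then: 1. $F$ is an additive monoidal functor, represented by $\lambda\rho$ (it is isomorphic as a monoidal functor to $\mathrm{Hom}(\lambda\rho,-)$ for a comonoid structure on $\lambda\rho$), it is essentially strong (the maps $F(\alpha)\otimes_RF(\beta)\to F(\alpha\beta)$ are bijective), and $\eta_F$ is an isomorphism of monoidal functors. 2. The map $\varepsilon_\rho:\Upsilon\otimes_{\mathcal C}F\to A$, $b\otimes_\alpha x\mapsto\rho(b)x$, is a ring isomorphism with $\varepsilon_\rho\circ\rho_F=\rho$.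 3. $H=F^l\otimes_{\mathcal C}F$ is a right bialgebroid over $R$ with source $r\mapsto 1\otimes r$, target $r\mapsto r\otimes 1$, coproduct $f\otimes_\alpha x\mapsto\sum_i(f\otimes_\alpha q_i)\otimes_R(p_i\otimes_\alpha x)$ (for any direct summand diagram for $\alpha$) and counit $f\otimes_\alpha x\mapsto fx$. The ring $L=\mathrm{End}(\rho\lambda)$ is a left bialgebroid over $R$ with source $r\mapsto r$, target $r\mapsto\rho(e\lambda(rm))$, coproduct $h\mapsto\sum_i\rho(e)h\rho(e\lambda(q_im))\otimes_Rp_i\rho\lambda(m)$ (for any direct summand diagram for $\lambda\rho$) and counit $h\mapsto\rho(e)hm$. As a right $R$-bialgebroid, $H$ is isomorphic to the opposite of $L$, i.e. to $L^{op}$ with the source and target of $L$ exchanged and the same coproduct and counit. 4. With the $R$-ring structure $r\mapsto 1\otimes r$ and the coaction $b\otimes_\alpha x\mapsto\sum_i(b\otimes_\alpha q_i)\otimes_R(p_i\otimes_\alpha x)$, the ring $\Upsilon\otimes_{\mathcal C}F$ is a right $H$-comodule algebra, and $\rho_F$ is an $H$-Galois extension: the coinvariant subalgebra is $\rho_F(B)$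 (which corresponds to $\rho(B)$ under $\varepsilon_\rho$) and the Galois map $a\otimes_Ba'\mapsto aa'_{(0)}\otimes_Ra'_{(1)}$ is bijective. 5. With the coaction $a\mapsto\sum_i\rho(e\lambda(a))q_i\otimes_Rp_i\rho\lambda(m)$ (for any direct summand diagram for $\lambda\rho$), the $R$-ring $A$ is a right comodule algebra over $L$ (that is, over $L^{op}$: $(aa')_{(0)}\otimes(aa')_{(1)}=a_{(0)}a'_{(0)}\otimes a'_{(1)}a_{(1)}$), and $\rho$ is an $L$-Galois extension: the coinvariant subalgebra is $\rho(B)$ and the Galois map $A\otimes_BA\to A\otimes_RL$ is bijective. -/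

import Mathlib

open CategoryTheory MonoidalCategory Opposite MulOpposite
open scoped TensorProduct DirectSum

universe u

namespace FieldAlg

/-! ## The 2-category of rings -/

/-- The group `Hom(α, β)` of intertwiners between parallel ring homomorphisms. -/
def intertwiner {S T : Type*} [Ring S] [Ring T] (α β : S →+* T) : AddSubgroup T where
  carrier := {t | ∀ s, t * α s = β s * t}
  zero_mem' := by intro s; simp
  add_mem' := by
    intro x y hx hy s
    rw [add_mul, mul_add, hx s, hy s]
  neg_mem' := by
    intro x hx s
    rw [neg_mul, mul_neg, hx s]

/-- The ring `End(φ) = Hom(φ, φ)`. -/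
def endRing {S T : Type*} [Ring S] [Ring T] (φ : S →+* T) : Subring T where
  carrier := {t | ∀ s, t * φ s = φ s * t}
  zero_mem' := by intro s; simp
  one_mem' := by intro s; simp
  add_mem' := by
    intro x y hx hy s
    rw [add_mul, mul_add, hx s, hy s]
  neg_mem' := by
    intro x hx s
    rw [neg_mul, mul_neg, hx s]
  mul_mem' := by
    intro x y hx hy s
    rw [mul_assoc, hy s, ← mul_assoc, hx s, mul_assoc]

/-- An adjunction `l ⊣ r` in the 2-category of rings, with counit `e : l r → id` and unit
`m : id → r l`. -/
structure RingAdjunction {A B : Type*} [Ring A] [Ring B] (l : A →+* B) (r : B →+* A) where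
  e : B
  m : A
  e_mem : e ∈ intertwiner (l.comp r) (RingHom.id B)
  m_mem : m ∈ intertwiner (RingHom.id A) (r.comp l)
  r_e_mul_m : r e * m = 1
  e_mul_l_m : e * l m = 1

/-- The objects of the endo-category `Ring(B, B)`: ring endomorphisms of `B`. -/
@[ext]
structure EndCat (B : Type u) [Ring B] : Type u where
  hom : B →+* B

section EndCat

variable {B : Type u} [Ring B]

/-- Arrows are intertwiners, composition is multiplication in `B`. -/
instance : Category.{u} (EndCat B) where
  Hom α β := intertwiner α.hom β.hom
  id α := ⟨1, by intro s; simp⟩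
  comp f g := ⟨g.1 * f.1, by
    intro s
    rw [mul_assoc, f.2 s, ← mul_assoc, g.2 s, mul_assoc]⟩
  id_comp f := Subtype.ext (mul_one _)
  comp_id f := Subtype.ext (one_mul _)
  assoc f g h := Subtype.ext (mul_assoc _ _ _).symm

instance : Preadditive (EndCat B) where
  homGroup α β := inferInstanceAs (AddCommGroup (intertwiner α.hom β.hom))
  add_comp _ _ _ _ _ _ := Subtype.ext (mul_add _ _ _)
  comp_add _ _ _ _ _ _ := Subtype.ext (add_mul _ _ _)

theorem EndCat.hom_ext {α β : EndCat B} {f g : α ⟶ β} (h : f.1 = g.1) : f = g := Subtype.ext h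

theorem EndCat.comp_val {α β γ : EndCat B} (f : α ⟶ β) (g : β ⟶ γ) :
    (f ≫ g).1 = g.1 * f.1 := rfl

theorem EndCat.id_val (α : EndCat B) : (𝟙 α : α ⟶ α).1 = 1 := rfl

/-- An isomorphism whose underlying element is `1`, between equal endomorphisms. -/
def EndCat.isoOfEq {α β : EndCat B} (h : α.hom = β.hom) : α ≅ β where
  hom := ⟨1, by intro s; simp [h]⟩
  inv := ⟨1, by intro s; simp [h]⟩
  hom_inv_id := Subtype.ext (one_mul _)
  inv_hom_id := Subtype.ext (one_mul _)

/-- `α ⊗ β = α ∘ β` and `t ⊗ s = t α(s)`. -/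
instance : MonoidalCategoryStruct (EndCat B) where
  tensorObj α β := ⟨α.hom.comp β.hom⟩
  tensorUnit := ⟨RingHom.id B⟩
  tensorHom {α α' β β'} t s := ⟨t.1 * α.hom s.1, by
    intro b
    have h1 := s.2 b
    have h2 := t.2
    simp only [RingHom.comp_apply]
    rw [mul_assoc, ← map_mul, h1, map_mul, ← mul_assoc, h2, mul_assoc]⟩
  whiskerLeft α _ _ s := ⟨α.hom s.1, by
    intro b
    simp only [RingHom.comp_apply]
    rw [← map_mul, s.2 b, map_mul]⟩
  whiskerRight t β := ⟨t.1, fun b => t.2 (β.hom b)⟩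
  associator _ _ _ := EndCat.isoOfEq rfl
  leftUnitor _ := EndCat.isoOfEq rfl
  rightUnitor _ := EndCat.isoOfEq rfl

instance : MonoidalCategory (EndCat B) where
  tensorHom_def {α α' β β'} t s := EndCat.hom_ext (t.2 s.1)
  id_tensorHom_id α β := EndCat.hom_ext (by
    change (1 : B) * α.hom 1 = 1
    simp)
  tensorHom_comp_tensorHom {α₁ α₂ α₃ β₁ β₂ β₃} t s t' s' := EndCat.hom_ext (by
    change t'.1 * α₂.hom s'.1 * (t.1 * α₁.hom s.1) = t'.1 * t.1 * α₁.hom (s'.1 * s.1)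
    have h := t.2 s'.1
    rw [map_mul, mul_assoc, ← mul_assoc (α₂.hom s'.1), ← h]
    simp only [mul_assoc])
  whiskerLeft_id α β := EndCat.hom_ext (map_one α.hom)
  id_whiskerRight _ _ := rfl
  associator_naturality {α₁ α₂ α₃ β₁ β₂ β₃} t s w := EndCat.hom_ext (by
    change 1 * (t.1 * α₁.hom s.1 * α₁.hom (α₂.hom w.1)) = t.1 * α₁.hom (s.1 * α₂.hom w.1) * 1
    rw [map_mul, one_mul, mul_one, mul_assoc])
  leftUnitor_naturality t := EndCat.hom_ext ((one_mul t.1).trans (mul_one t.1).symm)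
  rightUnitor_naturality t := EndCat.hom_ext ((one_mul t.1).trans (mul_one t.1).symm)
  pentagon α β γ δ := EndCat.hom_ext (by
    change α.hom (1 : B) * 1 * (1 : B) = (1 : B) * 1
    simp)
  triangle α β := EndCat.hom_ext (by
    change α.hom (1 : B) * 1 = (1 : B)
    simp)

end EndCat

/-! ## Monoidal functors to abelian groups -/

section Monoidal

variable {J : Type u} [Category.{u} J] [MonoidalCategory J]

/-- A (lax) monoidal structure on a functor to abelian groups. The structure maps
`F X ⊗ F Y → F (X ⊗ Y)` and `ℤ → F 𝟙` are written as biadditive maps and as an element. -/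
class AbMonoidal (F : J ⥤ AddCommGrpCat.{u}) where
  μ : ∀ X Y : J, F.obj X →+ F.obj Y →+ F.obj (X ⊗ Y)
  one : F.obj (𝟙_ J)
  μ_natural : ∀ {X X' Y Y' : J} (f : X ⟶ X') (g : Y ⟶ Y') (x : F.obj X) (y : F.obj Y),
    μ X' Y' (F.map f x) (F.map g y) = F.map (f ⊗ₘ g) (μ X Y x y)
  μ_assoc : ∀ {X Y Z : J} (x : F.obj X) (y : F.obj Y) (z : F.obj Z),
    F.map (α_ X Y Z).hom (μ (X ⊗ Y) Z (μ X Y x y) z) = μ X (Y ⊗ Z) x (μ Y Z y z)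
  one_μ : ∀ {X : J} (x : F.obj X), F.map (λ_ X).hom (μ (𝟙_ J) X one x) = x
  μ_one : ∀ {X : J} (x : F.obj X), F.map (ρ_ X).hom (μ X (𝟙_ J) x one) = x

/-- A natural transformation compatible with the monoidal structures. -/
def IsMonoidalNat {F G : J ⥤ AddCommGrpCat.{u}} [AbMonoidal F] [AbMonoidal G] (ν : F ⟶ G) : Prop :=
  (∀ (X Y : J) (x : F.obj X) (y : F.obj Y),
    ν.app (X ⊗ Y) (AbMonoidal.μ X Y x y) = AbMonoidal.μ X Y (ν.app X x) (ν.app Y y)) ∧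
  ν.app (𝟙_ J) AbMonoidal.one = AbMonoidal.one

/-- The monoidal functor `F` is representable, with representing object `γ`: it is isomorphic, as
a monoidal functor, to `Hom(γ, -)` with the monoidal structure given by some comonoid structure
on `γ`. -/
def IsRepresentedBy [Preadditive J] (F : J ⥤ AddCommGrpCat.{u}) [AbMonoidal F] (γ : J) : Prop :=
  ∃ (_ : ComonObj γ) (θ : F ≅ preadditiveCoyoneda.obj (Opposite.op γ)),
    (∀ (X Y : J) (x : F.obj X) (y : F.obj Y),
      (θ.hom.app (X ⊗ Y) (AbMonoidal.μ X Y x y) : γ ⟶ X ⊗ Y) =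
        ComonObj.comul ≫ ((θ.hom.app X x : γ ⟶ X) ⊗ₘ (θ.hom.app Y y : γ ⟶ Y))) ∧
    (θ.hom.app (𝟙_ J) AbMonoidal.one : γ ⟶ 𝟙_ J) = ComonObj.counit

end Monoidal

/-! ## Tensor products over noncommutative rings -/

section BalTensor

variable {R M N P M' N' : Type*} [AddCommGroup M] [AddCommGroup N] [AddCommGroup P]
  [AddCommGroup M'] [AddCommGroup N']

/-- The subgroup of `M ⊗ N` generated by the elements `m r ⊗ n - m ⊗ r n`. -/
def balRel (ra : R → M →+ M) (la : R → N →+ N) : AddSubgroup (M ⊗[ℤ] N) :=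
  AddSubgroup.closure {z | ∃ r m n, z = (ra r m) ⊗ₜ[ℤ] n - m ⊗ₜ[ℤ] (la r n)}

/-- The tensor product `M ⊗_R N` for a right action `ra` of `R` on `M` and a left action `la`
of `R` on `N`. -/
def BalTensor (ra : R → M →+ M) (la : R → N →+ N) : Type _ := (M ⊗[ℤ] N) ⧸ balRel ra la

namespace BalTensor

variable {ra : R → M →+ M} {la : R → N →+ N} {ra' : R → M' →+ M'} {la' : R → N' →+ N'}

instance : AddCommGroup (BalTensor ra la) := inferInstanceAs (AddCommGroup (_ ⧸ balRel ra la))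

/-- The projection `M ⊗ N → M ⊗_R N`. -/
def proj (ra : R → M →+ M) (la : R → N →+ N) : M ⊗[ℤ] N →+ BalTensor ra la :=
  QuotientAddGroup.mk' (balRel ra la)

/-- The elementary tensor `m ⊗_R n`. -/
def tmul (ra : R → M →+ M) (la : R → N →+ N) (m : M) (n : N) : BalTensor ra la :=
  proj ra la (m ⊗ₜ[ℤ] n)

theorem tmul_balanced (r : R) (m : M) (n : N) :
    tmul ra la (ra r m) n = tmul ra la m (la r n) := by
  rw [← sub_eq_zero, tmul, tmul, ← map_sub]
  exact (QuotientAddGroup.eq_zero_iff _).2 (AddSubgroup.subset_closure ⟨r, m, n, rfl⟩)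

theorem tmul_add (m : M) (n n' : N) :
    tmul ra la m (n + n') = tmul ra la m n + tmul ra la m n' := by
  simp [tmul, TensorProduct.tmul_add]

theorem add_tmul (m m' : M) (n : N) :
    tmul ra la (m + m') n = tmul ra la m n + tmul ra la m' n := by
  simp [tmul, TensorProduct.add_tmul]

theorem proj_surjective : Function.Surjective (proj ra la) :=
  QuotientAddGroup.mk'_surjective _

/-- Balanced biadditive maps factor through the tensor product. -/
def lift (f : M →+ N →+ P) (hf : ∀ r m n, f (ra r m) n = f m (la r n)) : BalTensor ra la →+ P :=
  QuotientAddGroup.lift (balRel ra la)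
    (TensorProduct.liftAddHom f (fun k m n => by simp))
    (by
      rw [balRel, AddSubgroup.closure_le]
      rintro _ ⟨r, m, n, rfl⟩
      simp [hf])

@[simp]
theorem lift_tmul (f : M →+ N →+ P) (hf : ∀ r m n, f (ra r m) n = f m (la r n)) (m : M) (n : N) :
    lift f hf (tmul ra la m n) = f m n := rfl

theorem hom_ext {f g : BalTensor ra la →+ P} (h : ∀ m n, f (tmul ra la m n) = g (tmul ra la m n)) :
    f = g := by
  ext z
  obtain ⟨z, rfl⟩ := proj_surjective z
  induction z using TensorProduct.induction_on with
  | zero => simp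
  | tmul m n => exact h m n
  | add x y hx hy => simp [hx, hy]

/-- The biadditive map `(m, n) ↦ m ⊗_R n`. -/
def tmulHom (ra : R → M →+ M) (la : R → N →+ N) : M →+ N →+ BalTensor ra la :=
  AddMonoidHom.mk' (fun m => AddMonoidHom.mk' (fun n => tmul ra la m n) (tmul_add m))
    (fun m m' => by ext n; exact add_tmul m m' n)

@[simp]
theorem tmulHom_apply (m : M) (n : N) : tmulHom ra la m n = tmul ra la m n := rfl

/-- The map `f ⊗_R g` for `R`-linear maps `f` and `g`. -/
def map (f : M →+ M') (g : N →+ N') (hf : ∀ r m, f (ra r m) = ra' r (f m))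
    (hg : ∀ r n, g (la r n) = la' r (g n)) : BalTensor ra la →+ BalTensor ra' la' :=
  lift (((tmulHom ra' la').comp f).compl₂ g)
    (fun r m n => by
      simp [hf, hg, tmul_balanced])

@[simp]
theorem map_tmul (f : M →+ M') (g : N →+ N') (hf : ∀ r m, f (ra r m) = ra' r (f m))
    (hg : ∀ r n, g (la r n) = la' r (g n)) (m : M) (n : N) :
    map f g hf hg (tmul ra la m n) = tmul ra' la' (f m) (g n) := rfl

/-- The map `f ⊗_R id`. -/
def mapLeft (la : R → N →+ N) (f : M →+ M') (hf : ∀ r m, f (ra r m) = ra' r (f m)) :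
    BalTensor ra la →+ BalTensor ra' la :=
  map f (AddMonoidHom.id N) hf (fun _ _ => rfl)

@[simp]
theorem mapLeft_tmul (f : M →+ M') (hf : ∀ r m, f (ra r m) = ra' r (f m)) (m : M) (n : N) :
    mapLeft la f hf (tmul ra la m n) = tmul ra' la (f m) n := rfl

/-- The map `id ⊗_R g`. -/
def mapRight (ra : R → M →+ M) (g : N →+ N') (hg : ∀ r n, g (la r n) = la' r (g n)) :
    BalTensor ra la →+ BalTensor ra la' :=
  map (AddMonoidHom.id M) g (fun _ _ => rfl) hg

@[simp]
theorem mapRight_tmul (g : N →+ N') (hg : ∀ r n, g (la r n) = la' r (g n)) (m : M) (n : N) :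
    mapRight ra g hg (tmul ra la m n) = tmul ra la' m (g n) := rfl

end BalTensor

end BalTensor

/-- Essential strongness: with `R = F 𝟙` acting on the groups `F X` through the monoidal structure
and the unitors, the maps `F X ⊗_R F Y → F (X ⊗ Y)` induced by the monoidal structure are
bijective. -/
def EssentiallyStrong {J : Type u} [Category.{u} J] [MonoidalCategory J]
    (F : J ⥤ AddCommGrpCat.{u}) [AbMonoidal F] : Prop :=
  ∀ X Y : J, ∃ φ : BalTensor
      (fun r : F.obj (𝟙_ J) => (F.map (ρ_ X).hom).hom.comp ((AbMonoidal.μ X (𝟙_ J)).flip r))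
      (fun r : F.obj (𝟙_ J) => (F.map (λ_ Y).hom).hom.comp (AbMonoidal.μ (𝟙_ J) Y r))
        →+ F.obj (X ⊗ Y),
    (∀ x y, φ (BalTensor.tmul _ _ x y) = AbMonoidal.μ X Y x y) ∧ Function.Bijective φ

/-! ## Bimodules, corings and comodules over a noncommutative ring -/

section Coring

/-- A right module structure on an abelian group; `act r m = m r`. -/
structure RightAction (R M : Type*) [Ring R] [AddCommGroup M] where
  act : R → M →+ M
  act_one : ∀ m, act 1 m = m
  act_mul : ∀ r s m, act (r * s) m = act s (act r m)
  act_add : ∀ r s m, act (r + s) m = act r m + act s m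

/-- A left module structure on an abelian group; `act r m = r m`. -/
structure LeftAction (R M : Type*) [Ring R] [AddCommGroup M] where
  act : R → M →+ M
  act_one : ∀ m, act 1 m = m
  act_mul : ∀ r s m, act (r * s) m = act r (act s m)
  act_add : ∀ r s m, act (r + s) m = act r m + act s m

/-- An `R`-`R`-bimodule structure on an abelian group. -/
structure Bimodule (R M : Type*) [Ring R] [AddCommGroup M] where
  left : LeftAction R M
  right : RightAction R M
  comm : ∀ r s m, left.act r (right.act s m) = right.act s (left.act r m)

variable {R M N P : Type*} [Ring R] [AddCommGroup M] [AddCommGroup N] [AddCommGroup P]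

/-- The right action on `M ⊗_R N` coming from a bimodule `N`. -/
def RightAction.tensor (X : RightAction R M) (Y : Bimodule R N) :
    RightAction R (BalTensor X.act Y.left.act) where
  act r := BalTensor.mapRight X.act (Y.right.act r) (fun s n => (Y.comm s r n).symm)
  act_one z := by
    refine DFunLike.congr_fun (BalTensor.hom_ext (g := AddMonoidHom.id _) fun m n => ?_) z
    simp [Y.right.act_one]
  act_mul r s z := by
    rw [← AddMonoidHom.comp_apply]
    refine DFunLike.congr_fun (BalTensor.hom_ext fun m n => ?_) z
    simp [Y.right.act_mul]
  act_add r s z := by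
    rw [← AddMonoidHom.add_apply]
    refine DFunLike.congr_fun (BalTensor.hom_ext fun m n => ?_) z
    simp [Y.right.act_add, BalTensor.tmul_add]

/-- The left action on `M ⊗_R N` coming from a bimodule `M`. -/
def LeftAction.tensor (X : Bimodule R M) (Y : LeftAction R N) :
    LeftAction R (BalTensor X.right.act Y.act) where
  act r := BalTensor.mapLeft Y.act (X.left.act r) (fun s m => X.comm r s m)
  act_one z := by
    refine DFunLike.congr_fun (BalTensor.hom_ext (g := AddMonoidHom.id _) fun m n => ?_) z
    simp [X.left.act_one]
  act_mul r s z := by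
    rw [← AddMonoidHom.comp_apply]
    refine DFunLike.congr_fun (BalTensor.hom_ext fun m n => ?_) z
    simp [X.left.act_mul]
  act_add r s z := by
    rw [← AddMonoidHom.add_apply]
    refine DFunLike.congr_fun (BalTensor.hom_ext fun m n => ?_) z
    simp [X.left.act_add, BalTensor.add_tmul]

/-- The biadditive map `(m ⊗ n, p) ↦ m ⊗ (n ⊗ p)`. -/
def BalTensor.assocAux (X : RightAction R M) (Y : Bimodule R N) (Z : LeftAction R P) :
    BalTensor X.act Y.left.act →+ P →+ BalTensor X.act (LeftAction.tensor Y Z).act :=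
  BalTensor.lift
    (AddMonoidHom.mk' (fun m => (tmulHom Y.right.act Z.act).compr₂
        (tmulHom X.act (LeftAction.tensor Y Z).act m))
      (fun m m' => by ext n p; simp))
    (fun r m n => by
      ext p
      exact BalTensor.tmul_balanced (la := (LeftAction.tensor Y Z).act) r m
        (BalTensor.tmul Y.right.act Z.act n p))

theorem BalTensor.assocAux_tmul (X : RightAction R M) (Y : Bimodule R N) (Z : LeftAction R P)
    (m : M) (n : N) (p : P) : BalTensor.assocAux X Y Z (BalTensor.tmul _ _ m n) p =
      BalTensor.tmul _ _ m (BalTensor.tmul _ _ n p) := rfl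

theorem BalTensor.assocAux_balanced (X : RightAction R M) (Y : Bimodule R N) (Z : LeftAction R P)
    (r : R) (z : BalTensor X.act Y.left.act) (p : P) :
    BalTensor.assocAux X Y Z ((X.tensor Y).act r z) p =
      BalTensor.assocAux X Y Z z (Z.act r p) := by
  have h : ((BalTensor.assocAux X Y Z).flip p).comp ((X.tensor Y).act r) =
      (BalTensor.assocAux X Y Z).flip (Z.act r p) := by
    refine BalTensor.hom_ext fun m n => ?_
    have h1 : (X.tensor Y).act r (BalTensor.tmul _ _ m n) =
        BalTensor.tmul _ _ m (Y.right.act r n) := rfl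
    rw [AddMonoidHom.comp_apply, AddMonoidHom.flip_apply, AddMonoidHom.flip_apply, h1,
      BalTensor.assocAux_tmul, BalTensor.assocAux_tmul, BalTensor.tmul_balanced]
  exact DFunLike.congr_fun h z

/-- The associativity map `(M ⊗_R N) ⊗_R P → M ⊗_R (N ⊗_R P)`. -/
def BalTensor.assoc (X : RightAction R M) (Y : Bimodule R N) (Z : LeftAction R P) :
    BalTensor (X.tensor Y).act Z.act →+ BalTensor X.act (LeftAction.tensor Y Z).act :=
  BalTensor.lift (BalTensor.assocAux X Y Z) (BalTensor.assocAux_balanced X Y Z)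

/-- An `R`-coring: a comonoid in the category of `R`-`R`-bimodules. -/
structure Coring (X : Bimodule R M) where
  comul : M →+ BalTensor X.right.act X.left.act
  comul_left : ∀ r m, comul (X.left.act r m) = (LeftAction.tensor X X.left).act r (comul m)
  comul_right : ∀ r m, comul (X.right.act r m) = (X.right.tensor X).act r (comul m)
  counit : M →+ R
  counit_left : ∀ r m, counit (X.left.act r m) = r * counit m
  counit_right : ∀ r m, counit (X.right.act r m) = counit m * r
  coassoc : ∀ m,
    BalTensor.assoc X.right X X.left
      (BalTensor.mapLeft X.left.act comul comul_right (comul m)) =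
    BalTensor.mapRight X.right.act comul comul_left (comul m)
  counit_comul : ∀ m,
    BalTensor.lift (AddMonoidHom.mk' (fun h => X.left.act (counit h))
        (fun h h' => by ext k; simp [X.left.act_add]))
      (fun r h k => by simp [counit_right, X.left.act_mul]) (comul m) = m
  comul_counit : ∀ m,
    BalTensor.lift (AddMonoidHom.mk' (fun h => X.right.act (counit h))
        (fun h h' => by ext k; simp [X.right.act_add])).flip
      (fun r h k => by simp [counit_left, X.right.act_mul]) (comul m) = m

/-- A right comodule over an `R`-coring. -/
structure Comodule {X : Bimodule R M} (K : Coring X) (Y : RightAction R N) where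
  coact : N →+ BalTensor Y.act X.left.act
  coact_right : ∀ r n, coact (Y.act r n) = (Y.tensor X).act r (coact n)
  coassoc : ∀ n,
    BalTensor.assoc Y X X.left
      (BalTensor.mapLeft X.left.act coact coact_right (coact n)) =
    BalTensor.mapRight Y.act K.comul K.comul_left (coact n)
  coact_counit : ∀ n,
    BalTensor.lift (AddMonoidHom.mk' (fun h => Y.act (K.counit h))
        (fun h h' => by ext k; simp [Y.act_add])).flip
      (fun r h k => by simp [K.counit_left, Y.act_mul]) (coact n) = n

end Coring

/-! ## Bialgebroids -/

section Bialgebroid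

variable {R H A B : Type*} [Ring R] [Ring H] [Ring A] [Ring B]

/-- The bimodule structure `r h r' = s(r) t(r') h` of a left bialgebroid. -/
def leftBimodule (s : R →+* H) (t : Rᵐᵒᵖ →+* H)
    (hst : ∀ r r', s r * t (op r') = t (op r') * s r) : Bimodule R H where
  left :=
    { act := fun r => AddMonoidHom.mulLeft (s r)
      act_one := by simp
      act_mul := by simp [mul_assoc]
      act_add := by simp [add_mul] }
  right :=
    { act := fun r => AddMonoidHom.mulLeft (t (op r))
      act_one := by simp
      act_mul := by simp [mul_assoc]
      act_add := by simp [add_mul] }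
  comm r r' h := by simp [← mul_assoc, hst]

/-- The bimodule structure `r h r' = h s(r') t(r)` of a right bialgebroid. -/
def rightBimodule (s : R →+* H) (t : Rᵐᵒᵖ →+* H)
    (hst : ∀ r r', s r * t (op r') = t (op r') * s r) : Bimodule R H where
  left :=
    { act := fun r => AddMonoidHom.mulRight (t (op r))
      act_one := by simp
      act_mul := by simp [mul_assoc]
      act_add := by simp [mul_add] }
  right :=
    { act := fun r => AddMonoidHom.mulRight (s r)
      act_one := by simp
      act_mul := by simp [mul_assoc]
      act_add := by simp [mul_add] }
  comm r r' h := by simp [mul_assoc, hst]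

/-- A left bialgebroid over `R` with total ring `H`. The condition `takeuchi` says that the
coproduct has values in the Takeuchi product
`{∑ h ⊗ h' | ∑ h t(r) ⊗ h' = ∑ h ⊗ h' s(r) for all r}`, on which the factorwise product is well
defined; the latter is computed on arbitrary representatives in the ring `H ⊗ H`. -/
structure LeftBialgebroid (R H : Type*) [Ring R] [Ring H] where
  source : R →+* H
  target : Rᵐᵒᵖ →+* H
  source_target : ∀ r r', source r * target (op r') = target (op r') * source r
  coring : Coring (leftBimodule source target source_target)
  takeuchi : ∀ (h : H) (z : H ⊗[ℤ] H), BalTensor.proj _ _ z = coring.comul h → ∀ r,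
    BalTensor.proj (leftBimodule source target source_target).right.act
      (leftBimodule source target source_target).left.act (z * (target (op r) ⊗ₜ[ℤ] 1)) =
    BalTensor.proj _ _ (z * (1 ⊗ₜ[ℤ] source r))
  comul_one : coring.comul 1 = BalTensor.tmul _ _ 1 1
  comul_mul : ∀ (h h' : H) (z z' : H ⊗[ℤ] H), BalTensor.proj _ _ z = coring.comul h →
    BalTensor.proj _ _ z' = coring.comul h' → coring.comul (h * h') = BalTensor.proj _ _ (z * z')
  counit_one : coring.counit 1 = 1
  counit_mul_source : ∀ h h',
    coring.counit (h * source (coring.counit h')) = coring.counit (h * h')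
  counit_mul_target : ∀ h h',
    coring.counit (h * target (op (coring.counit h'))) = coring.counit (h * h')

/-- A right bialgebroid over `R` with total ring `H`. The condition `takeuchi` says that the
coproduct has values in the Takeuchi product
`{∑ h ⊗ h' | ∑ s(r) h ⊗ h' = ∑ h ⊗ t(r) h' for all r}`. -/
structure RightBialgebroid (R H : Type*) [Ring R] [Ring H] where
  source : R →+* H
  target : Rᵐᵒᵖ →+* H
  source_target : ∀ r r', source r * target (op r') = target (op r') * source r
  coring : Coring (rightBimodule source target source_target)
  takeuchi : ∀ (h : H) (z : H ⊗[ℤ] H), BalTensor.proj _ _ z = coring.comul h → ∀ r,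
    BalTensor.proj (rightBimodule source target source_target).right.act
      (rightBimodule source target source_target).left.act ((source r ⊗ₜ[ℤ] 1) * z) =
    BalTensor.proj _ _ ((1 ⊗ₜ[ℤ] target (op r)) * z)
  comul_one : coring.comul 1 = BalTensor.tmul _ _ 1 1
  comul_mul : ∀ (h h' : H) (z z' : H ⊗[ℤ] H), BalTensor.proj _ _ z = coring.comul h →
    BalTensor.proj _ _ z' = coring.comul h' → coring.comul (h * h') = BalTensor.proj _ _ (z * z')
  counit_one : coring.counit 1 = 1
  counit_source_mul : ∀ h h',
    coring.counit (source (coring.counit h) * h') = coring.counit (h * h')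
  counit_target_mul : ∀ h h',
    coring.counit (target (op (coring.counit h)) * h') = coring.counit (h * h')

/-- The underlying `R`-`R`-bimodule of a left bialgebroid. -/
abbrev LeftBialgebroid.bimodule (L : LeftBialgebroid R H) : Bimodule R H :=
  leftBimodule L.source L.target L.source_target

/-- The underlying `R`-`R`-bimodule of a right bialgebroid. -/
abbrev RightBialgebroid.bimodule (K : RightBialgebroid R H) : Bimodule R H :=
  rightBimodule K.source K.target K.source_target

/-- The right `R`-module structure `a r = a π(r)` of an `R`-ring `π : R → A`. -/
def ringRightAction (π : R →+* A) : RightAction R A where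
  act r := AddMonoidHom.mulRight (π r)
  act_one := by simp
  act_mul := by simp [mul_assoc]
  act_add := by simp [mul_add]

/-- A structure of right comodule algebra over a right bialgebroid on an `R`-ring `π : R → A`:
a comodule over the underlying coring whose coaction takes values in the Takeuchi product
`{∑ a ⊗ h | ∑ r a ⊗ h = ∑ a ⊗ t(r) h}` and is unital and multiplicative,
`(a a')₀ ⊗ (a a')₁ = a₀ a'₀ ⊗ a₁ a'₁`. -/
structure RightBialgebroid.ComoduleAlgebra (K : RightBialgebroid R H) (π : R →+* A) extends
    Comodule K.coring (ringRightAction π) where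
  takeuchi : ∀ (a : A) (z : A ⊗[ℤ] H), BalTensor.proj _ _ z = coact a → ∀ r,
    BalTensor.proj (ringRightAction π).act K.bimodule.left.act ((π r ⊗ₜ[ℤ] 1) * z) =
    BalTensor.proj _ _ ((1 ⊗ₜ[ℤ] K.target (op r)) * z)
  coact_one : coact 1 = BalTensor.tmul _ _ 1 1
  coact_mul : ∀ (a a' : A) (z z' : A ⊗[ℤ] H), BalTensor.proj _ _ z = coact a →
    BalTensor.proj _ _ z' = coact a' → coact (a * a') = BalTensor.proj _ _ (z * z')

/-- The product `(a ⊗ h)(a' ⊗ h') = a a' ⊗ h' h` on `A ⊗ H`. -/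
noncomputable def twistedMul (A H : Type*) [Ring A] [Ring H] :
    A ⊗[ℤ] H →ₗ[ℤ] A ⊗[ℤ] H →ₗ[ℤ] A ⊗[ℤ] H :=
  TensorProduct.map₂ (LinearMap.mul ℤ A) (LinearMap.mul ℤ H).flip

/-- A structure of right comodule algebra over a left bialgebroid on an `R`-ring `π : R → A`
(that is, over the opposite right bialgebroid): a comodule over the underlying coring whose
coaction takes values in the Takeuchi product `{∑ a ⊗ h | ∑ r a ⊗ h = ∑ a ⊗ h s(r)}` and
satisfies `1 ↦ 1 ⊗ 1` and `(a a')₀ ⊗ (a a')₁ = a₀ a'₀ ⊗ a'₁ a₁`. -/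
structure LeftBialgebroid.ComoduleAlgebra (L : LeftBialgebroid R H) (π : R →+* A) extends
    Comodule L.coring (ringRightAction π) where
  takeuchi : ∀ (a : A) (z : A ⊗[ℤ] H), BalTensor.proj _ _ z = coact a → ∀ r,
    BalTensor.proj (ringRightAction π).act L.bimodule.left.act ((π r ⊗ₜ[ℤ] 1) * z) =
    BalTensor.proj _ _ (z * (1 ⊗ₜ[ℤ] L.source r))
  coact_one : coact 1 = BalTensor.tmul _ _ 1 1
  coact_mul : ∀ (a a' : A) (z z' : A ⊗[ℤ] H), BalTensor.proj _ _ z = coact a →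
    BalTensor.proj _ _ z' = coact a' → coact (a * a') = BalTensor.proj _ _ (twistedMul A H z z')

/-- The coinvariants `{a | δ(a) = a ⊗ 1}` of a coaction `δ : A → A ⊗_R H`. -/
def coinvariants {π : R →+* A} {Y : LeftAction R H}
    (δ : A →+ BalTensor (ringRightAction π).act Y.act) : Set A :=
  {a | δ a = BalTensor.tmul _ _ a 1}

/-- Left multiplication by `a` on the first factor of `A ⊗_R H`. -/
def leftMul (π : R →+* A) (Y : LeftAction R H) (a : A) :
    BalTensor (ringRightAction π).act Y.act →+ BalTensor (ringRightAction π).act Y.act :=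
  BalTensor.mapLeft Y.act (AddMonoidHom.mulLeft a) (fun r a' => (mul_assoc a a' (π r)).symm)

/-- The ring homomorphism `ρ : B → A` is a Galois extension for the coaction `δ` on `A`: the
coinvariants are `ρ(B)` and the Galois map `A ⊗_B A → A ⊗_R H`, `a ⊗ a' ↦ a a'₀ ⊗ a'₁` is
(well defined and) bijective. -/
def IsGalois (ρ : B →+* A) {π : R →+* A} {Y : LeftAction R H}
    (δ : A →+ BalTensor (ringRightAction π).act Y.act) : Prop :=
  coinvariants δ = Set.range ρ ∧
  ∃ Γ : BalTensor (fun b : B => AddMonoidHom.mulRight (ρ b))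
      (fun b : B => AddMonoidHom.mulLeft (ρ b)) →+ BalTensor (ringRightAction π).act Y.act,
    (∀ a a', Γ (BalTensor.tmul _ _ a a') = leftMul π Y a (δ a')) ∧ Function.Bijective Γ

/-- The opposite of a left bialgebroid `(L, R, s, t, Δ, ε)` is the right bialgebroid
`(Lᵒᵖ, R, t, s, Δ, ε)`. The ring isomorphism `Φ : H ≃ Lᵒᵖ` is an isomorphism of right bialgebroids
over `R` from `K` to the opposite of `L`. -/
structure IsIsoToOpposite {L' : Type*} [Ring L'] (K : RightBialgebroid R H)
    (L : LeftBialgebroid R L') (Φ : H ≃+* L'ᵐᵒᵖ) : Prop where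
  source : ∀ r, (Φ (K.source r)).unop = L.target (op r)
  target : ∀ r, (Φ (K.target (op r))).unop = L.source r
  counit : ∀ h, L.coring.counit (Φ h).unop = K.coring.counit h
  comul : ∀ (h : H) (z : H ⊗[ℤ] H), BalTensor.proj _ _ z = K.coring.comul h →
    L.coring.comul (Φ h).unop = BalTensor.proj _ _
      (TensorProduct.map
        ((opAddEquiv.symm : L'ᵐᵒᵖ ≃+ L').toAddMonoidHom.comp
          (Φ.toAddEquiv.toAddMonoidHom)).toIntLinearMap
        ((opAddEquiv.symm : L'ᵐᵒᵖ ≃+ L').toAddMonoidHom.comp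
          (Φ.toAddEquiv.toAddMonoidHom)).toIntLinearMap z)

end Bialgebroid

/-! ## The tensor product of a presheaf and a functor -/

section Coend

variable {J : Type u} [Category.{u} J]

open Classical in
/-- The relations `G(t) y ⊗ x = y ⊗ F(t) x` in `⨁ X, G X ⊗ F X`. -/
def coendRel (G : Jᵒᵖ ⥤ AddCommGrpCat.{u}) (F : J ⥤ AddCommGrpCat.{u}) :
    AddSubgroup (⨁ X : J, (G.obj (Opposite.op X)) ⊗[ℤ] (F.obj X)) :=
  AddSubgroup.closure {z | ∃ (X Y : J) (t : X ⟶ Y) (y : G.obj (Opposite.op Y)) (x : F.obj X),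
    z = DirectSum.of (fun X : J => (G.obj (Opposite.op X)) ⊗[ℤ] (F.obj X)) X
          ((G.map t.op y) ⊗ₜ[ℤ] x) -
        DirectSum.of (fun X : J => (G.obj (Opposite.op X)) ⊗[ℤ] (F.obj X)) Y
          (y ⊗ₜ[ℤ] (F.map t x))}

/-- The tensor product over `J` of a contravariant and a covariant functor to abelian groups. -/
def CoendTensor (G : Jᵒᵖ ⥤ AddCommGrpCat.{u}) (F : J ⥤ AddCommGrpCat.{u}) : Type u :=
  (⨁ X : J, (G.obj (Opposite.op X)) ⊗[ℤ] (F.obj X)) ⧸ coendRel G F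

namespace CoendTensor

variable {G : Jᵒᵖ ⥤ AddCommGrpCat.{u}} {F : J ⥤ AddCommGrpCat.{u}}

noncomputable instance : AddCommGroup (CoendTensor G F) :=
  inferInstanceAs (AddCommGroup (_ ⧸ coendRel G F))

/-- The projection from the direct sum. -/
def proj (G : Jᵒᵖ ⥤ AddCommGrpCat.{u}) (F : J ⥤ AddCommGrpCat.{u}) :
    (⨁ X : J, (G.obj (Opposite.op X)) ⊗[ℤ] (F.obj X)) →+ CoendTensor G F :=
  QuotientAddGroup.mk' (coendRel G F)

open Classical in
/-- The element `y ⊗ x` at the object `X`, as a biadditive map. -/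
noncomputable def mkHom (G : Jᵒᵖ ⥤ AddCommGrpCat.{u}) (F : J ⥤ AddCommGrpCat.{u}) (X : J) :
    G.obj (Opposite.op X) →+ F.obj X →+ CoendTensor G F :=
  AddMonoidHom.mk' (fun y => AddMonoidHom.mk' (fun x => proj G F
      (DirectSum.of (fun X : J => (G.obj (Opposite.op X)) ⊗[ℤ] (F.obj X)) X (y ⊗ₜ[ℤ] x)))
      (fun x x' => by rw [TensorProduct.tmul_add, map_add, map_add]))
    (fun y y' => by
      ext x
      simp only [AddMonoidHom.add_apply, AddMonoidHom.mk'_apply]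
      rw [TensorProduct.add_tmul, map_add, map_add])

/-- The element `y ⊗ x` at the object `X`. -/
noncomputable def mk (G : Jᵒᵖ ⥤ AddCommGrpCat.{u}) (F : J ⥤ AddCommGrpCat.{u}) (X : J)
    (y : G.obj (Opposite.op X)) (x : F.obj X) : CoendTensor G F :=
  mkHom G F X y x

theorem mk_rel {X Y : J} (t : X ⟶ Y) (y : G.obj (Opposite.op Y)) (x : F.obj X) :
    mk G F X (G.map t.op y) x = mk G F Y y (F.map t x) := by
  classical
  rw [← sub_eq_zero]
  change proj G F _ - proj G F _ = 0
  rw [← map_sub]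
  exact (QuotientAddGroup.eq_zero_iff _).2 (AddSubgroup.subset_closure ⟨X, Y, t, y, x, rfl⟩)

theorem hom_ext {P : Type*} [AddCommGroup P] {f g : CoendTensor G F →+ P}
    (h : ∀ X y x, f (mk G F X y x) = g (mk G F X y x)) : f = g := by
  classical
  refine QuotientAddGroup.addMonoidHom_ext _ ?_
  refine DirectSum.addHom_ext' fun X => ?_
  ext z
  induction z using TensorProduct.induction_on with
  | zero => simp
  | tmul y x => exact h X y x
  | add z w hz hw => rw [map_add, map_add, hz, hw]

open Classical in
/-- The universal property of the tensor product over `J`. -/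
noncomputable def lift {P : Type*} [AddCommGroup P]
    (φ : ∀ X : J, G.obj (Opposite.op X) →+ F.obj X →+ P)
    (hφ : ∀ (X Y : J) (t : X ⟶ Y) (y : G.obj (Opposite.op Y)) (x : F.obj X),
      φ X (G.map t.op y) x = φ Y y (F.map t x)) : CoendTensor G F →+ P :=
  QuotientAddGroup.lift (coendRel G F)
    (DirectSum.toAddMonoid fun X => TensorProduct.liftAddHom (φ X) (fun k y x => by simp))
    (by
      rw [coendRel, AddSubgroup.closure_le]
      rintro _ ⟨X, Y, t, y, x, rfl⟩
      simp [hφ])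

theorem lift_mk {P : Type*} [AddCommGroup P]
    (φ : ∀ X : J, G.obj (Opposite.op X) →+ F.obj X →+ P)
    (hφ : ∀ (X Y : J) (t : X ⟶ Y) (y : G.obj (Opposite.op Y)) (x : F.obj X),
      φ X (G.map t.op y) x = φ Y y (F.map t x)) (X : J) (y : G.obj (Opposite.op X))
    (x : F.obj X) : lift φ hφ (mk G F X y x) = φ X y x := by
  classical
  change DirectSum.toAddMonoid (fun X => TensorProduct.liftAddHom (φ X) _) (DirectSum.of _ X _) = _
  rw [DirectSum.toAddMonoid_of, TensorProduct.liftAddHom_tmul]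

theorem mk_add_left (X : J) (y y' : G.obj (Opposite.op X)) (x : F.obj X) :
    mk G F X (y + y') x = mk G F X y x + mk G F X y' x := by
  simp [mk]

theorem mk_add_right (X : J) (y : G.obj (Opposite.op X)) (x x' : F.obj X) :
    mk G F X y (x + x') = mk G F X y x + mk G F X y x' := by
  simp [mk]

variable [MonoidalCategory J] [AbMonoidal G] [AbMonoidal F]

theorem mk_mul_rel {X X' Y Y' : J} (t : X ⟶ X') (s : Y ⟶ Y')
    (y : G.obj (Opposite.op X')) (y' : G.obj (Opposite.op Y')) (x : F.obj X) (x' : F.obj Y) :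
    mk G F (X ⊗ Y) (AbMonoidal.μ (Opposite.op X) (Opposite.op Y) (G.map t.op y) (G.map s.op y'))
      (AbMonoidal.μ X Y x x') =
    mk G F (X' ⊗ Y') (AbMonoidal.μ (Opposite.op X') (Opposite.op Y') y y')
      (AbMonoidal.μ X' Y' (F.map t x) (F.map s x')) := by
  rw [AbMonoidal.μ_natural, AbMonoidal.μ_natural]
  exact mk_rel (t ⊗ₘ s) _ _

/-- Left multiplication by `y ⊗ x`. -/
noncomputable def mulAux (X : J) (y : G.obj (Opposite.op X)) (x : F.obj X) :
    CoendTensor G F →+ CoendTensor G F :=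
  lift (fun Y => ((mkHom G F (X ⊗ Y)).comp
      (AbMonoidal.μ (Opposite.op X) (Opposite.op Y) y)).compl₂ (AbMonoidal.μ X Y x))
    (fun Y Y' s y' x' => by
      have h := mk_mul_rel (G := G) (F := F) (𝟙 X) s y y' x x'
      have hx : F.map (𝟙 X) x = x := by simp
      have hy : G.map (𝟙 X).op y = y := by simp
      rw [hx, hy] at h
      exact h)

theorem mulAux_mk (X Y : J) (y : G.obj (Opposite.op X)) (x : F.obj X)
    (y' : G.obj (Opposite.op Y)) (x' : F.obj Y) :
    mulAux X y x (mk G F Y y' x') =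
      mk G F (X ⊗ Y) (AbMonoidal.μ (Opposite.op X) (Opposite.op Y) y y')
        (AbMonoidal.μ X Y x x') :=
  lift_mk _ _ Y y' x'

/-- Multiplication `(y ⊗ x)(y' ⊗ x') = y y' ⊗ x x'`. -/
noncomputable def mulHom : CoendTensor G F →+ CoendTensor G F →+ CoendTensor G F :=
  lift (fun X => AddMonoidHom.mk' (fun y => AddMonoidHom.mk' (fun x => mulAux X y x)
      (fun x x' => hom_ext fun Y y' w => by
        rw [AddMonoidHom.add_apply, mulAux_mk, mulAux_mk, mulAux_mk, map_add,
          AddMonoidHom.add_apply, mk_add_right]))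
      (fun y₁ y₂ => by
        ext x : 1
        refine hom_ext fun Y y' w => ?_
        simp only [AddMonoidHom.mk'_apply, AddMonoidHom.add_apply]
        rw [mulAux_mk, mulAux_mk, mulAux_mk, map_add, AddMonoidHom.add_apply, mk_add_left]))
    (fun X X' t y x => hom_ext fun Y y' w => by
      simp only [AddMonoidHom.mk'_apply]
      rw [mulAux_mk, mulAux_mk]
      have h := mk_mul_rel (G := G) (F := F) t (𝟙 Y) y y' x w
      have hx : F.map (𝟙 Y) w = w := by simp
      have hy : G.map (𝟙 Y).op y' = y' := by simp
      rw [hx, hy] at h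
      exact h)

theorem mulHom_mk (X Y : J) (y : G.obj (Opposite.op X)) (x : F.obj X)
    (y' : G.obj (Opposite.op Y)) (x' : F.obj Y) :
    mulHom (mk G F X y x) (mk G F Y y' x') =
      mk G F (X ⊗ Y) (AbMonoidal.μ (Opposite.op X) (Opposite.op Y) y y')
        (AbMonoidal.μ X Y x x') := by
  rw [mulHom, lift_mk]
  exact mulAux_mk X Y y x y' x'

theorem mulHom_assoc (a b c : CoendTensor G F) :
    mulHom (mulHom a b) c = mulHom a (mulHom b c) := by
  have h : (mulHom (G := G) (F := F)).compr₂ mulHom =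
      (AddMonoidHom.compHom.comp (mulHom (G := G) (F := F))).compl₂ mulHom := by
    refine hom_ext fun X y x => hom_ext fun Y y' x' => hom_ext fun Z y'' x'' => ?_
    change mulHom (mulHom (mk G F X y x) (mk G F Y y' x')) (mk G F Z y'' x'') =
      mulHom (mk G F X y x) (mulHom (mk G F Y y' x') (mk G F Z y'' x''))
    rw [mulHom_mk, mulHom_mk, mulHom_mk, mulHom_mk, ← AbMonoidal.μ_assoc (F := F), ← mk_rel]
    congr 1
    have h := AbMonoidal.μ_assoc (F := G) y y' y''
    have h2 : (α_ (Opposite.op X) (Opposite.op Y) (Opposite.op Z)).hom ≫ (α_ X Y Z).hom.op = 𝟙 _ :=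
      (α_ (Opposite.op X) (Opposite.op Y) (Opposite.op Z)).hom_inv_id
    refine Eq.trans ?_ (congrArg (fun w => G.map (α_ X Y Z).hom.op w) h)
    rw [← ConcreteCategory.comp_apply, ← G.map_comp, h2]
    simp
  exact DFunLike.congr_fun (DFunLike.congr_fun (DFunLike.congr_fun h a) b) c

theorem one_mulHom (a : CoendTensor G F) :
    mulHom (mk G F (𝟙_ J) (AbMonoidal.one (F := G)) (AbMonoidal.one (F := F))) a = a := by
  have h : mulHom (mk G F (𝟙_ J) (AbMonoidal.one (F := G)) (AbMonoidal.one (F := F))) =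
      AddMonoidHom.id _ := by
    refine hom_ext fun X y x => ?_
    rw [mulHom_mk, AddMonoidHom.id_apply]
    conv_rhs => rw [← AbMonoidal.one_μ (F := F) x, ← mk_rel]
    congr 1
    have h := AbMonoidal.one_μ (F := G) y
    conv_rhs => rw [← h, ← ConcreteCategory.comp_apply, ← G.map_comp]
    have h2 : (λ_ (Opposite.op X)).hom ≫ (λ_ X).hom.op = 𝟙 _ :=
      (λ_ (Opposite.op X)).hom_inv_id
    rw [h2]
    simp
  exact DFunLike.congr_fun h a

theorem mulHom_one (a : CoendTensor G F) :
    mulHom a (mk G F (𝟙_ J) (AbMonoidal.one (F := G)) (AbMonoidal.one (F := F))) = a := by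
  have h : mulHom.flip (mk G F (𝟙_ J) (AbMonoidal.one (F := G)) (AbMonoidal.one (F := F))) =
      AddMonoidHom.id _ := by
    refine hom_ext fun X y x => ?_
    rw [AddMonoidHom.flip_apply, mulHom_mk, AddMonoidHom.id_apply]
    conv_rhs => rw [← AbMonoidal.μ_one (F := F) x, ← mk_rel]
    congr 1
    have h := AbMonoidal.μ_one (F := G) y
    conv_rhs => rw [← h, ← ConcreteCategory.comp_apply, ← G.map_comp]
    have h2 : (ρ_ (Opposite.op X)).hom ≫ (ρ_ X).hom.op = 𝟙 _ :=
      (ρ_ (Opposite.op X)).hom_inv_id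
    rw [h2]
    simp
  exact DFunLike.congr_fun h a

noncomputable instance : Ring (CoendTensor G F) :=
  { (inferInstance : AddCommGroup (CoendTensor G F)) with
    mul := fun a b => mulHom a b
    one := mk G F (𝟙_ J) (AbMonoidal.one (F := G)) (AbMonoidal.one (F := F))
    mul_assoc := mulHom_assoc
    one_mul := one_mulHom
    mul_one := mulHom_one
    left_distrib := fun a b c => map_add (mulHom a) b c
    right_distrib := fun a b c => by
      change mulHom (a + b) c = mulHom a c + mulHom b c
      rw [map_add, AddMonoidHom.add_apply]
    zero_mul := fun a => by
      change mulHom 0 a = 0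
      rw [map_zero, AddMonoidHom.zero_apply]
    mul_zero := fun a => map_zero (mulHom a) }

theorem mk_mul_mk (X Y : J) (y : G.obj (Opposite.op X)) (x : F.obj X)
    (y' : G.obj (Opposite.op Y)) (x' : F.obj Y) :
    mk G F X y x * mk G F Y y' x' =
      mk G F (X ⊗ Y) (AbMonoidal.μ (Opposite.op X) (Opposite.op Y) y y')
        (AbMonoidal.μ X Y x x') := mulHom_mk X Y y x y' x'

theorem mk_eq_mk_mul_mk {X Y Z : J} (t : X ⊗ Y ⟶ Z) {y : G.obj (Opposite.op X)} {x : F.obj X}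
    {y' : G.obj (Opposite.op Y)} {x' : F.obj Y} {w : G.obj (Opposite.op Z)} {v : F.obj Z}
    (hw : G.map t.op w = AbMonoidal.μ (Opposite.op X) (Opposite.op Y) y y')
    (hv : F.map t (AbMonoidal.μ X Y x x') = v) :
    mk G F Z w v = mk G F X y x * mk G F Y y' x' := by
  rw [mk_mul_mk, ← hv, ← mk_rel, hw]

theorem one_def : (1 : CoendTensor G F) =
    mk G F (𝟙_ J) (AbMonoidal.one (F := G)) (AbMonoidal.one (F := F)) := rfl

end CoendTensor
end Coend

/-! ## The basic presheaf, fiber functors and field algebras -/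

section FieldAlgebra

variable {A B : Type u} [Ring A] [Ring B]

/-- `σ` is implementable in the extension `ρ : B → A`. -/
def Implementable (ρ : B →+* A) (σ : B →+* B) : Prop :=
  ∃ (n : ℕ) (f : Fin n → intertwiner ρ (ρ.comp σ)) (f' : Fin n → intertwiner (ρ.comp σ) ρ),
    ∀ b, ρ (σ b) = ∑ i, (f i : A) * ρ b * (f' i : A)

variable (C : ObjectProperty (EndCat B))

/-- The basic presheaf `Υ` on `C`: the constant object map `α ↦ B`, with arrows acting by right
multiplication. -/
def basicPresheaf : (C.FullSubcategory)ᵒᵖ ⥤ AddCommGrpCat.{u} where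
  obj _ := AddCommGrpCat.of B
  map t := AddCommGrpCat.ofHom (AddMonoidHom.mulRight (t.unop.hom.1 : B))
  map_id _ := by
    ext b
    exact mul_one b
  map_comp t s := by
    ext b
    exact (mul_assoc b _ _).symm

/-- The functor `F(α) = Hom(ρ, ρα)`, with `F(t) x = ρ(t) x`. -/
def fiberFunctor (ρ : B →+* A) : C.FullSubcategory ⥤ AddCommGrpCat.{u} where
  obj α := AddCommGrpCat.of (intertwiner ρ (ρ.comp α.obj.hom))
  map {α β} t := AddCommGrpCat.ofHom (AddMonoidHom.mk'
    (fun x => (⟨ρ t.hom.1 * x.1, fun b => by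
      have h := t.hom.2 b
      have hx := x.2 b
      simp only [RingHom.comp_apply] at hx ⊢
      rw [mul_assoc, hx, ← mul_assoc, ← map_mul, h, map_mul, mul_assoc]⟩ :
        intertwiner ρ (ρ.comp β.obj.hom)))
    (fun x y => Subtype.ext (mul_add _ _ _)))
  map_id α := by
    ext x
    change ρ 1 * x.1 = x.1
    rw [map_one, one_mul]
  map_comp t s := by
    ext x
    change ρ (s.hom.1 * t.hom.1) * x.1 = ρ s.hom.1 * (ρ t.hom.1 * x.1)
    rw [map_mul, mul_assoc]

/-- The dual functor `α ↦ Hom(ρα, ρ)`, contravariant, with `t` acting by `f ↦ f ρ(t)`. -/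
def dualFunctor (ρ : B →+* A) : (C.FullSubcategory)ᵒᵖ ⥤ AddCommGrpCat.{u} where
  obj α := AddCommGrpCat.of (intertwiner (ρ.comp α.unop.obj.hom) ρ)
  map {β α} t := AddCommGrpCat.ofHom (AddMonoidHom.mk'
    (fun f => (⟨f.1 * ρ t.unop.hom.1, fun b => by
      have h := t.unop.hom.2 b
      have hf := f.2 b
      simp only [RingHom.comp_apply] at hf ⊢
      rw [mul_assoc, ← map_mul, h, map_mul, ← mul_assoc, hf, mul_assoc]⟩ :
        intertwiner (ρ.comp α.unop.obj.hom) ρ))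
    (fun x y => Subtype.ext (add_mul _ _ _)))
  map_id α := by
    ext f
    change f.1 * ρ 1 = f.1
    rw [map_one, mul_one]
  map_comp t s := by
    ext f
    change f.1 * ρ (t.unop.hom.1 * s.unop.hom.1) = f.1 * ρ t.unop.hom.1 * ρ s.unop.hom.1
    rw [map_mul, mul_assoc]

variable [C.IsMonoidal]

/-- The map `b ⊗ b' ↦ b α(b')`. -/
def mulPresheaf (α : B →+* B) : B →+ B →+ B :=
  AddMonoidHom.mk' (fun b => (AddMonoidHom.mulLeft b).comp (α : B →+ B))
    (fun b b' => by ext c; exact add_mul b b' (α c))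

/-- The map `Hom(ρ, ρα) ⊗ Hom(ρ, ρβ) → Hom(ρ, ραβ)`, `x ⊗ y ↦ x y`. -/
def mulFiber (ρ : B →+* A) (α β : B →+* B) : intertwiner ρ (ρ.comp α) →+
    intertwiner ρ (ρ.comp β) →+ intertwiner ρ (ρ.comp (α.comp β)) :=
  AddMonoidHom.mk' (fun x => AddMonoidHom.mk' (fun y => ⟨x.1 * y.1, fun b => by
      have hx : x.1 * ρ (β b) = ρ (α (β b)) * x.1 := x.2 (β b)
      have hy : y.1 * ρ b = ρ (β b) * y.1 := y.2 b
      change x.1 * y.1 * ρ b = ρ (α (β b)) * (x.1 * y.1)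
      rw [mul_assoc, hy, ← mul_assoc, hx, mul_assoc]⟩)
      (fun y y' => Subtype.ext (mul_add _ _ _)))
    (fun x x' => AddMonoidHom.ext fun y => Subtype.ext (add_mul _ _ _))

/-- The map `Hom(ρα, ρ) ⊗ Hom(ρβ, ρ) → Hom(ραβ, ρ)`, `f ⊗ g ↦ g f`. -/
def mulDual (ρ : B →+* A) (α β : B →+* B) : intertwiner (ρ.comp α) ρ →+
    intertwiner (ρ.comp β) ρ →+ intertwiner (ρ.comp (α.comp β)) ρ :=
  AddMonoidHom.mk' (fun f => AddMonoidHom.mk' (fun g => ⟨g.1 * f.1, fun b => by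
      have hf : f.1 * ρ (α (β b)) = ρ (β b) * f.1 := f.2 (β b)
      have hg : g.1 * ρ (β b) = ρ b * g.1 := g.2 b
      change g.1 * f.1 * ρ (α (β b)) = ρ b * (g.1 * f.1)
      rw [mul_assoc, hf, ← mul_assoc, hg, mul_assoc]⟩)
      (fun y y' => Subtype.ext (add_mul _ _ _)))
    (fun x x' => AddMonoidHom.ext fun y => Subtype.ext (mul_add _ _ _))

/-- The monoidal structure `b ⊗ b' ↦ b α(b')` of the basic presheaf. -/
instance : AbMonoidal (basicPresheaf C) where
  μ α _ := mulPresheaf (B := B) α.unop.obj.hom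
  one := (1 : B)
  μ_natural {α α' β β'} t s := fun (b b' : B) => by
    change b * t.unop.hom.1 * α'.unop.obj.hom (b' * s.unop.hom.1) =
      b * α.unop.obj.hom b' * (t.unop.hom.1 * α'.unop.obj.hom s.unop.hom.1)
    rw [map_mul, mul_assoc, ← mul_assoc t.unop.hom.1, t.unop.hom.2 b']
    simp only [mul_assoc]
  μ_assoc {α β γ} := fun (b b' b'' : B) => by
    change b * α.unop.obj.hom b' * α.unop.obj.hom (β.unop.obj.hom b'') * 1 =
      b * α.unop.obj.hom (b' * β.unop.obj.hom b'')
    rw [map_mul, mul_one, mul_assoc]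
  one_μ {α} := fun (b : B) => by
    change 1 * b * 1 = b
    rw [one_mul, mul_one]
  μ_one {α} := fun (b : B) => by
    change b * α.unop.obj.hom 1 * 1 = b
    rw [map_one, mul_one, mul_one]

/-- The monoidal structure `x ⊗ y ↦ x y` of the fiber functor. -/
instance (ρ : B →+* A) : AbMonoidal (fiberFunctor C ρ) where
  μ α β := mulFiber ρ α.obj.hom β.obj.hom
  one := (⟨1, fun b => (one_mul _).trans (mul_one _).symm⟩ : intertwiner ρ (ρ.comp (RingHom.id B)))
  μ_natural {α α' β β'} t s x y := Subtype.ext (by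
    have hx : x.1 * ρ s.hom.1 = ρ (α.obj.hom s.hom.1) * x.1 := x.2 s.hom.1
    change ρ t.hom.1 * x.1 * (ρ s.hom.1 * y.1) =
      ρ (t.hom.1 * α.obj.hom s.hom.1) * (x.1 * y.1)
    rw [map_mul, mul_assoc, ← mul_assoc x.1, hx]
    simp only [mul_assoc])
  μ_assoc {α β γ} x y z := Subtype.ext (by
    change ρ 1 * (x.1 * y.1 * z.1) = x.1 * (y.1 * z.1)
    rw [map_one, one_mul, mul_assoc])
  one_μ {α} x := Subtype.ext (by
    change ρ 1 * (1 * x.1) = x.1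
    rw [map_one, one_mul, one_mul])
  μ_one {α} x := Subtype.ext (by
    change ρ 1 * (x.1 * 1) = x.1
    rw [map_one, one_mul, mul_one])

/-- The monoidal structure `f ⊗ g ↦ g f` of the dual functor. -/
instance (ρ : B →+* A) : AbMonoidal (dualFunctor C ρ) where
  μ α β := mulDual ρ α.unop.obj.hom β.unop.obj.hom
  one := (⟨1, fun b => (one_mul _).trans (mul_one _).symm⟩ : intertwiner (ρ.comp (RingHom.id B)) ρ)
  μ_natural {α α' β β'} t s f g := Subtype.ext (by
    have hf : f.1 * ρ (α.unop.obj.hom s.unop.hom.1) = ρ s.unop.hom.1 * f.1 := f.2 s.unop.hom.1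
    have ht : t.unop.hom.1 * α'.unop.obj.hom s.unop.hom.1 =
      α.unop.obj.hom s.unop.hom.1 * t.unop.hom.1 := t.unop.hom.2 s.unop.hom.1
    change g.1 * ρ s.unop.hom.1 * (f.1 * ρ t.unop.hom.1) =
      g.1 * f.1 * ρ (t.unop.hom.1 * α'.unop.obj.hom s.unop.hom.1)
    rw [ht, map_mul, mul_assoc, ← mul_assoc (ρ s.unop.hom.1), ← hf]
    simp only [mul_assoc])
  μ_assoc {α β γ} f g h := Subtype.ext (by
    change h.1 * (g.1 * f.1) * ρ 1 = h.1 * g.1 * f.1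
    rw [map_one, mul_one, mul_assoc])
  one_μ {α} f := Subtype.ext (by
    change f.1 * 1 * ρ 1 = f.1
    rw [map_one, mul_one, mul_one])
  μ_one {α} f := Subtype.ext (by
    change 1 * f.1 * ρ 1 = f.1
    rw [map_one, mul_one, one_mul])

/-- The field algebra `Υ ⊗_C F` of a monoidal functor `F`. -/
abbrev FieldAlgebra (F : C.FullSubcategory ⥤ AddCommGrpCat.{u}) : Type u :=
  CoendTensor (basicPresheaf C) F

/-- The element `b ⊗_α x` of a field algebra. -/
noncomputable abbrev fieldMk (F : C.FullSubcategory ⥤ AddCommGrpCat.{u}) (α : C.FullSubcategory)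
    (b : B) (x : F.obj α) : FieldAlgebra C F :=
  CoendTensor.mk (basicPresheaf C) F α b x

/-- The field algebra extension `ρ_F : B → Υ ⊗_C F`, `b ↦ b ⊗ 1`. -/
noncomputable def fieldExt (F : C.FullSubcategory ⥤ AddCommGrpCat.{u}) [AbMonoidal F] :
    B →+* FieldAlgebra C F where
  toFun b := fieldMk C F (𝟙_ C.FullSubcategory) b AbMonoidal.one
  map_one' := rfl
  map_zero' := by
    change CoendTensor.mkHom (basicPresheaf C) F (𝟙_ C.FullSubcategory) (0 : B) _ = 0
    exact (DFunLike.congr_fun (map_zero _) _).trans rfl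
  map_add' b b' := CoendTensor.mk_add_left _ _ _ _
  map_mul' b b' := CoendTensor.mk_eq_mk_mul_mk (λ_ (𝟙_ C.FullSubcategory)).hom
    (mul_one (b * b')) (AbMonoidal.one_μ (F := F) (X := 𝟙_ C.FullSubcategory) AbMonoidal.one)

/-- The element `f ⊗_α x` of `F^l ⊗_C F` for `F = Hom(ρ, ρ-)`. -/
noncomputable abbrev dualMk (ρ : B →+* A) (α : C.FullSubcategory)
    (f : intertwiner (ρ.comp α.obj.hom) ρ) (x : intertwiner ρ (ρ.comp α.obj.hom)) :
    CoendTensor (dualFunctor C ρ) (fiberFunctor C ρ) :=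
  CoendTensor.mk (dualFunctor C ρ) (fiberFunctor C ρ) α f x

/-- The ring homomorphism `π_F : R → Υ ⊗_C F`, `r ↦ 1 ⊗ r`, for `F = Hom(ρ, ρ-)` and
`R = F(ι) = End(ρ)`. -/
noncomputable def fieldBase (ρ : B →+* A) : endRing ρ →+* FieldAlgebra C (fiberFunctor C ρ) where
  toFun r := fieldMk C (fiberFunctor C ρ) (𝟙_ C.FullSubcategory) 1
    (⟨r.1, r.2⟩ : intertwiner ρ (ρ.comp (RingHom.id B)))
  map_one' := rfl
  map_zero' := map_zero (CoendTensor.mkHom (basicPresheaf C) (fiberFunctor C ρ)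
    (𝟙_ C.FullSubcategory) (1 : B))
  map_add' r r' := CoendTensor.mk_add_right (F := fiberFunctor C ρ) _ _ _ _
  map_mul' r r' := CoendTensor.mk_eq_mk_mul_mk (F := fiberFunctor C ρ)
    (λ_ (𝟙_ C.FullSubcategory)).hom
    (by
      change (1 : B) * 1 = 1 * (RingHom.id B) 1
      simp)
    (Subtype.ext (by
      change ρ 1 * (r.1 * r'.1) = r.1 * r'.1
      rw [map_one, one_mul]))

theorem fieldMk_mem (F : C.FullSubcategory ⥤ AddCommGrpCat.{u}) [AbMonoidal F]
    (α : C.FullSubcategory) (x : F.obj α) :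
    fieldMk C F α 1 x ∈ intertwiner (fieldExt C F) ((fieldExt C F).comp α.obj.hom) := by
  intro b
  have h1 : fieldMk C F α (α.obj.hom b) x = fieldMk C F α 1 x * fieldExt C F b :=
    CoendTensor.mk_eq_mk_mul_mk (ρ_ α).hom
      (by
        change α.obj.hom b * 1 = 1 * α.obj.hom b
        simp)
      (AbMonoidal.μ_one x)
  have h2 : fieldMk C F α (α.obj.hom b) x = fieldExt C F (α.obj.hom b) * fieldMk C F α 1 x :=
    CoendTensor.mk_eq_mk_mul_mk (λ_ α).hom
      (by
        change α.obj.hom b * 1 = α.obj.hom b * (RingHom.id B) 1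
        simp)
      (AbMonoidal.one_μ x)
  exact h1.symm.trans h2

/-- The unit `η_F : F → Hom(ρ_F, ρ_F -)`, `x ↦ 1 ⊗_α x`, of the adjunction between monoidal
functors and extensions of `B`. -/
noncomputable def fieldUnit (F : C.FullSubcategory ⥤ AddCommGrpCat.{u}) [AbMonoidal F] :
    F ⟶ fiberFunctor C (fieldExt C F) where
  app α := AddCommGrpCat.ofHom (AddMonoidHom.mk'
    (fun x => (⟨fieldMk C F α 1 x, fieldMk_mem C F α x⟩ :
      intertwiner (fieldExt C F) ((fieldExt C F).comp α.obj.hom)))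
    (fun x y => Subtype.ext (CoendTensor.mk_add_right _ _ _ _)))
  naturality α β t := by
    ext x
    refine Subtype.ext ?_
    change fieldMk C F β 1 (F.map t x) = fieldExt C F t.hom.1 * fieldMk C F α 1 x
    have h : fieldMk C F α t.hom.1 x = fieldExt C F t.hom.1 * fieldMk C F α 1 x :=
      CoendTensor.mk_eq_mk_mul_mk (λ_ α).hom
        (by
          change t.hom.1 * 1 = t.hom.1 * (RingHom.id B) 1
          simp)
        (AbMonoidal.one_μ x)
    refine Eq.trans ?_ h
    refine (CoendTensor.mk_rel (G := basicPresheaf C) t (1 : B) x).symm.trans ?_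
    exact congrArg (fun b : B => fieldMk C F α b x) (one_mul t.hom.1)

/-- The biadditive map `b ⊗ x ↦ ρ(b) x`. -/
def counitAux (ρ : B →+* A) (α : B →+* B) : B →+ intertwiner ρ (ρ.comp α) →+ A :=
  AddMonoidHom.mk' (fun b => (AddMonoidHom.mulLeft (ρ b)).comp
      (intertwiner ρ (ρ.comp α)).subtype)
    (fun b b' => by
      ext x
      change ρ (b + b') * x.1 = ρ b * x.1 + ρ b' * x.1
      rw [map_add, add_mul])

/-- The additive map underlying the counit. -/
noncomputable def fieldCounitHom (ρ : B →+* A) : FieldAlgebra C (fiberFunctor C ρ) →+ A :=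
  CoendTensor.lift (G := basicPresheaf C) (F := fiberFunctor C ρ)
    (fun α => counitAux ρ α.obj.hom)
    (fun α β t => fun (b : B) x => by
      change ρ (b * t.hom.1) * x.1 = ρ b * (ρ t.hom.1 * x.1)
      rw [map_mul, mul_assoc])

theorem fieldCounitHom_mk (ρ : B →+* A) (α : C.FullSubcategory) (b : B)
    (x : intertwiner ρ (ρ.comp α.obj.hom)) :
    fieldCounitHom C ρ (fieldMk C (fiberFunctor C ρ) α b x) = ρ b * x.1 :=
  CoendTensor.lift_mk (G := basicPresheaf C) (F := fiberFunctor C ρ) _ _ α b x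

/-- The counit `ε_ρ : Υ ⊗_C F → A`, `b ⊗_α x ↦ ρ(b) x`, for `F = Hom(ρ, ρ-)`. -/
noncomputable def fieldCounit (ρ : B →+* A) : FieldAlgebra C (fiberFunctor C ρ) →+* A where
  __ := fieldCounitHom C ρ
  map_one' := by
    change fieldCounitHom C ρ (fieldMk C (fiberFunctor C ρ) _ 1 _) = 1
    refine (fieldCounitHom_mk C ρ _ _ _).trans ?_
    change ρ 1 * 1 = 1
    simp
  map_mul' a a' := by
    have h : (CoendTensor.mulHom).compr₂ (fieldCounitHom C ρ) =
        (AddMonoidHom.mul.comp (fieldCounitHom C ρ)).compl₂ (fieldCounitHom C ρ) := by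
      refine CoendTensor.hom_ext fun α (b : B) x => CoendTensor.hom_ext fun β (b' : B) x' => ?_
      have hx : x.1 * ρ b' = ρ (α.obj.hom b') * x.1 := x.2 b'
      change fieldCounitHom C ρ (CoendTensor.mulHom (fieldMk C (fiberFunctor C ρ) α b x)
        (fieldMk C (fiberFunctor C ρ) β b' x')) =
        fieldCounitHom C ρ (fieldMk C (fiberFunctor C ρ) α b x) *
          fieldCounitHom C ρ (fieldMk C (fiberFunctor C ρ) β b' x')
      refine Eq.trans ?_ (congrArg₂ (· * ·) (fieldCounitHom_mk C ρ α b x)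
        (fieldCounitHom_mk C ρ β b' x')).symm
      refine (congrArg (fieldCounitHom C ρ) (CoendTensor.mulHom_mk α β _ _ _ _)).trans ?_
      refine (fieldCounitHom_mk C ρ (α ⊗ β) (b * α.obj.hom b')
        (mulFiber ρ α.obj.hom β.obj.hom x x')).trans ?_
      change ρ (b * α.obj.hom b') * (x.1 * x'.1) = ρ b * x.1 * (ρ b' * x'.1)
      rw [map_mul, mul_assoc (ρ b) x.1, ← mul_assoc x.1, hx]
      simp only [mul_assoc]
    exact DFunLike.congr_fun (DFunLike.congr_fun h a) a'

theorem fieldCounit_mk (ρ : B →+* A) (α : C.FullSubcategory) (b : B)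
    (x : intertwiner ρ (ρ.comp α.obj.hom)) :
    fieldCounit C ρ (fieldMk C (fiberFunctor C ρ) α b x) = ρ b * x.1 :=
  fieldCounitHom_mk C ρ α b x

/-! ## The bialgebroids and coactions -/

/-- A direct summand diagram `ρα → ρ → ρα`, with arrows `p i` and `q i` and `∑ q i p i = 1`. -/
def IsSummandDiagram {ρ : B →+* A} {α : B →+* B} {n : ℕ}
    (p : Fin n → intertwiner (ρ.comp α) ρ) (q : Fin n → intertwiner ρ (ρ.comp α)) : Prop :=
  ∑ i, (q i : A) * (p i : A) = 1

/-- The total ring `F^l ⊗_C F` for `F = Hom(ρ, ρ-)`. -/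
abbrev DualCoend (ρ : B →+* A) : Type u := CoendTensor (dualFunctor C ρ) (fiberFunctor C ρ)

/-- The structure maps of the right bialgebroid `F^l ⊗_C F` over `R = End(ρ)`: source
`r ↦ 1 ⊗ r`, target `r ↦ r ⊗ 1`, counit `f ⊗ x ↦ f x` and coproduct
`f ⊗_α x ↦ ∑ (f ⊗_α q i) ⊗ (p i ⊗_α x)`, for any direct summand diagram `ρα → ρ → ρα`. -/
structure IsDualBialgebroid (ρ : B →+* A)
    (K : RightBialgebroid (endRing ρ) (DualCoend C ρ)) : Prop where
  source : ∀ r : endRing ρ, K.source r = dualMk C ρ (𝟙_ C.FullSubcategory)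
    ⟨1, (one_mem (endRing ρ))⟩ ⟨r.1, r.2⟩
  target : ∀ r : endRing ρ, K.target (op r) = dualMk C ρ (𝟙_ C.FullSubcategory)
    ⟨r.1, r.2⟩ ⟨1, (one_mem (endRing ρ))⟩
  counit : ∀ (α : C.FullSubcategory) (f : intertwiner (ρ.comp α.obj.hom) ρ)
    (x : intertwiner ρ (ρ.comp α.obj.hom)),
    (K.coring.counit (dualMk C ρ α f x) : A) = f.1 * x.1
  comul : ∀ (α : C.FullSubcategory) (n : ℕ) (p : Fin n → intertwiner (ρ.comp α.obj.hom) ρ)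
    (q : Fin n → intertwiner ρ (ρ.comp α.obj.hom)), IsSummandDiagram p q →
    ∀ (f : intertwiner (ρ.comp α.obj.hom) ρ) (x : intertwiner ρ (ρ.comp α.obj.hom)),
    K.coring.comul (dualMk C ρ α f x) =
      ∑ i, BalTensor.tmul _ _ (dualMk C ρ α f (q i)) (dualMk C ρ α (p i) x)

/-- The coaction `b ⊗_α x ↦ ∑ (b ⊗_α q i) ⊗ (p i ⊗_α x)` of `F^l ⊗_C F` on the field algebra. -/
def IsFieldCoaction (ρ : B →+* A) (K : RightBialgebroid (endRing ρ) (DualCoend C ρ))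
    (δ : K.ComoduleAlgebra (fieldBase C ρ)) : Prop :=
  ∀ (α : C.FullSubcategory) (n : ℕ) (p : Fin n → intertwiner (ρ.comp α.obj.hom) ρ)
    (q : Fin n → intertwiner ρ (ρ.comp α.obj.hom)), IsSummandDiagram p q →
    ∀ (b : B) (x : intertwiner ρ (ρ.comp α.obj.hom)),
    δ.coact (fieldMk C (fiberFunctor C ρ) α b x) =
      ∑ i, BalTensor.tmul _ _ (fieldMk C (fiberFunctor C ρ) α b (q i)) (dualMk C ρ α (p i) x)

variable {l : A →+* B} {r : B →+* A}

/-- The element `ρ(e) h ρ(e λ(q m))` of `End(ρλ)`. -/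
def comulFst (adj : RingAdjunction l r) (h : endRing (r.comp l))
    (q : intertwiner r (r.comp (l.comp r))) : endRing (r.comp l) :=
  ⟨r adj.e * h.1 * r (adj.e * l (q.1 * adj.m)), fun a => by
    have he : ∀ b, adj.e * l (r b) = b * adj.e := adj.e_mem
    have hm : adj.m * a = r (l a) * adj.m := adj.m_mem a
    have hq : q.1 * r (l a) = r (l (r (l a))) * q.1 := q.2 (l a)
    have hh : h.1 * r (l (r (l a))) = r (l (r (l a))) * h.1 := h.2 (r (l a))
    have hu : adj.e * l (q.1 * adj.m) * l a = l (r (l a)) * (adj.e * l (q.1 * adj.m)) := by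
      rw [mul_assoc, ← map_mul, mul_assoc q.1, hm, ← mul_assoc q.1, hq, mul_assoc, map_mul,
        ← mul_assoc, he, mul_assoc]
    change r adj.e * h.1 * r (adj.e * l (q.1 * adj.m)) * r (l a) =
      r (l a) * (r adj.e * h.1 * r (adj.e * l (q.1 * adj.m)))
    rw [mul_assoc, ← map_mul, hu, map_mul, ← mul_assoc, mul_assoc (r adj.e), hh, ← mul_assoc,
      ← map_mul, he, map_mul]
    simp only [mul_assoc]⟩

/-- The element `p ρλ(m)` of `End(ρλ)`. -/
def comulSnd (adj : RingAdjunction l r) (p : intertwiner (r.comp (l.comp r)) r) :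
    endRing (r.comp l) :=
  ⟨p.1 * r (l adj.m), fun a => by
    have hm : adj.m * a = r (l a) * adj.m := adj.m_mem a
    have hp : p.1 * r (l (r (l a))) = r (l a) * p.1 := p.2 (l a)
    change p.1 * r (l adj.m) * r (l a) = r (l a) * (p.1 * r (l adj.m))
    rw [mul_assoc, ← map_mul, ← map_mul, hm, map_mul, map_mul, ← mul_assoc, hp, mul_assoc]⟩

/-- The structure maps of the left bialgebroid `End(ρλ)` over `R = End(ρ)`: source `r ↦ r`, target
`r ↦ ρ(e λ(r m))`, counit `h ↦ ρ(e) h m` and coproduct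
`h ↦ ∑ ρ(e) h ρ(e λ(q i m)) ⊗ p i ρλ(m)`, for any direct summand diagram `ρλρ → ρ → ρλρ`. -/
structure IsEndBialgebroid (adj : RingAdjunction l r)
    (L : LeftBialgebroid (endRing r) (endRing (r.comp l))) : Prop where
  source : ∀ a : endRing r, (L.source a : A) = a
  target : ∀ a : endRing r, (L.target (op a) : A) = r (adj.e * l (a * adj.m))
  counit : ∀ h : endRing (r.comp l), (L.coring.counit h : A) = r adj.e * h * adj.m
  comul : ∀ (n : ℕ) (p : Fin n → intertwiner (r.comp (l.comp r)) r)
    (q : Fin n → intertwiner r (r.comp (l.comp r))), IsSummandDiagram p q →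
    ∀ h : endRing (r.comp l), L.coring.comul h =
      ∑ i, BalTensor.tmul _ _ (comulFst adj h (q i)) (comulSnd adj (p i))

/-- The coaction `a ↦ ∑ ρ(e λ(a)) q i ⊗ p i ρλ(m)` of `End(ρλ)` on `A`. -/
def IsEndCoaction (adj : RingAdjunction l r)
    (L : LeftBialgebroid (endRing r) (endRing (r.comp l)))
    (δ : L.ComoduleAlgebra (endRing r).subtype) : Prop :=
  ∀ (n : ℕ) (p : Fin n → intertwiner (r.comp (l.comp r)) r)
    (q : Fin n → intertwiner r (r.comp (l.comp r))), IsSummandDiagram p q →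
    ∀ a : A, δ.coact a =
      ∑ i, BalTensor.tmul _ _ (r (adj.e * l a) * (q i).1) (comulSnd adj (p i))

end FieldAlgebra

end FieldAlg

/-!
Every element of `End(ρλ)` is a matrix coefficient `f ρ(e λ(x m))` with `f ∈ Hom(ρα, ρ)` and
`x ∈ Hom(ρ, ρα)`; the choice `α = λρ` and `x = m` already suffices. Since `λρ` represents `F`, with
universal element `m`, every element of a coend against `F` is likewise concentrated at `λρ` in the
form `y ⊗ m`. This identifies `Υ ⊗_C F` with `A` and `F^l ⊗_C F` with the opposite of `End(ρλ)`.

A direct summand diagram `(p, q)` for `λρ` gives a dual basis `p_i ρλ(m)` of the left `R`-module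
`End(ρλ)`, so that the maps `a ⊗ h ↦ a ρ(e) h` on `A ⊗_R End(ρλ)` and `h ⊗ h' ↦ ρ(e) h ρλ(h')` on
`End(ρλ) ⊗_R End(ρλ)` are injective into `A`. Through them the coaction becomes `a ↦ ρ(e λ(a))` and
the coproduct becomes `h ↦ h ρ(e)`, neither of which involves the diagram; the axioms of a comodule
algebra and of a left bialgebroid turn into identities between `e`, `m` and intertwiners in `A`. The
structures on `F^l ⊗_C F` and `Υ ⊗_C F` are transported from those on `End(ρλ)` and `A`.
-/

namespace FieldAlg

/-! ## Balanced tensor products and dual bases -/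

namespace BalTensor

section Map

variable {R M N P M' N' M'' N'' : Type*} [AddCommGroup M] [AddCommGroup N] [AddCommGroup P]
  [AddCommGroup M'] [AddCommGroup N'] [AddCommGroup M''] [AddCommGroup N'']
  {ra : R → M →+ M} {la : R → N →+ N} {ra' : R → M' →+ M'} {la' : R → N' →+ N'}
  {ra'' : R → M'' →+ M''} {la'' : R → N'' →+ N''}

theorem tmul_sum {ι : Type*} (s : Finset ι) (m : M) (n : ι → N) :
    tmul ra la m (∑ i ∈ s, n i) = ∑ i ∈ s, tmul ra la m (n i) :=
  map_sum (tmulHom ra la m) n s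

theorem sum_tmul {ι : Type*} (s : Finset ι) (m : ι → M) (n : N) :
    tmul ra la (∑ i ∈ s, m i) n = ∑ i ∈ s, tmul ra la (m i) n :=
  map_sum ((tmulHom ra la).flip n) m s

theorem hom_congr {f g : BalTensor ra la →+ P}
    (h : ∀ m n, f (tmul ra la m n) = g (tmul ra la m n)) (z : BalTensor ra la) : f z = g z :=
  DFunLike.congr_fun (hom_ext h) z

theorem map_map (f : M →+ M') (g : N →+ N') (hf : ∀ r m, f (ra r m) = ra' r (f m))
    (hg : ∀ r n, g (la r n) = la' r (g n)) (f' : M' →+ M'') (g' : N' →+ N'')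
    (hf' : ∀ r m, f' (ra' r m) = ra'' r (f' m)) (hg' : ∀ r n, g' (la' r n) = la'' r (g' n))
    (z : BalTensor ra la) :
    map f' g' hf' hg' (map f g hf hg z) =
      map (f'.comp f) (g'.comp g) (fun r m => by simp [hf, hf']) (fun r n => by simp [hg, hg']) z :=
  hom_congr (f := (map f' g' hf' hg').comp (map f g hf hg)) (g := map (f'.comp f) (g'.comp g) _ _)
    (fun _ _ => rfl) z

theorem map_eq_self {f : M →+ M} {g : N →+ N} (hf : ∀ r m, f (ra r m) = ra r (f m))
    (hg : ∀ r n, g (la r n) = la r (g n)) (hf_id : ∀ m, f m = m) (hg_id : ∀ n, g n = n)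
    (z : BalTensor ra la) : map f g hf hg z = z :=
  hom_congr (g := AddMonoidHom.id _) (fun m n => by simp [hf_id, hg_id]) z

/-- The isomorphism of tensor products induced by isomorphisms of the factors. -/
def congr (f : M ≃+ M') (g : N ≃+ N') (hf : ∀ r m, f (ra r m) = ra' r (f m))
    (hg : ∀ r n, g (la r n) = la' r (g n)) : BalTensor ra la ≃+ BalTensor ra' la' :=
  have hf' : ∀ r m, f.symm (ra' r m) = ra r (f.symm m) := fun r m => by
    rw [f.symm_apply_eq, hf, f.apply_symm_apply]
  have hg' : ∀ r n, g.symm (la' r n) = la r (g.symm n) := fun r n => by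
    rw [g.symm_apply_eq, hg, g.apply_symm_apply]
  { map f.toAddMonoidHom g.toAddMonoidHom hf hg with
    invFun := map f.symm.toAddMonoidHom g.symm.toAddMonoidHom hf' hg'
    left_inv := fun z => (map_map _ _ _ _ _ _ _ _ z).trans
      (map_eq_self _ _ f.symm_apply_apply g.symm_apply_apply z)
    right_inv := fun z => (map_map _ _ _ _ _ _ _ _ z).trans
      (map_eq_self _ _ f.apply_symm_apply g.apply_symm_apply z) }

theorem map_proj (f : M →+ M') (g : N →+ N') (hf : ∀ r m, f (ra r m) = ra' r (f m))
    (hg : ∀ r n, g (la r n) = la' r (g n)) (z : M ⊗[ℤ] N) :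
    map f g hf hg (proj ra la z) =
      proj ra' la' (TensorProduct.map f.toIntLinearMap g.toIntLinearMap z) := by
  induction z using TensorProduct.induction_on with
  | zero => simp
  | tmul m n => rfl
  | add z w hz hw => simp only [map_add, hz, hw]

/-- The inverse is `w ↦ ∑ q i ⊗ c i w`. -/
theorem lift_bijective {ι : Type*} [Fintype ι] (f : M →+ N →+ P)
    (hf : ∀ r m n, f (ra r m) n = f m (la r n)) (q : ι → M) (c : ι → P →+ N) (d : ι → M → R)
    (hq : ∀ m, ∑ i, ra (d i m) (q i) = m) (hf_c : ∀ w, ∑ i, f (q i) (c i w) = w)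
    (hc_f : ∀ i m n, c i (f m n) = la (d i m) n) : Function.Bijective (lift f hf) := by
  let s : P →+ BalTensor ra la := ∑ i, (tmulHom ra la (q i)).comp (c i)
  have left_inv : Function.LeftInverse s (lift f hf) := by
    refine hom_congr (f := s.comp (lift f hf)) (g := AddMonoidHom.id _) fun m n => ?_
    calc s (f m n)
        = ∑ i, tmul ra la (q i) (la (d i m) n) := by
          simp only [s, AddMonoidHom.finsetSum_apply, AddMonoidHom.comp_apply, tmulHom_apply, hc_f]
      _ = ∑ i, tmul ra la (ra (d i m) (q i)) n := by simp only [tmul_balanced]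
      _ = tmul ra la m n := by rw [← sum_tmul, hq]
  exact ⟨left_inv.injective, fun w => ⟨∑ i, tmul ra la (q i) (c i w), by
    simpa only [map_sum, lift_tmul] using hf_c w⟩⟩

end Map

end BalTensor

section Contract

variable {R M N M' N' : Type*} [Ring R] [AddCommGroup M] [AddCommGroup N] [AddCommGroup M']
  [AddCommGroup N']

/-- The map `M ⊗_R N → M`, `m ⊗ n ↦ m · c(n)` defined by a left linear functional `c`. -/
def RightAction.contract (X : RightAction R M) {Y : LeftAction R N} (c : N →+ R)
    (hc : ∀ r n, c (Y.act r n) = r * c n) : BalTensor X.act Y.act →+ M :=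
  BalTensor.lift (AddMonoidHom.mk' (fun n => X.act (c n))
    (fun n n' => by ext m; simp [X.act_add])).flip
    (fun r m n => by simp [hc, X.act_mul])

/-- The map `M ⊗_R N → N`, `m ⊗ n ↦ c(m) · n` defined by a right linear functional `c`. -/
def LeftAction.contract (Y : LeftAction R N) {X : RightAction R M} (c : M →+ R)
    (hc : ∀ r m, c (X.act r m) = c m * r) : BalTensor X.act Y.act →+ N :=
  BalTensor.lift (AddMonoidHom.mk' (fun m => Y.act (c m))
    (fun m m' => by ext n; simp [Y.act_add]))
    (fun r m n => by simp [hc, Y.act_mul])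

variable {X : RightAction R M} {Y : LeftAction R N} {X' : RightAction R M'} {Y' : LeftAction R N'}
  (f : M →+ M') (g : N →+ N') (hf : ∀ r m, f (X.act r m) = X'.act r (f m))
  (hg : ∀ r n, g (Y.act r n) = Y'.act r (g n))

theorem RightAction.map_contract (c : N' →+ R) (hc : ∀ r n, c (Y'.act r n) = r * c n)
    (z : BalTensor X.act Y.act) :
    f (X.contract (c.comp g) (fun r n => by simp [hg, hc]) z) =
      X'.contract c hc (BalTensor.map f g hf hg z) :=
  BalTensor.hom_congr
    (f := f.comp (X.contract (c.comp g) (fun r n => by simp [hg, hc])))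
    (g := (X'.contract c hc).comp (BalTensor.map f g hf hg)) (fun m n => hf (c (g n)) m) z

theorem LeftAction.map_contract (c : M' →+ R) (hc : ∀ r m, c (X'.act r m) = c m * r)
    (z : BalTensor X.act Y.act) :
    g (Y.contract (c.comp f) (fun r m => by simp [hf, hc]) z) =
      Y'.contract c hc (BalTensor.map f g hf hg z) :=
  BalTensor.hom_congr
    (f := g.comp (Y.contract (c.comp f) (fun r m => by simp [hf, hc])))
    (g := (Y'.contract c hc).comp (BalTensor.map f g hf hg)) (fun m n => hg (c (f m)) n) z

end Contract

section DualBasis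

variable {R M N P Q : Type*} [Ring R] [AddCommGroup M] [AddCommGroup N] [AddCommGroup P]
  [AddCommGroup Q]

/-- A finite dual basis of a left module: vectors `vec i` and left linear coordinate functionals
`coord i` with `n = ∑ coord i n · vec i` for all `n`. Its existence says that the module is finitely
generated and projective. -/
structure LeftAction.DualBasis (Y : LeftAction R N) (ι : Type*) [Fintype ι] where
  vec : ι → N
  coord : ι → N →+ R
  coord_act : ∀ i s n, coord i (Y.act s n) = s * coord i n
  sum_coord : ∀ n, ∑ i, Y.act (coord i n) (vec i) = n

namespace LeftAction.DualBasis

variable {ι : Type*} [Fintype ι] {Y : LeftAction R N} (b : Y.DualBasis ι) (X : RightAction R M)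

/-- The coefficient `m ⊗ n ↦ m · coord i n` of a tensor with respect to a dual basis of the second
factor. -/
def coeff (i : ι) : BalTensor X.act Y.act →+ M :=
  X.contract (b.coord i) (b.coord_act i)

theorem sum_coeff_tmul_vec (z : BalTensor X.act Y.act) :
    ∑ i, BalTensor.tmul _ _ (b.coeff X i z) (b.vec i) = z := by
  let f : BalTensor X.act Y.act →+ BalTensor X.act Y.act :=
    ∑ i, ((BalTensor.tmulHom X.act Y.act).flip (b.vec i)).comp (b.coeff X i)
  have hf : ∀ z, f z = ∑ i, BalTensor.tmul _ _ (b.coeff X i z) (b.vec i) :=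
    AddMonoidHom.finsetSum_apply _ _
  rw [← hf]
  refine BalTensor.hom_congr (f := f) (g := AddMonoidHom.id _) (fun m n => ?_) z
  calc f (BalTensor.tmul _ _ m n)
      = ∑ i, BalTensor.tmul _ _ (X.act (b.coord i n) m) (b.vec i) := hf _
    _ = ∑ i, BalTensor.tmul _ _ m (Y.act (b.coord i n) (b.vec i)) := by
        simp only [BalTensor.tmul_balanced]
    _ = BalTensor.tmul _ _ m n := by rw [← BalTensor.tmul_sum, b.sum_coord]

theorem injective_of_coeff {f : BalTensor X.act Y.act →+ P} {j : M →+ Q}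
    (hj : Function.Injective j) (c : ι → P →+ Q)
    (hc : ∀ i m n, c i (f (BalTensor.tmul _ _ m n)) = j (X.act (b.coord i n) m)) :
    Function.Injective f := by
  have hcoeff : ∀ i z, c i (f z) = j (b.coeff X i z) := fun i =>
    BalTensor.hom_congr (f := (c i).comp f) (g := j.comp (b.coeff X i)) (hc i)
  intro z w hzw
  rw [← b.sum_coeff_tmul_vec X z, ← b.sum_coeff_tmul_vec X w]
  refine Finset.sum_congr rfl fun i _ => ?_
  rw [hj (by rw [← hcoeff, ← hcoeff, hzw] : j (b.coeff X i z) = j (b.coeff X i w))]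

end LeftAction.DualBasis

end DualBasis

section Assoc

namespace BalTensor

variable {R M N P M' N' P' : Type*} [Ring R] [AddCommGroup M] [AddCommGroup N] [AddCommGroup P]
  [AddCommGroup M'] [AddCommGroup N'] [AddCommGroup P']
  {X : RightAction R M} {Y : Bimodule R N} {Z : LeftAction R P}
  {X' : RightAction R M'} {Y' : Bimodule R N'} {Z' : LeftAction R P'}

theorem map_tensor_right (f : M →+ M') (g : N →+ N') (hf : ∀ r m, f (X.act r m) = X'.act r (f m))
    (hgl : ∀ r n, g (Y.left.act r n) = Y'.left.act r (g n))
    (hgr : ∀ r n, g (Y.right.act r n) = Y'.right.act r (g n)) (r : R)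
    (z : BalTensor X.act Y.left.act) :
    map f g hf hgl ((X.tensor Y).act r z) = (X'.tensor Y').act r (map f g hf hgl z) :=
  hom_congr (f := (map f g hf hgl).comp ((X.tensor Y).act r))
    (g := ((X'.tensor Y').act r).comp (map f g hf hgl))
    (fun m n => congrArg (tmul _ _ (f m)) (hgr r n)) z

theorem map_tensor_left (g : N →+ N') (k : P →+ P')
    (hgl : ∀ r n, g (Y.left.act r n) = Y'.left.act r (g n))
    (hgr : ∀ r n, g (Y.right.act r n) = Y'.right.act r (g n))
    (hk : ∀ r p, k (Z.act r p) = Z'.act r (k p)) (r : R) (z : BalTensor Y.right.act Z.act) :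
    map g k hgr hk ((LeftAction.tensor Y Z).act r z) =
      (LeftAction.tensor Y' Z').act r (map g k hgr hk z) :=
  hom_congr (f := (map g k hgr hk).comp ((LeftAction.tensor Y Z).act r))
    (g := ((LeftAction.tensor Y' Z').act r).comp (map g k hgr hk))
    (fun n p => congrArg (tmul _ _ · (k p)) (hgl r n)) z

theorem assoc_map (f : M →+ M') (g : N →+ N') (k : P →+ P')
    (hf : ∀ r m, f (X.act r m) = X'.act r (f m))
    (hgl : ∀ r n, g (Y.left.act r n) = Y'.left.act r (g n))
    (hgr : ∀ r n, g (Y.right.act r n) = Y'.right.act r (g n))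
    (hk : ∀ r p, k (Z.act r p) = Z'.act r (k p)) (z : BalTensor (X.tensor Y).act Z.act) :
    assoc X' Y' Z' (map (map f g hf hgl) k (map_tensor_right f g hf hgl hgr) hk z) =
      map f (map g k hgr hk) hf (map_tensor_left g k hgl hgr hk) (assoc X Y Z z) := by
  let F := map f (map g k hgr hk) hf (map_tensor_left g k hgl hgr hk)
  refine hom_congr (f := (assoc X' Y' Z').comp (map (map f g hf hgl) k _ hk))
    (g := F.comp (assoc X Y Z)) (fun w p => ?_) z
  exact hom_congr (f := ((assocAux X' Y' Z').flip (k p)).comp (map f g hf hgl))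
    (g := F.comp ((assocAux X Y Z).flip p)) (fun _ _ => rfl) w

end BalTensor

variable {R M N : Type*} [Ring R] [AddCommGroup M] [AddCommGroup N]
  {X : Bimodule R M} {Y : RightAction R N}

/-- When a coaction and a coproduct share their second components `vec i`, coassociativity amounts
to the compatibility `hD` of the coaction with the first components. -/
theorem coassoc_of_components {ι : Type*} [Fintype ι] (vec : ι → M) (D : ι → N → N)
    (E : ι → M →+ M) (hE : ∀ i r m, E i (X.left.act r m) = X.left.act r (E i m))
    {δ : N →+ BalTensor Y.act X.left.act} {Δ : M →+ BalTensor X.right.act X.left.act}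
    (hδ : ∀ n, δ n = ∑ i, BalTensor.tmul _ _ (D i n) (vec i))
    (hΔ : ∀ m, Δ m = ∑ i, BalTensor.tmul _ _ (E i m) (vec i))
    (δ_right : ∀ r n, δ (Y.act r n) = (Y.tensor X).act r (δ n))
    (Δ_left : ∀ r m, Δ (X.left.act r m) = (LeftAction.tensor X X.left).act r (Δ m))
    (hD : ∀ i n, δ (D i n) = BalTensor.mapRight Y.act (E i) (hE i) (δ n)) (n : N) :
    BalTensor.assoc Y X X.left (BalTensor.mapLeft X.left.act δ δ_right (δ n)) =
      BalTensor.mapRight Y.act Δ Δ_left (δ n) := by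
  have hmapRight : ∀ z : BalTensor Y.act X.left.act, BalTensor.mapRight Y.act Δ Δ_left z =
      ∑ i, BalTensor.assocAux Y X X.left (BalTensor.mapRight Y.act (E i) (hE i) z) (vec i) := by
    intro z
    rw [BalTensor.hom_congr (g := ∑ i, ((BalTensor.assocAux Y X X.left).flip (vec i)).comp
      (BalTensor.mapRight Y.act (E i) (hE i))) (fun a m => ?_) z, AddMonoidHom.finsetSum_apply]
    · rfl
    · rw [BalTensor.mapRight_tmul, hΔ, BalTensor.tmul_sum, AddMonoidHom.finsetSum_apply]
      rfl
  calc BalTensor.assoc Y X X.left (BalTensor.mapLeft X.left.act δ δ_right (δ n))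
      = ∑ i, BalTensor.assocAux Y X X.left (δ (D i n)) (vec i) := by
        conv_lhs => rw [hδ n, map_sum, map_sum]
        rfl
    _ = BalTensor.mapRight Y.act Δ Δ_left (δ n) := by simp only [hD, hmapRight]

end Assoc

/-! ## Transport of corings and comodules -/

section Transport

variable {R M M' N N' : Type*} [Ring R] [AddCommGroup M] [AddCommGroup M'] [AddCommGroup N]
  [AddCommGroup N']

/-- An isomorphism of right modules. -/
structure RightAction.Iso (Y' : RightAction R N') (Y : RightAction R N) where
  toAddEquiv : N' ≃+ N
  map_act : ∀ r n, toAddEquiv (Y'.act r n) = Y.act r (toAddEquiv n)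

/-- An isomorphism of bimodules. -/
structure Bimodule.Iso (X' : Bimodule R M') (X : Bimodule R M) extends
    RightAction.Iso X'.right X.right where
  map_left : ∀ r m, toAddEquiv (X'.left.act r m) = X.left.act r (toAddEquiv m)

variable {X' : Bimodule R M'} {X : Bimodule R M} {Y' : RightAction R N'} {Y : RightAction R N}

/-- The isomorphism `N' ⊗_R M' ≃ N ⊗_R M` induced by isomorphisms of the factors. -/
def tensorEquiv (ψ : RightAction.Iso Y' Y) (φ : Bimodule.Iso X' X) :
    BalTensor Y'.act X'.left.act ≃+ BalTensor Y.act X.left.act :=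
  BalTensor.congr ψ.toAddEquiv φ.toAddEquiv ψ.map_act φ.map_left

section tensorEquiv

variable (ψ : RightAction.Iso Y' Y) (φ : Bimodule.Iso X' X)

@[simp]
theorem tensorEquiv_tmul (n : N') (m : M') : tensorEquiv ψ φ (BalTensor.tmul _ _ n m) =
    BalTensor.tmul _ _ (ψ.toAddEquiv n) (φ.toAddEquiv m) := rfl

/-- The map `N' ⊗ M' → N ⊗ M` of tensor products over `ℤ` underlying `tensorEquiv ψ φ`. -/
noncomputable def intTensorMap : N' ⊗[ℤ] M' →ₗ[ℤ] N ⊗[ℤ] M :=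
  TensorProduct.map ψ.toAddEquiv.toAddMonoidHom.toIntLinearMap
    φ.toAddEquiv.toAddMonoidHom.toIntLinearMap

@[simp]
theorem intTensorMap_tmul (n : N') (m : M') :
    intTensorMap ψ φ (n ⊗ₜ m) = ψ.toAddEquiv n ⊗ₜ φ.toAddEquiv m := rfl

theorem tensorEquiv_proj (z : N' ⊗[ℤ] M') :
    tensorEquiv ψ φ (BalTensor.proj _ _ z) = BalTensor.proj _ _ (intTensorMap ψ φ z) :=
  BalTensor.map_proj ψ.toAddEquiv.toAddMonoidHom φ.toAddEquiv.toAddMonoidHom ψ.map_act φ.map_left z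

theorem proj_eq_proj_iff (z w : N' ⊗[ℤ] M') :
    BalTensor.proj Y'.act X'.left.act z = BalTensor.proj Y'.act X'.left.act w ↔
      BalTensor.proj Y.act X.left.act (intTensorMap ψ φ z) =
        BalTensor.proj Y.act X.left.act (intTensorMap ψ φ w) := by
  rw [← tensorEquiv_proj, ← tensorEquiv_proj, (tensorEquiv ψ φ).injective.eq_iff]

theorem tensorEquiv_act_right (r : R) (z : BalTensor Y'.act X'.left.act) :
    tensorEquiv ψ φ ((Y'.tensor X').act r z) = (Y.tensor X).act r (tensorEquiv ψ φ z) :=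
  BalTensor.map_tensor_right ψ.toAddEquiv.toAddMonoidHom φ.toAddEquiv.toAddMonoidHom ψ.map_act
    φ.map_left φ.map_act r z

theorem tensorEquiv_act_left (r : R) (z : BalTensor X'.right.act X'.left.act) :
    tensorEquiv φ.toIso φ ((LeftAction.tensor X' X'.left).act r z) =
      (LeftAction.tensor X X.left).act r (tensorEquiv φ.toIso φ z) :=
  BalTensor.map_tensor_left (Z := X'.left) (Z' := X.left) φ.toAddEquiv.toAddMonoidHom
    φ.toAddEquiv.toAddMonoidHom φ.map_left φ.map_act φ.map_left r z

/-- The isomorphism `N' ⊗_R (M' ⊗_R M') ≃ N ⊗_R (M ⊗_R M)`. -/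
def tensorEquiv₃ : BalTensor Y'.act (LeftAction.tensor X' X'.left).act ≃+
    BalTensor Y.act (LeftAction.tensor X X.left).act :=
  BalTensor.congr ψ.toAddEquiv (tensorEquiv φ.toIso φ) ψ.map_act (tensorEquiv_act_left φ)

variable {ψ φ} {δ : N →+ BalTensor Y.act X.left.act} {δ' : N' →+ BalTensor Y'.act X'.left.act}
  {Δ : M →+ BalTensor X.right.act X.left.act} {Δ' : M' →+ BalTensor X'.right.act X'.left.act}

theorem tensorEquiv₃_assoc_mapLeft
    (hδ : ∀ n, tensorEquiv ψ φ (δ' n) = δ (ψ.toAddEquiv n))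
    (δ_right : ∀ r n, δ (Y.act r n) = (Y.tensor X).act r (δ n))
    (δ'_right : ∀ r n, δ' (Y'.act r n) = (Y'.tensor X').act r (δ' n))
    (z : BalTensor Y'.act X'.left.act) :
    tensorEquiv₃ ψ φ
        (BalTensor.assoc Y' X' X'.left (BalTensor.mapLeft X'.left.act δ' δ'_right z)) =
      BalTensor.assoc Y X X.left (BalTensor.mapLeft X.left.act δ δ_right (tensorEquiv ψ φ z)) := by
  refine (BalTensor.assoc_map (Z := X'.left) (Z' := X.left) ψ.toAddEquiv.toAddMonoidHom
    φ.toAddEquiv.toAddMonoidHom φ.toAddEquiv.toAddMonoidHom ψ.map_act φ.map_left φ.map_act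
    φ.map_left _).symm.trans (congrArg (BalTensor.assoc Y X X.left) ?_)
  refine BalTensor.hom_congr
    (f := (BalTensor.map (tensorEquiv ψ φ).toAddMonoidHom φ.toAddEquiv.toAddMonoidHom
      (tensorEquiv_act_right ψ φ) φ.map_left).comp (BalTensor.mapLeft X'.left.act δ' δ'_right))
    (g := (BalTensor.mapLeft X.left.act δ δ_right).comp (tensorEquiv ψ φ).toAddMonoidHom)
    (fun n m => ?_) z
  exact congrArg (BalTensor.tmul _ _ · (φ.toAddEquiv m)) (hδ n)

theorem tensorEquiv₃_mapRight
    (hΔ : ∀ m, tensorEquiv φ.toIso φ (Δ' m) = Δ (φ.toAddEquiv m))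
    (Δ_left : ∀ r m, Δ (X.left.act r m) = (LeftAction.tensor X X.left).act r (Δ m))
    (Δ'_left : ∀ r m, Δ' (X'.left.act r m) = (LeftAction.tensor X' X'.left).act r (Δ' m))
    (z : BalTensor Y'.act X'.left.act) :
    tensorEquiv₃ ψ φ (BalTensor.mapRight Y'.act Δ' Δ'_left z) =
      BalTensor.mapRight Y.act Δ Δ_left (tensorEquiv ψ φ z) :=
  BalTensor.hom_congr
    (f := (tensorEquiv₃ ψ φ).toAddMonoidHom.comp (BalTensor.mapRight Y'.act Δ' Δ'_left))
    (g := (BalTensor.mapRight Y.act Δ Δ_left).comp (tensorEquiv ψ φ).toAddMonoidHom)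
    (fun n m => congrArg (BalTensor.tmul _ _ (ψ.toAddEquiv n)) (hΔ m)) z

theorem coassoc_transport
    (hδ : ∀ n, tensorEquiv ψ φ (δ' n) = δ (ψ.toAddEquiv n))
    (hΔ : ∀ m, tensorEquiv φ.toIso φ (Δ' m) = Δ (φ.toAddEquiv m))
    {δ_right : ∀ r n, δ (Y.act r n) = (Y.tensor X).act r (δ n)}
    {δ'_right : ∀ r n, δ' (Y'.act r n) = (Y'.tensor X').act r (δ' n)}
    {Δ_left : ∀ r m, Δ (X.left.act r m) = (LeftAction.tensor X X.left).act r (Δ m)}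
    {Δ'_left : ∀ r m, Δ' (X'.left.act r m) = (LeftAction.tensor X' X'.left).act r (Δ' m)}
    (n : N')
    (coassoc : BalTensor.assoc Y X X.left
        (BalTensor.mapLeft X.left.act δ δ_right (δ (ψ.toAddEquiv n))) =
      BalTensor.mapRight Y.act Δ Δ_left (δ (ψ.toAddEquiv n))) :
    BalTensor.assoc Y' X' X'.left (BalTensor.mapLeft X'.left.act δ' δ'_right (δ' n)) =
      BalTensor.mapRight Y'.act Δ' Δ'_left (δ' n) := by
  apply (tensorEquiv₃ ψ φ).injective
  rw [tensorEquiv₃_assoc_mapLeft hδ δ_right, tensorEquiv₃_mapRight hΔ Δ_left, hδ, coassoc]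

end tensorEquiv

namespace Coring

/-- Transport of a coring along an isomorphism of bimodules. -/
def transport (K : Coring X) (φ : Bimodule.Iso X' X) : Coring X' where
  comul := (tensorEquiv φ.toIso φ).symm.toAddMonoidHom.comp
    (K.comul.comp φ.toAddEquiv.toAddMonoidHom)
  comul_left r m := by
    apply (tensorEquiv φ.toIso φ).injective
    rw [tensorEquiv_act_left]
    simp [φ.map_left, K.comul_left]
  comul_right r m := by
    apply (tensorEquiv φ.toIso φ).injective
    rw [tensorEquiv_act_right]
    simp [φ.map_act, K.comul_right]
  counit := K.counit.comp φ.toAddEquiv.toAddMonoidHom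
  counit_left r m := by simp [φ.map_left, K.counit_left]
  counit_right r m := by simp [φ.map_act, K.counit_right]
  coassoc m := coassoc_transport (ψ := φ.toIso) (φ := φ) (fun n => by simp) (fun n => by simp) m
    (K.coassoc _)
  counit_comul m := by
    apply φ.toAddEquiv.injective
    refine (LeftAction.map_contract (Y' := X.left) φ.toAddEquiv.toAddMonoidHom
      φ.toAddEquiv.toAddMonoidHom φ.map_act φ.map_left K.counit K.counit_right _).trans ?_
    refine (congrArg (X.left.contract K.counit K.counit_right) ?_).trans
      (K.counit_comul (φ.toAddEquiv m))
    exact (tensorEquiv φ.toIso φ).apply_symm_apply (K.comul (φ.toAddEquiv m))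
  comul_counit m := by
    apply φ.toAddEquiv.injective
    refine (RightAction.map_contract (X' := X.right) φ.toAddEquiv.toAddMonoidHom
      φ.toAddEquiv.toAddMonoidHom φ.map_act φ.map_left K.counit K.counit_left _).trans ?_
    refine (congrArg (X.right.contract K.counit K.counit_left) ?_).trans
      (K.comul_counit (φ.toAddEquiv m))
    exact (tensorEquiv φ.toIso φ).apply_symm_apply (K.comul (φ.toAddEquiv m))

theorem tensorEquiv_transport_comul (K : Coring X) (φ : Bimodule.Iso X' X) (m : M') :
    tensorEquiv φ.toIso φ ((K.transport φ).comul m) = K.comul (φ.toAddEquiv m) :=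
  (tensorEquiv φ.toIso φ).apply_symm_apply (K.comul (φ.toAddEquiv m))

theorem proj_eq_transport_comul_iff (K : Coring X) (φ : Bimodule.Iso X' X) (m : M')
    (z : M' ⊗[ℤ] M') : BalTensor.proj _ _ z = (K.transport φ).comul m ↔
      BalTensor.proj _ _ (intTensorMap φ.toIso φ z) = K.comul (φ.toAddEquiv m) := by
  rw [← tensorEquiv_proj, ← tensorEquiv_transport_comul, (tensorEquiv φ.toIso φ).injective.eq_iff]

end Coring

namespace Comodule

variable {K : Coring X} (D : Comodule K Y) (φ : Bimodule.Iso X' X) (ψ : RightAction.Iso Y' Y)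

/-- Transport of a comodule along isomorphisms of bimodules and of right modules. -/
def transport : Comodule (K.transport φ) Y' where
  coact := (tensorEquiv ψ φ).symm.toAddMonoidHom.comp (D.coact.comp ψ.toAddEquiv.toAddMonoidHom)
  coact_right r m := by
    apply (tensorEquiv ψ φ).injective
    rw [tensorEquiv_act_right]
    simp [ψ.map_act, D.coact_right]
  coassoc m := coassoc_transport (ψ := ψ) (φ := φ) (fun n => by simp)
    (K.tensorEquiv_transport_comul φ) m (D.coassoc _)
  coact_counit m := by
    apply ψ.toAddEquiv.injective
    refine (RightAction.map_contract (X' := Y) ψ.toAddEquiv.toAddMonoidHom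
      φ.toAddEquiv.toAddMonoidHom ψ.map_act φ.map_left K.counit K.counit_left _).trans ?_
    refine (congrArg (Y.contract K.counit K.counit_left) ?_).trans
      (D.coact_counit (ψ.toAddEquiv m))
    exact (tensorEquiv ψ φ).apply_symm_apply (D.coact (ψ.toAddEquiv m))

theorem tensorEquiv_transport_coact (n : N') :
    tensorEquiv ψ φ ((D.transport φ ψ).coact n) = D.coact (ψ.toAddEquiv n) :=
  (tensorEquiv ψ φ).apply_symm_apply (D.coact (ψ.toAddEquiv n))

theorem proj_eq_transport_coact_iff (n : N') (z : N' ⊗[ℤ] M') :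
    BalTensor.proj Y'.act X'.left.act z = (D.transport φ ψ).coact n ↔
      BalTensor.proj Y.act X.left.act (intTensorMap ψ φ z) = D.coact (ψ.toAddEquiv n) := by
  rw [← tensorEquiv_proj, ← D.tensorEquiv_transport_coact φ ψ,
    (tensorEquiv ψ φ).injective.eq_iff]

end Comodule

end Transport

/-! ## The opposite of a left bialgebroid -/

section OppositeBialgebroid

variable {R H L' A A' B : Type*} [Ring R] [Ring H] [Ring L'] [Ring A'] [Ring A] [Ring B]

namespace LeftBialgebroid

variable (L : LeftBialgebroid R L') (Φ : H ≃+* L'ᵐᵒᵖ)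

/-- The source `r ↦ Φ⁻¹(t(r))` of the right bialgebroid opposite to `L`. -/
def oppositeSource : R →+* H where
  toFun r := Φ.symm (op (L.target (op r)))
  map_one' := by simp
  map_zero' := by simp
  map_add' r s := by simp
  map_mul' r s := by simp

/-- The target `r ↦ Φ⁻¹(s(r))` of the right bialgebroid opposite to `L`. -/
def oppositeTarget : Rᵐᵒᵖ →+* H where
  toFun r := Φ.symm (op (L.source r.unop))
  map_one' := by simp
  map_zero' := by simp
  map_add' r s := by simp
  map_mul' r s := by simp

theorem opposite_source_target (r r' : R) :
    L.oppositeSource Φ r * L.oppositeTarget Φ (op r') =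
      L.oppositeTarget Φ (op r') * L.oppositeSource Φ r := by
  change Φ.symm _ * Φ.symm _ = Φ.symm _ * Φ.symm _
  rw [← map_mul, ← map_mul, ← op_mul, ← op_mul, MulOpposite.unop_op, L.source_target]

/-- The isomorphism of bimodules underlying `Φ`. -/
def oppositeIso :
    Bimodule.Iso (rightBimodule _ _ (L.opposite_source_target Φ)) L.bimodule where
  toAddEquiv := Φ.toAddEquiv.trans opAddEquiv.symm
  map_act r h := by simp [rightBimodule, leftBimodule, oppositeSource]
  map_left r h := by simp [rightBimodule, leftBimodule, oppositeTarget]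

@[simp]
theorem oppositeIso_apply (h : H) : (L.oppositeIso Φ).toAddEquiv h = (Φ h).unop := rfl

@[simp]
theorem unop_oppositeSource (r : R) : (Φ (L.oppositeSource Φ r)).unop = L.target (op r) := by
  simp [oppositeSource]

@[simp]
theorem unop_oppositeTarget (r : R) : (Φ (L.oppositeTarget Φ (op r))).unop = L.source r := by
  simp [oppositeTarget]

theorem intTensorMap_oppositeIso_mul (z z' : H ⊗[ℤ] H) :
    intTensorMap (L.oppositeIso Φ).toIso (L.oppositeIso Φ) (z * z') =
      intTensorMap (L.oppositeIso Φ).toIso (L.oppositeIso Φ) z' *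
        intTensorMap (L.oppositeIso Φ).toIso (L.oppositeIso Φ) z := by
  let θ := intTensorMap (L.oppositeIso Φ).toIso (L.oppositeIso Φ)
  have h : (LinearMap.mul ℤ (H ⊗[ℤ] H)).compr₂ θ =
      (LinearMap.mul ℤ (L' ⊗[ℤ] L')).flip.compl₁₂ θ θ := by
    ext a b c d
    change θ ((a ⊗ₜ b) * (c ⊗ₜ d)) = θ (c ⊗ₜ d) * θ (a ⊗ₜ b)
    simp [θ]
  exact LinearMap.congr_fun₂ h z z'

/-- The right bialgebroid structure on `H` for which `Φ` is an isomorphism to the opposite of the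
left bialgebroid `L`. -/
def opposite : RightBialgebroid R H where
  source := L.oppositeSource Φ
  target := L.oppositeTarget Φ
  source_target := L.opposite_source_target Φ
  coring := L.coring.transport (L.oppositeIso Φ)
  takeuchi h z hz r := by
    have hz' := (L.coring.proj_eq_transport_comul_iff _ _ _).1 hz
    rw [proj_eq_proj_iff (L.oppositeIso Φ).toIso (L.oppositeIso Φ), intTensorMap_oppositeIso_mul,
      intTensorMap_oppositeIso_mul]
    simpa using L.takeuchi _ _ hz' r
  comul_one := by
    apply (tensorEquiv (L.oppositeIso Φ).toIso (L.oppositeIso Φ)).injective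
    rw [Coring.tensorEquiv_transport_comul]
    simp [L.comul_one]
  comul_mul h h' z z' hz hz' := by
    rw [Coring.proj_eq_transport_comul_iff] at hz hz'
    rw [eq_comm, Coring.proj_eq_transport_comul_iff, intTensorMap_oppositeIso_mul]
    simpa using (L.comul_mul _ _ _ _ hz' hz).symm
  counit_one := by simp [Coring.transport, L.counit_one]
  counit_source_mul h h' := by simp [Coring.transport, L.counit_mul_target]
  counit_target_mul h h' := by simp [Coring.transport, L.counit_mul_source]

theorem opposite_isIsoToOpposite : IsIsoToOpposite (L.opposite Φ) L Φ where
  source := L.unop_oppositeSource Φ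
  target := L.unop_oppositeTarget Φ
  counit _ := rfl
  comul _ _ hz := ((L.coring.proj_eq_transport_comul_iff (L.oppositeIso Φ) _ _).1 hz).symm

end LeftBialgebroid

section RingIso

variable (ε : A' ≃+* A) {π : R →+* A} {π' : R →+* A'}

/-- The isomorphism of right `R`-modules underlying an isomorphism of `R`-rings. -/
def ringRightIso (h : ∀ r, ε (π' r) = π r) :
    RightAction.Iso (ringRightAction π') (ringRightAction π) where
  toAddEquiv := ε.toAddEquiv
  map_act r a := by simp [ringRightAction, h]

@[simp]
theorem ringRightIso_apply (h : ∀ r, ε (π' r) = π r) (a : A') :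
    (ringRightIso ε h).toAddEquiv a = ε a := rfl

theorem leftMul_tensorEquiv (h : ∀ r, ε (π' r) = π r) {X' : Bimodule R H} {X : Bimodule R L'}
    (φ : Bimodule.Iso X' X) (a : A') (z : BalTensor (ringRightAction π').act X'.left.act) :
    leftMul π X.left (ε a) (tensorEquiv (ringRightIso ε h) φ z) =
      tensorEquiv (ringRightIso ε h) φ (leftMul π' X'.left a z) :=
  BalTensor.hom_congr
    (f := (leftMul π X.left (ε a)).comp (tensorEquiv (ringRightIso ε h) φ).toAddMonoidHom)
    (g := (tensorEquiv (ringRightIso ε h) φ).toAddMonoidHom.comp (leftMul π' X'.left a))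
    (fun c k => congrArg (BalTensor.tmul _ _ · (φ.toAddEquiv k)) (map_mul ε a c).symm) z

end RingIso

@[simp]
theorem twistedMul_tmul_tmul (a a' : A) (h h' : L') :
    twistedMul A L' (a ⊗ₜ[ℤ] h) (a' ⊗ₜ[ℤ] h') = (a * a') ⊗ₜ[ℤ] (h' * h) := rfl

theorem twistedMul_tmul_one (a : A) (z : A ⊗[ℤ] L') :
    twistedMul A L' (a ⊗ₜ[ℤ] 1) z = (a ⊗ₜ[ℤ] 1) * z := by
  have h : twistedMul A L' (a ⊗ₜ[ℤ] 1) = LinearMap.mulLeft ℤ (a ⊗ₜ[ℤ] 1) := by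
    ext c d
    change twistedMul A L' (a ⊗ₜ 1) (c ⊗ₜ d) = (a ⊗ₜ 1) * (c ⊗ₜ d)
    simp
  exact LinearMap.congr_fun h z

theorem twistedMul_one_tmul (h : L') (z : A ⊗[ℤ] L') :
    twistedMul A L' (1 ⊗ₜ[ℤ] h) z = z * (1 ⊗ₜ[ℤ] h) := by
  have h : twistedMul A L' (1 ⊗ₜ[ℤ] h) = LinearMap.mulRight ℤ (1 ⊗ₜ[ℤ] h) := by
    ext c d
    change twistedMul A L' (1 ⊗ₜ h) (c ⊗ₜ d) = (c ⊗ₜ d) * (1 ⊗ₜ h)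
    simp
  exact LinearMap.congr_fun h z

namespace LeftBialgebroid.ComoduleAlgebra

variable {L : LeftBialgebroid R L'} {π : R →+* A} (δ : L.ComoduleAlgebra π) (Φ : H ≃+* L'ᵐᵒᵖ)
  (ε : A' ≃+* A) {π' : R →+* A'} (h : ∀ r, ε (π' r) = π r)

theorem intTensorMap_ringRightIso_mul (z z' : A' ⊗[ℤ] H) :
    intTensorMap (ringRightIso ε h) (L.oppositeIso Φ) (z * z') =
      twistedMul A L' (intTensorMap (ringRightIso ε h) (L.oppositeIso Φ) z)
        (intTensorMap (ringRightIso ε h) (L.oppositeIso Φ) z') := by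
  let θ := intTensorMap (ringRightIso ε h) (L.oppositeIso Φ)
  have h : (LinearMap.mul ℤ (A' ⊗[ℤ] H)).compr₂ θ = (twistedMul A L').compl₁₂ θ θ := by
    ext a b c d
    change θ ((a ⊗ₜ b) * (c ⊗ₜ d)) = twistedMul A L' (θ (a ⊗ₜ b)) (θ (c ⊗ₜ d))
    simp [θ]
  exact LinearMap.congr_fun₂ h z z'

/-- Transport of a comodule algebra over a left bialgebroid to the opposite right bialgebroid,
along an isomorphism of `R`-rings. -/
def transport : (L.opposite Φ).ComoduleAlgebra π' where
  __ := δ.toComodule.transport (L.oppositeIso Φ) (ringRightIso ε h)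
  takeuchi a z hz r := by
    have hz' := (δ.proj_eq_transport_coact_iff (L.oppositeIso Φ) (ringRightIso ε h) a z).1 hz
    refine (proj_eq_proj_iff (ringRightIso ε h) (L.oppositeIso Φ) _ _).2 ?_
    rw [intTensorMap_ringRightIso_mul, intTensorMap_ringRightIso_mul]
    simpa [h, twistedMul_tmul_one, twistedMul_one_tmul, opposite] using δ.takeuchi _ _ hz' r
  coact_one := by
    apply (tensorEquiv (ringRightIso ε h) (L.oppositeIso Φ)).injective
    refine (δ.tensorEquiv_transport_coact (L.oppositeIso Φ) (ringRightIso ε h) 1).trans ?_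
    change _ = BalTensor.tmul _ _ (ε 1) (Φ 1).unop
    simpa using δ.coact_one
  coact_mul a a' z z' hz hz' := by
    have w := (δ.proj_eq_transport_coact_iff (L.oppositeIso Φ) (ringRightIso ε h) a z).1 hz
    have w' := (δ.proj_eq_transport_coact_iff (L.oppositeIso Φ) (ringRightIso ε h) a' z').1 hz'
    refine ((δ.proj_eq_transport_coact_iff (L.oppositeIso Φ) (ringRightIso ε h) _ _).2 ?_).symm
    rw [intTensorMap_ringRightIso_mul]
    simpa using (δ.coact_mul _ _ _ _ w w').symm

theorem tensorEquiv_transport (a : A') :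
    tensorEquiv (ringRightIso ε h) (L.oppositeIso Φ) ((δ.transport Φ ε h).coact a) =
      δ.coact (ε a) :=
  δ.tensorEquiv_transport_coact (L.oppositeIso Φ) (ringRightIso ε h) a

theorem mem_coinvariants_transport_iff (a : A') :
    a ∈ coinvariants (δ.transport Φ ε h).coact ↔ ε a ∈ coinvariants δ.coact := by
  have h₁ := tensorEquiv_tmul (ringRightIso ε h) (L.oppositeIso Φ) a 1
  rw [ringRightIso_apply, oppositeIso_apply, map_one, MulOpposite.unop_one] at h₁
  change _ = _ ↔ _ = _
  rw [← δ.tensorEquiv_transport Φ ε h]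
  refine Iff.trans ?_ (Eq.congr_right h₁)
  exact (tensorEquiv (ringRightIso ε h) (L.oppositeIso Φ)).injective.eq_iff.symm

/-- The isomorphism `A' ⊗_B A' ≃ A ⊗_B A` for an isomorphism of extensions of `B`. -/
def extensionTensorEquiv {ρ : B →+* A} {ρ' : B →+* A'} (hρ : ∀ b, ε (ρ' b) = ρ b) :
    BalTensor (fun b : B => AddMonoidHom.mulRight (ρ' b))
      (fun b : B => AddMonoidHom.mulLeft (ρ' b)) ≃+
    BalTensor (fun b : B => AddMonoidHom.mulRight (ρ b))
      (fun b : B => AddMonoidHom.mulLeft (ρ b)) :=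
  BalTensor.congr ε.toAddEquiv ε.toAddEquiv (fun b a => by simp [hρ]) (fun b a => by simp [hρ])

theorem isGalois_transport {ρ : B →+* A} {ρ' : B →+* A'} (hρ : ∀ b, ε (ρ' b) = ρ b)
    (hG : IsGalois ρ δ.coact) : IsGalois ρ' (δ.transport Φ ε h).coact := by
  obtain ⟨hco, Γ, hΓ, hbij⟩ := hG
  let T := tensorEquiv (ringRightIso ε h) (L.oppositeIso Φ)
  refine ⟨?_, T.symm.toAddMonoidHom.comp (Γ.comp (extensionTensorEquiv ε hρ).toAddMonoidHom),
    fun a a' => T.injective ?_,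
    T.symm.bijective.comp (hbij.comp (extensionTensorEquiv ε hρ).bijective)⟩
  · ext a
    rw [mem_coinvariants_transport_iff, hco]
    refine exists_congr fun b => ?_
    rw [← hρ, ε.injective.eq_iff]
  · calc T (T.symm (Γ (BalTensor.tmul _ _ (ε a) (ε a'))))
        = leftMul π L.bimodule.left (ε a) (δ.coact (ε a')) := by rw [T.apply_symm_apply, hΓ]
      _ = T (leftMul π' (L.opposite Φ).bimodule.left a ((δ.transport Φ ε h).coact a')) := by
          rw [← δ.tensorEquiv_transport Φ ε h a']
          exact leftMul_tensorEquiv ε h (L.oppositeIso Φ) a _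

end LeftBialgebroid.ComoduleAlgebra

end OppositeBialgebroid

/-! ## The bialgebroid `End(ρλ)` -/

section Intertwiner

variable {A B : Type u} [Ring A] [Ring B] {l : A →+* B} {r : B →+* A} {α : B →+* B}

theorem mul_map_of_intertwiner_left (x : intertwiner r (r.comp α)) (b : B) :
    x.1 * r b = r (α b) * x.1 := x.2 b

theorem mul_map_of_intertwiner_right (f : intertwiner (r.comp α) r) (b : B) :
    f.1 * r (α b) = r b * f.1 := f.2 b

theorem mul_map_of_endRing (s : endRing r) (b : B) : s.1 * r b = r b * s.1 := s.2 b

theorem mul_map_of_endRing_comp (h : endRing (r.comp l)) (a : A) :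
    h.1 * r (l a) = r (l a) * h.1 := h.2 a

/-- The composition `Hom(β, γ) × Hom(α, β) → Hom(α, γ)` of intertwiners. -/
def intertwinerComp {S T : Type*} [Ring S] [Ring T] {α β γ : S →+* T} :
    intertwiner β γ →+ intertwiner α β →+ intertwiner α γ :=
  AddMonoidHom.mk' (fun t => AddMonoidHom.mk'
      (fun s => ⟨t.1 * s.1, fun b => by rw [mul_assoc, s.2, ← mul_assoc, t.2, mul_assoc]⟩)
      fun s s' => Subtype.ext (mul_add t.1 s.1 s'.1))
    fun t t' => AddMonoidHom.ext fun s => Subtype.ext (add_mul t.1 t'.1 s.1)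

/-- The composition pairing `Hom(ρα, ρ) × Hom(ρ, ρα) → End(ρ)`. -/
def pairing : intertwiner (r.comp α) r →+ intertwiner r (r.comp α) →+ endRing r :=
  AddMonoidHom.mk' (fun f => AddMonoidHom.mk'
      (fun x => ⟨f.1 * x.1, (intertwinerComp f x).2⟩)
      fun x y => Subtype.ext (mul_add f.1 x.1 y.1))
    fun f g => AddMonoidHom.ext fun x => Subtype.ext (add_mul f.1 g.1 x.1)

@[simp]
theorem coe_pairing (f : intertwiner (r.comp α) r) (x : intertwiner r (r.comp α)) :
    (pairing f x : A) = f.1 * x.1 := rfl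

end Intertwiner

namespace RingAdjunction

variable {A B : Type u} [Ring A] [Ring B] {l : A →+* B} {r : B →+* A} (adj : RingAdjunction l r)
  {α β : B →+* B}

section MatrixCoefficients

theorem e_mul (b : B) : adj.e * l (r b) = b * adj.e := adj.e_mem b

theorem m_mul (a : A) : adj.m * a = r (l a) * adj.m := adj.m_mem a

theorem r_e_mul (b : B) : r adj.e * r (l (r b)) = r b * r adj.e := by
  rw [← map_mul, adj.e_mul, map_mul]

theorem r_e_mul_r_l_m : r adj.e * r (l adj.m) = 1 := by
  rw [← map_mul, adj.e_mul_l_m, map_one]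

/-- The unit `m` of the adjunction, as an element of `Hom(ρ, ρλρ)`. -/
def unit : intertwiner r (r.comp (l.comp r)) := ⟨adj.m, fun b => adj.m_mul (r b)⟩

theorem r_transpose_mul_m (a : A) : r (adj.e * l a) * adj.m = a := by
  rw [map_mul, mul_assoc, ← adj.m_mul, ← mul_assoc, adj.r_e_mul_m, one_mul]

theorem transpose_r_mul (b : B) (a : A) : adj.e * l (r b * a) = b * (adj.e * l a) := by
  rw [map_mul, ← mul_assoc, adj.e_mul, mul_assoc]

theorem map_transpose_mul_transpose (x : intertwiner r (r.comp α)) (a : A) :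
    α (adj.e * l a) * (adj.e * l (x.1 * adj.m)) = adj.e * l (x.1 * a) := by
  rw [← adj.transpose_r_mul, ← mul_assoc, ← mul_map_of_intertwiner_left, mul_assoc,
    adj.r_transpose_mul_m]

theorem map_e_mul_transpose (x : intertwiner r (r.comp α)) :
    α adj.e * (adj.e * l (x.1 * adj.m)) = adj.e * l x.1 := by
  simpa using adj.map_transpose_mul_transpose x 1

theorem transpose_mul_l (x : intertwiner r (r.comp α)) (a : A) :
    adj.e * l (x.1 * adj.m) * l a = α (l a) * (adj.e * l (x.1 * adj.m)) := by
  rw [mul_assoc, ← map_mul, mul_assoc x.1, adj.m_mul, ← mul_assoc x.1,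
    mul_map_of_intertwiner_left, mul_assoc, adj.transpose_r_mul]

/-- The matrix coefficient `f ρ(e λ(x m))` of `f ∈ Hom(ρα, ρ)` and `x ∈ Hom(ρ, ρα)`, where
`e λ(x m) ∈ Hom(λ, αλ)`. -/
def matrixCoeff :
    intertwiner (r.comp α) r →+ intertwiner r (r.comp α) →+ endRing (r.comp l) :=
  AddMonoidHom.mk' (fun f => AddMonoidHom.mk'
      (fun x => ⟨f.1 * r (adj.e * l (x.1 * adj.m)), fun a => by
        rw [RingHom.comp_apply, mul_assoc, ← map_mul, adj.transpose_mul_l, map_mul, ← mul_assoc,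
          mul_map_of_intertwiner_right, mul_assoc]⟩)
      fun x y => Subtype.ext (by simp [add_mul, mul_add]))
    fun f g => AddMonoidHom.ext fun x => Subtype.ext (add_mul f.1 g.1 _)

@[simp]
theorem coe_matrixCoeff (f : intertwiner (r.comp α) r) (x : intertwiner r (r.comp α)) :
    (adj.matrixCoeff f x : A) = f.1 * r (adj.e * l (x.1 * adj.m)) := rfl

theorem coe_matrixCoeff_mul_matrixCoeff (g : intertwiner (r.comp β) r)
    (y : intertwiner r (r.comp β)) (f : intertwiner (r.comp α) r) (x : intertwiner r (r.comp α)) :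
    (adj.matrixCoeff g y * adj.matrixCoeff f x : A) =
      g.1 * f.1 * r (adj.e * l (x.1 * y.1 * adj.m)) := by
  rw [coe_matrixCoeff, coe_matrixCoeff, mul_assoc g.1, ← mul_assoc (r _),
    ← mul_map_of_intertwiner_right, mul_assoc f.1, ← map_mul, map_transpose_mul_transpose,
    ← mul_assoc, ← mul_assoc]

/-- The isomorphism `End(ρλ) ≃ Hom(ρλρ, ρ)`, `h ↦ ρ(e) h`, of the adjunction. -/
def mate : endRing (r.comp l) ≃+ intertwiner (r.comp (l.comp r)) r where
  toFun h := ⟨r adj.e * h.1, fun b => by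
    change _ * r (l (r b)) = _
    rw [mul_assoc, mul_map_of_endRing_comp, ← mul_assoc, adj.r_e_mul, mul_assoc]⟩
  invFun := comulSnd adj
  left_inv h := Subtype.ext (by
    change r adj.e * h.1 * r (l adj.m) = h.1
    rw [mul_assoc, mul_map_of_endRing_comp, ← mul_assoc, adj.r_e_mul_r_l_m, one_mul])
  right_inv f := Subtype.ext (by
    change r adj.e * (f.1 * r (l adj.m)) = f.1
    rw [← mul_assoc, ← mul_map_of_intertwiner_right, mul_assoc, RingHom.comp_apply, ← map_mul,
      ← map_mul, adj.r_e_mul_m, map_one, map_one, mul_one])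
  map_add' h h' := Subtype.ext (mul_add _ h.1 h'.1)

@[simp]
theorem mate_comulSnd (f : intertwiner (r.comp (l.comp r)) r) : adj.mate (comulSnd adj f) = f :=
  adj.mate.apply_symm_apply f

theorem r_e_mul_matrixCoeff (f : intertwiner (r.comp α) r) (x : intertwiner r (r.comp α)) :
    r adj.e * (adj.matrixCoeff f x).1 = f.1 * r (adj.e * l x.1) := by
  rw [coe_matrixCoeff, ← mul_assoc, ← mul_map_of_intertwiner_right, mul_assoc, ← map_mul,
    map_e_mul_transpose]

theorem matrixCoeff_unit (f : intertwiner (r.comp (l.comp r)) r) :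
    adj.matrixCoeff f adj.unit = comulSnd adj f := Subtype.ext (by
  change f.1 * r (adj.e * l (adj.m * adj.m)) = f.1 * r (l adj.m)
  rw [adj.m_mul, adj.transpose_r_mul, adj.e_mul_l_m, mul_one])

theorem matrixCoeff_mate_unit (h : endRing (r.comp l)) :
    adj.matrixCoeff (adj.mate h) adj.unit = h :=
  (adj.matrixCoeff_unit _).trans (adj.mate.symm_apply_apply h)

end MatrixCoefficients

section EndCoring

/-- The source `s ↦ s` of the bialgebroid `End(ρλ)`. -/
def endSource (l : A →+* B) (r : B →+* A) : endRing r →+* endRing (r.comp l) :=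
  Subring.inclusion fun _ hx a => hx (l a)

@[simp]
theorem coe_endSource (s : endRing r) : (endSource l r s : A) = s.1 := rfl

/-- The target `s ↦ ρ(e λ(s m))` of the bialgebroid `End(ρλ)`. -/
def endTarget : (endRing r)ᵐᵒᵖ →+* endRing (r.comp l) where
  toFun s := adj.matrixCoeff (α := RingHom.id B) ⟨1, one_mem (endRing r)⟩ ⟨s.unop.1, s.unop.2⟩
  map_one' := Subtype.ext (by simp [adj.e_mul_l_m])
  map_zero' := Subtype.ext (by simp)
  map_add' s s' := Subtype.ext (by simp [add_mul, mul_add])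
  map_mul' s s' := Subtype.ext
    ((adj.coe_matrixCoeff_mul_matrixCoeff (α := RingHom.id B) (β := RingHom.id B)
      ⟨1, one_mem (endRing r)⟩ ⟨s.unop.1, s.unop.2⟩ ⟨1, one_mem (endRing r)⟩
      ⟨s'.unop.1, s'.unop.2⟩).trans (by simp)).symm

@[simp]
theorem coe_endTarget (s : endRing r) :
    (adj.endTarget (op s) : A) = r (adj.e * l (s.1 * adj.m)) := one_mul _

theorem endSource_mul_endTarget (s s' : endRing r) :
    endSource l r s * adj.endTarget (op s') = adj.endTarget (op s') * endSource l r s :=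
  Subtype.ext (by
    rw [Subring.coe_mul, Subring.coe_mul, coe_endSource, coe_endTarget, mul_map_of_endRing])

theorem r_e_mul_endTarget (s : endRing r) :
    r adj.e * (adj.endTarget (op s)).1 = r adj.e * r (l s.1) := by
  rw [coe_endTarget, ← map_mul, ← map_mul]
  exact congrArg r (adj.map_e_mul_transpose (α := RingHom.id B) ⟨s.1, s.2⟩)

theorem endTarget_mul_matrixCoeff (s : endRing r) (f : intertwiner (r.comp α) r)
    (x : intertwiner r (r.comp α)) :
    (adj.endTarget (op s) * adj.matrixCoeff f x : A) =
      f.1 * r (adj.e * l (x.1 * s.1 * adj.m)) := by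
  refine (adj.coe_matrixCoeff_mul_matrixCoeff (β := RingHom.id B) ⟨1, one_mem (endRing r)⟩
    ⟨s.1, s.2⟩ f x).trans ?_
  rw [one_mul]

/-- The bimodule underlying the bialgebroid `End(ρλ)`. -/
abbrev endBimodule : Bimodule (endRing r) (endRing (r.comp l)) :=
  leftBimodule (endSource l r) adj.endTarget adj.endSource_mul_endTarget

theorem coe_mate_endBimodule_left (s : endRing r) (h : endRing (r.comp l)) :
    (adj.mate (adj.endBimodule.left.act s h) : A) = s.1 * adj.mate h := by
  change r adj.e * (s.1 * h.1) = s.1 * (r adj.e * h.1)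
  rw [← mul_assoc, ← mul_map_of_endRing, mul_assoc]

theorem coe_mate_endBimodule_right (s : endRing r) (h : endRing (r.comp l)) :
    (adj.mate (adj.endBimodule.right.act s h) : A) = adj.mate h * r (l s.1) := by
  change r adj.e * ((adj.endTarget (op s)).1 * h.1) = r adj.e * h.1 * r (l s.1)
  rw [← mul_assoc, r_e_mul_endTarget, mul_assoc, mul_assoc, mul_map_of_endRing_comp]

theorem pairing_mate_left (x : intertwiner r (r.comp (l.comp r))) (s : endRing r)
    (h : endRing (r.comp l)) :
    pairing (adj.mate (adj.endBimodule.left.act s h)) x = s * pairing (adj.mate h) x :=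
  Subtype.ext (by
    rw [coe_pairing, coe_mate_endBimodule_left, Subring.coe_mul, coe_pairing, mul_assoc])

/-- The counit `h ↦ ρ(e) h m` of `End(ρλ)`. -/
def endCounit : endRing (r.comp l) →+ endRing r :=
  (pairing.flip adj.unit).comp adj.mate.toAddMonoidHom

theorem endCounit_apply (h : endRing (r.comp l)) :
    adj.endCounit h = pairing (adj.mate h) adj.unit := rfl

theorem endCounit_matrixCoeff (f : intertwiner (r.comp α) r) (x : intertwiner r (r.comp α)) :
    adj.endCounit (adj.matrixCoeff f x) = pairing f x := Subtype.ext (by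
  change r adj.e * (adj.matrixCoeff f x).1 * adj.m = f.1 * x.1
  rw [r_e_mul_matrixCoeff, mul_assoc, r_transpose_mul_m])

theorem endCounit_comulSnd (f : intertwiner (r.comp (l.comp r)) r) :
    adj.endCounit (comulSnd adj f) = pairing f adj.unit := by
  rw [endCounit_apply, mate_comulSnd]

variable {n : ℕ} {p : Fin n → intertwiner (r.comp (l.comp r)) r}
  {q : Fin n → intertwiner r (r.comp (l.comp r))}

/-- The dual basis of the left `End(ρ)`-module `End(ρλ)` defined by a summand diagram for `λρ`. -/
def dualBasis (hpq : IsSummandDiagram p q) : adj.endBimodule.left.DualBasis (Fin n) where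
  vec i := comulSnd adj (p i)
  coord i := (pairing.flip (q i)).comp adj.mate.toAddMonoidHom
  coord_act i := adj.pairing_mate_left (q i)
  sum_coord h := by
    apply adj.mate.injective
    refine Subtype.ext ?_
    have hi : ∀ i, (adj.mate (adj.endBimodule.left.act (pairing (adj.mate h) (q i))
        (comulSnd adj (p i))) : A) = adj.mate h * (q i * p i) := fun i => by
      rw [coe_mate_endBimodule_left, mate_comulSnd, coe_pairing, mul_assoc]
    rw [map_sum, AddSubgroup.val_finsetSum]
    refine (Finset.sum_congr rfl fun i _ => hi i).trans ?_
    rw [← Finset.mul_sum]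
    exact (congrArg _ hpq).trans (mul_one _)

/-- The map `End(ρλ) ⊗_R End(ρλ) → A`, `h ⊗ h' ↦ ρ(e) h ρλ(h')`. -/
def endTensorEmb : BalTensor adj.endBimodule.right.act adj.endBimodule.left.act →+ A :=
  BalTensor.lift
    ((AddMonoidHom.mul.compl₂ ((r.comp l).comp (endRing (r.comp l)).subtype).toAddMonoidHom).comp
      ((intertwiner (r.comp (l.comp r)) r).subtype.comp adj.mate.toAddMonoidHom))
    (fun s h h' => by
      change (adj.mate (adj.endBimodule.right.act s h) : A) * r (l h'.1) =
        adj.mate h * r (l (s.1 * h'.1))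
      rw [coe_mate_endBimodule_right, map_mul, map_mul, mul_assoc])

@[simp]
theorem endTensorEmb_tmul (h h' : endRing (r.comp l)) :
    adj.endTensorEmb (BalTensor.tmul _ _ h h') = r adj.e * h.1 * r (l h'.1) := rfl

theorem endTensorEmb_injective (hpq : IsSummandDiagram p q) :
    Function.Injective adj.endTensorEmb := by
  refine (adj.dualBasis hpq).injective_of_coeff adj.endBimodule.right
    (j := (intertwiner (r.comp (l.comp r)) r).subtype.comp adj.mate.toAddMonoidHom)
    (Subtype.val_injective.comp adj.mate.injective)
    (fun i => (AddMonoidHom.mulLeft (r adj.e)).comp (AddMonoidHom.mulRight (r (l (q i).1))))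
    fun i h h' => ?_
  refine Eq.trans ?_ (adj.coe_mate_endBimodule_right _ h).symm
  change r adj.e * ((adj.mate h).1 * r (l h'.1) * r (l (q i).1)) =
    (adj.mate h).1 * r (l (r adj.e * h'.1 * (q i).1))
  have hmate : (adj.mate h).1 * r (l (r adj.e)) = r adj.e * (adj.mate h).1 :=
    mul_map_of_intertwiner_right (adj.mate h) adj.e
  simp only [map_mul, ← mul_assoc, hmate]

theorem endTensorEmb_left (s : endRing r)
    (z : BalTensor adj.endBimodule.right.act adj.endBimodule.left.act) :
    adj.endTensorEmb ((LeftAction.tensor adj.endBimodule adj.endBimodule.left).act s z) =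
      s.1 * adj.endTensorEmb z :=
  BalTensor.hom_congr
    (f := adj.endTensorEmb.comp ((LeftAction.tensor adj.endBimodule adj.endBimodule.left).act s))
    (g := (AddMonoidHom.mulLeft s.1).comp adj.endTensorEmb)
    (fun h h' => by
      change (adj.mate (adj.endBimodule.left.act s h) : A) * r (l h'.1) =
        s.1 * (adj.mate h * r (l h'.1))
      rw [coe_mate_endBimodule_left, mul_assoc]) z

theorem endTensorEmb_right (s : endRing r)
    (z : BalTensor adj.endBimodule.right.act adj.endBimodule.left.act) :
    adj.endTensorEmb ((adj.endBimodule.right.tensor adj.endBimodule).act s z) =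
      adj.endTarget (op s) * adj.endTensorEmb z :=
  BalTensor.hom_congr
    (f := adj.endTensorEmb.comp ((adj.endBimodule.right.tensor adj.endBimodule).act s))
    (g := (AddMonoidHom.mulLeft (adj.endTarget (op s)).1).comp adj.endTensorEmb)
    (fun h h' => by
      change (adj.mate h).1 * r (l ((adj.endTarget (op s)).1 * h'.1)) =
        (adj.endTarget (op s)).1 * ((adj.mate h).1 * r (l h'.1))
      rw [map_mul, map_mul, coe_endTarget, ← mul_assoc, ← mul_assoc]
      exact congrArg (· * _) (mul_map_of_intertwiner_right (adj.mate h) _)) z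

theorem endTensorEmb_proj_mul_tmul (z : endRing (r.comp l) ⊗[ℤ] endRing (r.comp l))
    (k k' : endRing (r.comp l)) :
    adj.endTensorEmb (BalTensor.proj _ _ (z * k ⊗ₜ[ℤ] k')) =
      adj.endTensorEmb (BalTensor.proj _ _ z) * (k.1 * r (l k'.1)) := by
  induction z using TensorProduct.induction_on with
  | zero => simp
  | add z w hz hw => rw [add_mul, map_add, map_add, hz, hw, map_add, map_add, add_mul]
  | tmul h h' =>
    rw [Algebra.TensorProduct.tmul_mul_tmul]
    change r adj.e * (h.1 * k.1) * r (l (h'.1 * k'.1)) =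
      r adj.e * h.1 * r (l h'.1) * (k.1 * r (l k'.1))
    rw [map_mul, map_mul, mul_assoc _ (r (l h'.1)), ← mul_assoc (r (l h'.1)) k.1,
      ← mul_map_of_endRing_comp]
    simp only [mul_assoc]

theorem endTensorEmb_proj_mul {z : endRing (r.comp l) ⊗[ℤ] endRing (r.comp l)} {a : A}
    (hz : adj.endTensorEmb (BalTensor.proj _ _ z) = a * r adj.e)
    (z' : endRing (r.comp l) ⊗[ℤ] endRing (r.comp l)) :
    adj.endTensorEmb (BalTensor.proj _ _ (z * z')) =
      a * adj.endTensorEmb (BalTensor.proj _ _ z') := by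
  induction z' using TensorProduct.induction_on with
  | zero => simp
  | add z' w' hz' hw' => rw [mul_add, map_add, map_add, hz', hw', map_add, map_add, mul_add]
  | tmul k k' =>
    rw [endTensorEmb_proj_mul_tmul, hz]
    change a * r adj.e * (k.1 * r (l k'.1)) = a * (r adj.e * k.1 * r (l k'.1))
    simp only [mul_assoc]

theorem endTensorEmb_sum_matrixCoeff_tmul {n : ℕ} {p : Fin n → intertwiner (r.comp α) r}
    {q : Fin n → intertwiner r (r.comp α)} (hpq : IsSummandDiagram p q)
    (f : intertwiner (r.comp α) r) (x : intertwiner r (r.comp α)) :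
    adj.endTensorEmb (∑ i, BalTensor.tmul _ _ (adj.matrixCoeff f (q i)) (adj.matrixCoeff (p i) x)) =
      adj.matrixCoeff f x * r adj.e := by
  have hi : ∀ i, adj.endTensorEmb (BalTensor.tmul _ _ (adj.matrixCoeff f (q i))
      (adj.matrixCoeff (p i) x)) =
      f.1 * r (adj.e * l (q i * p i * r (adj.e * l (x.1 * adj.m)))) := fun i => by
    rw [endTensorEmb_tmul, r_e_mul_matrixCoeff, coe_matrixCoeff, mul_assoc, ← map_mul,
      mul_assoc adj.e, ← map_mul, mul_assoc (q i).1]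
  calc _ = f.1 * r (adj.e * l ((∑ i, (q i : A) * p i) * r (adj.e * l (x.1 * adj.m)))) := by
        simp only [map_sum, hi, Finset.sum_mul, Finset.mul_sum]
    _ = adj.matrixCoeff f x * r adj.e := by
        rw [show ∑ i, (q i : A) * p i = 1 from hpq, one_mul, adj.e_mul, map_mul, ← mul_assoc,
          coe_matrixCoeff]

/-- The coproduct of `End(ρλ)` defined by a summand diagram for `λρ`. -/
def endComul (p : Fin n → intertwiner (r.comp (l.comp r)) r)
    (q : Fin n → intertwiner r (r.comp (l.comp r))) :
    endRing (r.comp l) →+ BalTensor adj.endBimodule.right.act adj.endBimodule.left.act :=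
  ∑ i, ((BalTensor.tmulHom _ _).flip (comulSnd adj (p i))).comp
    ((adj.matrixCoeff.flip (q i)).comp adj.mate.toAddMonoidHom)

theorem endComul_apply (h : endRing (r.comp l)) : adj.endComul p q h =
    ∑ i, BalTensor.tmul _ _ (adj.matrixCoeff (adj.mate h) (q i)) (comulSnd adj (p i)) := by
  rw [endComul, AddMonoidHom.finsetSum_apply]
  rfl

theorem endTensorEmb_endComul (hpq : IsSummandDiagram p q) (h : endRing (r.comp l)) :
    adj.endTensorEmb (adj.endComul p q h) = h.1 * r adj.e := by
  simp only [endComul_apply, ← matrixCoeff_unit]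
  rw [endTensorEmb_sum_matrixCoeff_tmul adj hpq, matrixCoeff_mate_unit]

theorem endComul_matrixCoeff (hpq : IsSummandDiagram p q) {n' : ℕ}
    {p' : Fin n' → intertwiner (r.comp α) r} {q' : Fin n' → intertwiner r (r.comp α)}
    (hpq' : IsSummandDiagram p' q') (f : intertwiner (r.comp α) r)
    (x : intertwiner r (r.comp α)) : adj.endComul p q (adj.matrixCoeff f x) =
      ∑ i, BalTensor.tmul _ _ (adj.matrixCoeff f (q' i)) (adj.matrixCoeff (p' i) x) :=
  adj.endTensorEmb_injective hpq ((adj.endTensorEmb_endComul hpq _).trans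
    (adj.endTensorEmb_sum_matrixCoeff_tmul hpq' f x).symm)

theorem sum_endTarget_mul_matrixCoeff (hpq : IsSummandDiagram p q) (h : endRing (r.comp l)) :
    ∑ i, adj.endTarget (op (pairing (p i) adj.unit)) * adj.matrixCoeff (adj.mate h) (q i) = h := by
  have hi : ∀ i, (adj.endTarget (op (pairing (p i) adj.unit)) *
      adj.matrixCoeff (adj.mate h) (q i) : A) =
      (adj.mate h).1 * r (adj.e * l (q i * p i * (adj.m * adj.m))) := fun i => by
    rw [endTarget_mul_matrixCoeff, coe_pairing]
    simp only [mul_assoc]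
    rfl
  refine Eq.trans (Subtype.ext ?_) (adj.matrixCoeff_mate_unit h)
  calc _ = ∑ i, (adj.mate h).1 * r (adj.e * l (q i * p i * (adj.m * adj.m))) := by
        simp only [AddSubmonoidClass.coe_finsetSum, Subring.coe_mul, hi]
    _ = (adj.mate h).1 * r (adj.e * l ((∑ i, (q i : A) * p i) * (adj.m * adj.m))) := by
        simp only [map_sum, Finset.mul_sum, Finset.sum_mul]
    _ = (adj.mate h).1 * r (adj.e * l (adj.m * adj.m)) := by
        rw [show ∑ i, (q i : A) * p i = 1 from hpq, one_mul]

theorem coe_endCounit_mul_m (h : endRing (r.comp l)) :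
    (adj.endCounit h : A) * adj.m = h.1 * adj.m := by
  change r adj.e * h.1 * adj.m * adj.m = h.1 * adj.m
  rw [mul_assoc (r adj.e * h.1), adj.m_mul, ← mul_assoc, mul_assoc (r adj.e),
    mul_map_of_endRing_comp, ← mul_assoc, adj.r_e_mul_r_l_m, one_mul]

/-- The coring structure on `End(ρλ)` defined by a summand diagram for `λρ`. -/
def endCoring (hpq : IsSummandDiagram p q) : Coring adj.endBimodule where
  comul := adj.endComul p q
  comul_left s h := adj.endTensorEmb_injective hpq (by
    rw [endTensorEmb_left, endTensorEmb_endComul adj hpq, endTensorEmb_endComul adj hpq,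
      ← mul_assoc]
    rfl)
  comul_right s h := adj.endTensorEmb_injective hpq (by
    rw [endTensorEmb_right, endTensorEmb_endComul adj hpq, endTensorEmb_endComul adj hpq,
      ← mul_assoc]
    rfl)
  counit := adj.endCounit
  counit_left := adj.pairing_mate_left adj.unit
  counit_right s h := Subtype.ext (by
    rw [endCounit_apply, coe_pairing, coe_mate_endBimodule_right, mul_assoc]
    change _ * (r (l s.1) * adj.m) = (adj.mate h).1 * adj.m * s.1
    rw [← adj.m_mul, mul_assoc])
  coassoc := coassoc_of_components (fun i => comulSnd adj (p i))
    (fun i h => adj.matrixCoeff (adj.mate h) (q i))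
    (fun i => (adj.matrixCoeff.flip (q i)).comp adj.mate.toAddMonoidHom)
    (fun i s h => Subtype.ext (by
      change (adj.mate (adj.endBimodule.left.act s h)).1 * _ = s.1 * ((adj.mate h).1 * _)
      rw [coe_mate_endBimodule_left, mul_assoc]))
    adj.endComul_apply adj.endComul_apply _ _ fun i h => by
      rw [adj.endComul_matrixCoeff hpq hpq, endComul_apply, map_sum]
      refine Finset.sum_congr rfl fun j _ => ?_
      rw [BalTensor.mapRight_tmul]
      change _ = BalTensor.tmul _ _ _ (adj.matrixCoeff (adj.mate (comulSnd adj (p j))) (q i))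
      rw [mate_comulSnd]
  counit_comul h := by
    rw [endComul_apply, map_sum]
    refine (Finset.sum_congr rfl fun i _ => ?_).trans ((adj.dualBasis hpq).sum_coord h)
    exact congrArg (adj.endBimodule.left.act · _) (adj.endCounit_matrixCoeff (adj.mate h) (q i))
  comul_counit h := by
    rw [endComul_apply, map_sum]
    refine (Finset.sum_congr rfl fun i _ => ?_).trans (adj.sum_endTarget_mul_matrixCoeff hpq h)
    exact congrArg (fun s => adj.endTarget (op s) * adj.matrixCoeff (adj.mate h) (q i))
      (adj.endCounit_comulSnd (p i))

/-- The left bialgebroid `End(ρλ)` over `End(ρ)` defined by a summand diagram for `λρ`. -/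
def endBialgebroid (hpq : IsSummandDiagram p q) :
    LeftBialgebroid (endRing r) (endRing (r.comp l)) where
  source := endSource l r
  target := adj.endTarget
  source_target := adj.endSource_mul_endTarget
  coring := adj.endCoring hpq
  takeuchi h z hz s := adj.endTensorEmb_injective hpq (by
    have hz' : adj.endTensorEmb (BalTensor.proj _ _ z) = h.1 * r adj.e :=
      (congrArg _ hz).trans (adj.endTensorEmb_endComul hpq h)
    rw [endTensorEmb_proj_mul_tmul, endTensorEmb_proj_mul_tmul, hz']
    change h.1 * r adj.e * ((adj.endTarget (op s)).1 * r (l 1)) =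
      h.1 * r adj.e * (1 * r (l s.1))
    rw [map_one, map_one, mul_one, one_mul, mul_assoc, mul_assoc, r_e_mul_endTarget])
  comul_one := adj.endTensorEmb_injective hpq (by
    refine (adj.endTensorEmb_endComul hpq 1).trans ?_
    simp)
  comul_mul h h' z z' hz hz' := adj.endTensorEmb_injective hpq (by
    have hz₁ := (congrArg adj.endTensorEmb hz).trans (adj.endTensorEmb_endComul hpq h)
    have hz₂ := (congrArg adj.endTensorEmb hz').trans (adj.endTensorEmb_endComul hpq h')
    refine (adj.endTensorEmb_endComul hpq (h * h')).trans ?_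
    refine Eq.trans ?_ (adj.endTensorEmb_proj_mul hz₁ z').symm
    rw [hz₂, Subring.coe_mul, mul_assoc])
  counit_one := Subtype.ext (by
    change r adj.e * 1 * adj.m = 1
    rw [mul_one, adj.r_e_mul_m])
  counit_mul_source h h' := Subtype.ext (by
    change r adj.e * (h.1 * (adj.endCounit h').1) * adj.m = r adj.e * (h.1 * h'.1) * adj.m
    simp only [mul_assoc, coe_endCounit_mul_m])
  counit_mul_target h h' := Subtype.ext (by
    change r adj.e * (h.1 * (adj.endTarget (op (adj.endCounit h'))).1) * adj.m =
      r adj.e * (h.1 * h'.1) * adj.m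
    rw [coe_endTarget, mul_assoc, mul_assoc h.1, r_transpose_mul_m, coe_endCounit_mul_m]
    simp only [mul_assoc])

theorem endBialgebroid_isEndBialgebroid (hpq : IsSummandDiagram p q) :
    IsEndBialgebroid adj (adj.endBialgebroid hpq) where
  source _ := rfl
  target s := adj.coe_endTarget s
  counit _ := rfl
  comul _ _ _ hpq' h := adj.endTensorEmb_injective hpq
    ((adj.endTensorEmb_endComul hpq h).trans
      ((congrArg _ (adj.endComul_apply h)).symm.trans (adj.endTensorEmb_endComul hpq' h)).symm)

end EndCoring

end RingAdjunction

/-! ## The Galois extension `ρ : B → A` -/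

namespace RingAdjunction

section EndComodule

variable {A B : Type u} [Ring A] [Ring B] {l : A →+* B} {r : B →+* A} (adj : RingAdjunction l r)
  {n : ℕ} {p : Fin n → intertwiner (r.comp (l.comp r)) r}
  {q : Fin n → intertwiner r (r.comp (l.comp r))}

/-- The map `A ⊗_R End(ρλ) → A`, `a ⊗ h ↦ a ρ(e) h`. -/
def coactionEmb :
    BalTensor (ringRightAction (endRing r).subtype).act adj.endBimodule.left.act →+ A :=
  BalTensor.lift
    (AddMonoidHom.mul.compl₂
      ((intertwiner (r.comp (l.comp r)) r).subtype.comp adj.mate.toAddMonoidHom))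
    (fun s a h => by
      change a * s.1 * (adj.mate h).1 = a * (adj.mate (adj.endBimodule.left.act s h)).1
      rw [coe_mate_endBimodule_left, mul_assoc])

theorem coactionEmb_tmul (a : A) (h : endRing (r.comp l)) :
    adj.coactionEmb (BalTensor.tmul _ _ a h) = a * (r adj.e * h.1) := rfl

theorem coactionEmb_tmul_one (a : A) :
    adj.coactionEmb (BalTensor.tmul _ _ a 1) = a * r adj.e :=
  congrArg (a * ·) (mul_one _)

theorem coactionEmb_injective (hpq : IsSummandDiagram p q) :
    Function.Injective adj.coactionEmb :=
  (adj.dualBasis hpq).injective_of_coeff (ringRightAction (endRing r).subtype)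
    (j := AddMonoidHom.id A) Function.injective_id (fun i => AddMonoidHom.mulRight (q i).1)
    fun i a h => mul_assoc a (adj.mate h).1 (q i).1

theorem coactionEmb_leftMul (a : A)
    (z : BalTensor (ringRightAction (endRing r).subtype).act adj.endBimodule.left.act) :
    adj.coactionEmb (leftMul _ _ a z) = a * adj.coactionEmb z :=
  BalTensor.hom_congr (f := adj.coactionEmb.comp (leftMul _ _ a))
    (g := (AddMonoidHom.mulLeft a).comp adj.coactionEmb)
    (fun a' h => mul_assoc a a' (adj.mate h).1) z

theorem coactionEmb_right (s : endRing r)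
    (z : BalTensor (ringRightAction (endRing r).subtype).act adj.endBimodule.left.act) :
    adj.coactionEmb (((ringRightAction (endRing r).subtype).tensor adj.endBimodule).act s z) =
      adj.coactionEmb z * r (l s.1) :=
  BalTensor.hom_congr
    (f := adj.coactionEmb.comp
      (((ringRightAction (endRing r).subtype).tensor adj.endBimodule).act s))
    (g := (AddMonoidHom.mulRight (r (l s.1))).comp adj.coactionEmb)
    (fun a h => by
      change a * (adj.mate (adj.endBimodule.right.act s h)).1 = a * (adj.mate h).1 * r (l s.1)
      rw [coe_mate_endBimodule_right, mul_assoc]) z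

theorem coactionEmb_proj_twistedMul_tmul (a : A) (h : endRing (r.comp l))
    (z : A ⊗[ℤ] endRing (r.comp l)) :
    adj.coactionEmb (BalTensor.proj _ _ (twistedMul _ _ (a ⊗ₜ[ℤ] h) z)) =
      a * adj.coactionEmb (BalTensor.proj _ _ z) * h.1 := by
  induction z using TensorProduct.induction_on with
  | zero => simp
  | add z w hz hw => rw [map_add, map_add, map_add, hz, hw, map_add, map_add, mul_add, add_mul]
  | tmul a' h' =>
    rw [twistedMul_tmul_tmul]
    change a * a' * (r adj.e * (h'.1 * h.1)) = a * (a' * (r adj.e * h'.1)) * h.1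
    simp only [mul_assoc]

theorem coactionEmb_proj_twistedMul {z' : A ⊗[ℤ] endRing (r.comp l)} {a' : A}
    (hz' : adj.coactionEmb (BalTensor.proj _ _ z') = r (adj.e * l a'))
    (z : A ⊗[ℤ] endRing (r.comp l)) :
    adj.coactionEmb (BalTensor.proj _ _ (twistedMul _ _ z z')) =
      adj.coactionEmb (BalTensor.proj _ _ z) * r (l a') := by
  induction z using TensorProduct.induction_on with
  | zero => simp
  | add z w hz hw =>
    rw [map_add, LinearMap.add_apply, map_add, map_add, hz, hw, map_add, map_add, add_mul]
  | tmul a h =>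
    rw [coactionEmb_proj_twistedMul_tmul, hz']
    change a * r (adj.e * l a') * h.1 = a * (r adj.e * h.1) * r (l a')
    rw [map_mul, mul_assoc, mul_assoc, mul_assoc, mul_assoc, mul_map_of_endRing_comp]

theorem coactionEmb_sum_tmul_matrixCoeff {α : B →+* B} {n : ℕ}
    {p : Fin n → intertwiner (r.comp α) r} {q : Fin n → intertwiner r (r.comp α)}
    (hpq : IsSummandDiagram p q) (b : B) (x : intertwiner r (r.comp α)) :
    adj.coactionEmb (∑ i, BalTensor.tmul _ _ (r b * (q i).1) (adj.matrixCoeff (p i) x)) =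
      r (adj.e * l (r b * x.1)) := by
  have hi : ∀ i, adj.coactionEmb (BalTensor.tmul _ _ (r b * (q i).1) (adj.matrixCoeff (p i) x)) =
      r b * (q i * p i) * r (adj.e * l x.1) := fun i => by
    rw [coactionEmb_tmul, r_e_mul_matrixCoeff]
    simp only [mul_assoc]
  calc _ = r b * (∑ i, (q i : A) * p i) * r (adj.e * l x.1) := by
        simp only [map_sum, hi, Finset.mul_sum, Finset.sum_mul]
    _ = r (adj.e * l (r b * x.1)) := by
        rw [show ∑ i, (q i : A) * p i = 1 from hpq, mul_one, transpose_r_mul, ← map_mul]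

/-- The coaction of `End(ρλ)` on `A` defined by a summand diagram for `λρ`. -/
def endCoact (p : Fin n → intertwiner (r.comp (l.comp r)) r)
    (q : Fin n → intertwiner r (r.comp (l.comp r))) :
    A →+ BalTensor (ringRightAction (endRing r).subtype).act adj.endBimodule.left.act :=
  ∑ i, ((BalTensor.tmulHom _ _).flip (comulSnd adj (p i))).comp
    ((AddMonoidHom.mulRight (q i).1).comp
      (r.toAddMonoidHom.comp ((AddMonoidHom.mulLeft adj.e).comp l.toAddMonoidHom)))

theorem endCoact_apply (a : A) : adj.endCoact p q a =
    ∑ i, BalTensor.tmul _ _ (r (adj.e * l a) * (q i).1) (comulSnd adj (p i)) := by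
  rw [endCoact, AddMonoidHom.finsetSum_apply]
  rfl

theorem coactionEmb_endCoact (hpq : IsSummandDiagram p q) (a : A) :
    adj.coactionEmb (adj.endCoact p q a) = r (adj.e * l a) := by
  simp only [endCoact_apply, ← matrixCoeff_unit]
  rw [coactionEmb_sum_tmul_matrixCoeff adj hpq]
  exact congrArg (fun a => r (adj.e * l a)) (adj.r_transpose_mul_m a)

theorem endCoact_r_mul (hpq : IsSummandDiagram p q) {α : B →+* B} {n' : ℕ}
    {p' : Fin n' → intertwiner (r.comp α) r} {q' : Fin n' → intertwiner r (r.comp α)}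
    (hpq' : IsSummandDiagram p' q') (b : B) (x : intertwiner r (r.comp α)) :
    adj.endCoact p q (r b * x.1) =
      ∑ i, BalTensor.tmul _ _ (r b * (q' i).1) (adj.matrixCoeff (p' i) x) :=
  adj.coactionEmb_injective hpq ((adj.coactionEmb_endCoact hpq _).trans
    (adj.coactionEmb_sum_tmul_matrixCoeff hpq' b x).symm)

/-- The comodule `A` over the coring `End(ρλ)`. -/
def endComodule (hpq : IsSummandDiagram p q) :
    Comodule (adj.endCoring hpq) (ringRightAction (endRing r).subtype) where
  coact := adj.endCoact p q
  coact_right s a := adj.coactionEmb_injective hpq (by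
    rw [coactionEmb_right, coactionEmb_endCoact adj hpq, coactionEmb_endCoact adj hpq, ← map_mul,
      mul_assoc, ← map_mul]
    rfl)
  coassoc := coassoc_of_components (fun i => comulSnd adj (p i))
    (fun i a => r (adj.e * l a) * (q i).1)
    (fun i => (adj.matrixCoeff.flip (q i)).comp adj.mate.toAddMonoidHom)
    (fun i s h => Subtype.ext (by
      change (adj.mate (adj.endBimodule.left.act s h)).1 * _ = s.1 * ((adj.mate h).1 * _)
      rw [coe_mate_endBimodule_left, mul_assoc]))
    adj.endCoact_apply adj.endComul_apply _ _ fun i a => by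
      rw [adj.endCoact_r_mul hpq hpq, endCoact_apply, map_sum]
      refine Finset.sum_congr rfl fun j _ => ?_
      rw [BalTensor.mapRight_tmul]
      change _ = BalTensor.tmul _ _ _ (adj.matrixCoeff (adj.mate (comulSnd adj (p j))) (q i))
      rw [mate_comulSnd]
  coact_counit a := by
    have hi : ∀ i, r (adj.e * l a) * (q i).1 * (adj.endCounit (comulSnd adj (p i))).1 =
        r (adj.e * l a) * (q i * p i) * adj.m := fun i => by
      rw [endCounit_comulSnd, coe_pairing]
      simp only [mul_assoc]
      rfl
    rw [endCoact_apply, map_sum]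
    refine (Finset.sum_congr rfl fun i _ => hi i).trans ?_
    rw [← Finset.sum_mul, ← Finset.mul_sum, show ∑ i, (q i : A) * p i = 1 from hpq, mul_one,
      r_transpose_mul_m]

/-- The comodule algebra `A` over `End(ρλ)`. -/
def endComoduleAlgebra (hpq : IsSummandDiagram p q) :
    (adj.endBialgebroid hpq).ComoduleAlgebra (endRing r).subtype where
  __ := adj.endComodule hpq
  takeuchi a z hz s := adj.coactionEmb_injective hpq (by
    have hz' : adj.coactionEmb (BalTensor.proj _ _ z) = r (adj.e * l a) :=
      (congrArg _ hz).trans (adj.coactionEmb_endCoact hpq a)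
    rw [← twistedMul_tmul_one, ← twistedMul_one_tmul]
    refine (adj.coactionEmb_proj_twistedMul_tmul s.1 1 z).trans ?_
    refine Eq.trans ?_ (adj.coactionEmb_proj_twistedMul_tmul 1 (endSource l r s) z).symm
    rw [hz', coe_endSource, one_mul, mul_map_of_endRing]
    exact mul_one _)
  coact_one := adj.coactionEmb_injective hpq (by
    refine (adj.coactionEmb_endCoact hpq 1).trans ?_
    refine Eq.trans ?_ (adj.coactionEmb_tmul_one 1).symm
    rw [map_one, mul_one, one_mul])
  coact_mul a a' z z' hz hz' := adj.coactionEmb_injective hpq (by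
    have hz₁ : adj.coactionEmb (BalTensor.proj _ _ z) = r (adj.e * l a) :=
      (congrArg _ hz).trans (adj.coactionEmb_endCoact hpq a)
    have hz₂ := (congrArg adj.coactionEmb hz').trans (adj.coactionEmb_endCoact hpq a')
    refine (adj.coactionEmb_endCoact hpq (a * a')).trans ?_
    refine Eq.trans ?_ (adj.coactionEmb_proj_twistedMul hz₂ z).symm
    refine Eq.trans ?_ (congrArg (· * r (l a')) hz₁).symm
    rw [map_mul l, ← mul_assoc, map_mul r])

theorem endComoduleAlgebra_isEndCoaction (hpq : IsSummandDiagram p q) :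
    IsEndCoaction adj (adj.endBialgebroid hpq) (adj.endComoduleAlgebra hpq) :=
  fun _ _ _ hpq' a => adj.coactionEmb_injective hpq
    ((adj.coactionEmb_endCoact hpq a).trans
      ((congrArg _ (adj.endCoact_apply a)).symm.trans (adj.coactionEmb_endCoact hpq' a)).symm)

/-- The Galois map `A ⊗_B A → A ⊗_R End(ρλ)`, `a ⊗ a' ↦ a a'₀ ⊗ a'₁`. -/
def galoisMap (hpq : IsSummandDiagram p q) :
    BalTensor (fun b : B => AddMonoidHom.mulRight (r b))
      (fun b : B => AddMonoidHom.mulLeft (r b)) →+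
    BalTensor (ringRightAction (endRing r).subtype).act adj.endBimodule.left.act :=
  BalTensor.lift
    (AddMonoidHom.mk' (fun a => (leftMul _ _ a).comp (adj.endCoact p q)) fun a a' => by
      ext c
      refine adj.coactionEmb_injective hpq ?_
      simp only [AddMonoidHom.comp_apply, AddMonoidHom.add_apply, map_add, coactionEmb_leftMul,
        add_mul])
    (fun b a a' => by
      refine adj.coactionEmb_injective hpq ?_
      simp only [AddMonoidHom.mk'_apply, AddMonoidHom.comp_apply, coactionEmb_leftMul,
        coactionEmb_endCoact adj hpq, AddMonoidHom.coe_mulRight, AddMonoidHom.coe_mulLeft,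
        adj.transpose_r_mul, map_mul r, mul_assoc])

theorem coactionEmb_galoisMap_tmul (hpq : IsSummandDiagram p q) (a a' : A) :
    adj.coactionEmb (adj.galoisMap hpq (BalTensor.tmul _ _ a a')) = a * r (adj.e * l a') := by
  refine (adj.coactionEmb_leftMul a (adj.endCoact p q a')).trans ?_
  rw [coactionEmb_endCoact adj hpq]

theorem tmul_coactionEmb_galoisMap (hpq : IsSummandDiagram p q)
    (z : BalTensor (fun b : B => AddMonoidHom.mulRight (r b))
      (fun b : B => AddMonoidHom.mulLeft (r b))) :
    BalTensor.tmul _ _ (adj.coactionEmb (adj.galoisMap hpq z)) adj.m = z :=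
  BalTensor.hom_congr
    (f := ((BalTensor.tmulHom _ _).flip adj.m).comp (adj.coactionEmb.comp (adj.galoisMap hpq)))
    (g := AddMonoidHom.id _)
    (fun a a' => by
      change BalTensor.tmul _ _ (adj.coactionEmb (adj.galoisMap hpq (BalTensor.tmul _ _ a a')))
        adj.m = BalTensor.tmul _ _ a a'
      rw [coactionEmb_galoisMap_tmul]
      refine (BalTensor.tmul_balanced (ra := fun b : B => AddMonoidHom.mulRight (r b))
        (adj.e * l a') a adj.m).trans ?_
      exact congrArg _ (adj.r_transpose_mul_m a')) z

theorem galoisMap_bijective (hpq : IsSummandDiagram p q) :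
    Function.Bijective (adj.galoisMap hpq) := by
  refine Function.bijective_iff_has_inverse.mpr
    ⟨fun z => BalTensor.tmul _ _ (adj.coactionEmb z) adj.m, adj.tmul_coactionEmb_galoisMap hpq,
      fun z => adj.coactionEmb_injective hpq ?_⟩
  rw [coactionEmb_galoisMap_tmul, adj.e_mul_l_m, map_one, mul_one]

theorem r_transpose_eq_mul_r_e_iff (a : A) :
    r (adj.e * l a) = a * r adj.e ↔ a ∈ Set.range r := by
  constructor
  · intro h
    refine ⟨adj.e * l (a * adj.m), ?_⟩
    rw [map_mul l, ← mul_assoc, map_mul r, h, mul_assoc, adj.r_e_mul_r_l_m, mul_one]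
  · rintro ⟨b, rfl⟩
    rw [adj.e_mul, map_mul]

theorem endComoduleAlgebra_isGalois (hpq : IsSummandDiagram p q) :
    IsGalois r (adj.endComoduleAlgebra hpq).coact := by
  refine ⟨Set.ext fun a => ?_, adj.galoisMap hpq, fun _ _ => rfl, adj.galoisMap_bijective hpq⟩
  calc a ∈ coinvariants (adj.endComoduleAlgebra hpq).coact
      ↔ adj.coactionEmb (adj.endCoact p q a) = adj.coactionEmb (BalTensor.tmul _ _ a 1) :=
        (adj.coactionEmb_injective hpq).eq_iff.symm
    _ ↔ r (adj.e * l a) = a * r adj.e := by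
        rw [coactionEmb_endCoact adj hpq, coactionEmb_tmul_one]
    _ ↔ a ∈ Set.range r := adj.r_transpose_eq_mul_r_e_iff a

end EndComodule

end RingAdjunction

/-! ## The fiber functor and the field algebra -/

section FiberFunctor

variable {A B : Type u} [Ring A] [Ring B] {r : B →+* A}
  {C : ObjectProperty (EndCat B)}

theorem Implementable.exists_isSummandDiagram {σ : B →+* B} (h : Implementable r σ) :
    ∃ (n : ℕ) (p : Fin n → intertwiner (r.comp σ) r) (q : Fin n → intertwiner r (r.comp σ)),
      IsSummandDiagram p q := by
  obtain ⟨n, f, f', hf⟩ := h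
  exact ⟨n, f', f, by simpa [IsSummandDiagram] using (hf 1).symm⟩

theorem fiberFunctor_additive : (fiberFunctor C r).Additive where
  map_add {α β t s} := by
    ext x
    exact Subtype.ext ((congrArg (· * x.1) (map_add r t.hom.1 s.hom.1)).trans (add_mul _ _ _))

variable [C.IsMonoidal]

theorem fiberFunctor_essentiallyStrong (hC : ∀ σ : EndCat B, C σ → Implementable r σ.hom) :
    EssentiallyStrong (fiberFunctor C r) := by
  intro α β
  obtain ⟨n, p, q, hpq⟩ := (hC α.obj α.property).exists_isSummandDiagram
  have hpq' (a : A) : ∑ i, (q i).1 * ((p i).1 * a) = a := by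
    simp only [← mul_assoc]
    rw [← Finset.sum_mul, show ∑ i, (q i : A) * p i = 1 from hpq, one_mul]
  let c (i : Fin n) : intertwiner r (r.comp (α.obj.hom.comp β.obj.hom)) →+
      intertwiner r (r.comp β.obj.hom) :=
    intertwinerComp ⟨(p i).1, fun b => (p i).2 (β.obj.hom b)⟩
  let d (i : Fin n) : intertwiner r (r.comp α.obj.hom) →+ intertwiner r (r.comp (RingHom.id B)) :=
    intertwinerComp (p i)
  refine ⟨BalTensor.lift (AbMonoidal.μ α β) ?balanced, fun _ _ => rfl,
    BalTensor.lift_bijective _ _ q c (fun i => d i) (fun x => Subtype.ext ?_)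
      (fun w => Subtype.ext ?_) (fun i x y => Subtype.ext ?_)⟩
  case balanced =>
    intro s x y
    refine Subtype.ext ?_
    change r 1 * (x.1 * s.1) * y.1 = x.1 * (r 1 * (s.1 * y.1))
    rw [map_one, one_mul, one_mul, mul_assoc]
  · refine (AddSubmonoidClass.coe_finsetSum _ _).trans ?_
    change ∑ i, r 1 * ((q i).1 * ((p i).1 * x.1)) = x.1
    simpa only [map_one, one_mul] using hpq' x.1
  · exact (AddSubmonoidClass.coe_finsetSum _ _).trans (hpq' w.1)
  · change (p i).1 * (x.1 * y.1) = r 1 * ((p i).1 * x.1 * y.1)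
    rw [map_one, one_mul, mul_assoc]

theorem fieldCounit_comp_fieldExt :
    (fieldCounit C r).comp (fieldExt C (fiberFunctor C r)) = r := by
  ext b
  exact (fieldCounit_mk C r (𝟙_ C.FullSubcategory) b _).trans (mul_one (r b))

theorem fieldCounit_fieldMk_one (α : C.FullSubcategory) (x : intertwiner r (r.comp α.obj.hom)) :
    fieldCounit C r (fieldMk C (fiberFunctor C r) α 1 x) = x.1 := by
  rw [fieldCounit_mk, map_one, one_mul]

theorem fieldUnit_isMonoidalNat : IsMonoidalNat (fieldUnit C (fiberFunctor C r)) := by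
  refine ⟨fun α β x y => Subtype.ext ?_, rfl⟩
  refine Eq.trans ?_ (CoendTensor.mk_mul_mk (G := basicPresheaf C) (F := fiberFunctor C r)
    α β (1 : B) x (1 : B) y).symm
  exact congrArg (fun b : B => fieldMk C (fiberFunctor C r) (α ⊗ β) b _)
    (show (1 : B) = 1 * α.obj.hom 1 by rw [map_one, mul_one])

end FiberFunctor

namespace RingAdjunction

section FiberFunctor

variable {A B : Type u} [Ring A] [Ring B] {l : A →+* B} {r : B →+* A} (adj : RingAdjunction l r)
  {C : ObjectProperty (EndCat B)} (hγ : C ⟨l.comp r⟩)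

/-- The bijection `Hom(ρ, ρα) ≃ Hom(λρ, α)`, `x ↦ e λ(x)`, of the adjunction. -/
def transposeEquiv (α : C.FullSubcategory) :
    intertwiner r (r.comp α.obj.hom) ≃+ ((⟨⟨l.comp r⟩, hγ⟩ : C.FullSubcategory) ⟶ α) where
  toFun x := ObjectProperty.homMk ⟨adj.e * l x.1, fun b => by
    change adj.e * l x.1 * l (r b) = α.obj.hom b * (adj.e * l x.1)
    rw [mul_assoc, ← map_mul, mul_map_of_intertwiner_left, adj.transpose_r_mul]⟩
  invFun t := (fiberFunctor C r).map t adj.unit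
  left_inv x := Subtype.ext (adj.r_transpose_mul_m x.1)
  right_inv t := ObjectProperty.hom_ext _ (EndCat.hom_ext (by
    change adj.e * l (r t.hom.1 * adj.m) = t.hom.1
    rw [adj.transpose_r_mul, adj.e_mul_l_m, mul_one]))
  map_add' x y := ObjectProperty.hom_ext _ (EndCat.hom_ext (by
    change adj.e * l (x.1 + y.1) = adj.e * l x.1 + adj.e * l y.1
    rw [map_add, mul_add]))

/-- The natural isomorphism `Hom(ρ, ρ-) ≅ Hom(λρ, -)`. -/
def transposeNatIso : fiberFunctor C r ≅
    preadditiveCoyoneda.obj (op (⟨⟨l.comp r⟩, hγ⟩ : C.FullSubcategory)) :=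
  NatIso.ofComponents (fun α => (adj.transposeEquiv hγ α).toAddCommGrpIso) fun {α β} t => by
    ext x
    exact ObjectProperty.hom_ext _ (EndCat.hom_ext (adj.transpose_r_mul t.hom.1 x.1))

theorem coendTensor_mk_eq_transpose (G : C.FullSubcategoryᵒᵖ ⥤ AddCommGrpCat.{u})
    (α : C.FullSubcategory) (y : G.obj (op α)) (x : intertwiner r (r.comp α.obj.hom)) :
    CoendTensor.mk G (fiberFunctor C r) α y x =
      CoendTensor.mk G (fiberFunctor C r) ⟨⟨l.comp r⟩, hγ⟩
        (G.map (adj.transposeEquiv hγ α x).op y) adj.unit := by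
  conv_lhs => rw [← (adj.transposeEquiv hγ α).symm_apply_apply x]
  exact (CoendTensor.mk_rel (F := fiberFunctor C r) (adj.transposeEquiv hγ α x) y adj.unit).symm

variable [C.IsMonoidal]

/-- The comonoid structure on `λρ`, with coproduct `λ(m)` and counit `e`. -/
abbrev comon : ComonObj (⟨⟨l.comp r⟩, hγ⟩ : C.FullSubcategory) where
  counit := ObjectProperty.homMk ⟨adj.e, adj.e_mem⟩
  comul := ObjectProperty.homMk ⟨l adj.m, fun b => by
    change l adj.m * l (r b) = l (r (l (r b))) * l adj.m
    rw [← map_mul, adj.m_mul, map_mul]⟩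
  counit_comul := ObjectProperty.hom_ext _ (EndCat.hom_ext adj.e_mul_l_m)
  comul_counit := ObjectProperty.hom_ext _ (EndCat.hom_ext (by
    change l (r adj.e) * l adj.m = 1
    rw [← map_mul, adj.r_e_mul_m, map_one]))
  comul_assoc := ObjectProperty.hom_ext _ (EndCat.hom_ext (by
    change l (r (l adj.m)) * l adj.m = 1 * l adj.m * l adj.m
    rw [one_mul, ← map_mul, ← map_mul, adj.m_mul]))

theorem fiberFunctor_isRepresentedBy (adj : RingAdjunction l r) (hγ : C ⟨l.comp r⟩) :
    IsRepresentedBy (fiberFunctor C r) (⟨⟨l.comp r⟩, hγ⟩ : C.FullSubcategory) := by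
  refine ⟨adj.comon hγ, adj.transposeNatIso hγ, fun α β x y => ?_, ?_⟩
  · refine ObjectProperty.hom_ext _ (EndCat.hom_ext ?_)
    change adj.e * l (x.1 * y.1) = adj.e * l x.1 * l (r (adj.e * l y.1)) * l adj.m
    rw [mul_assoc, ← map_mul, adj.r_transpose_mul_m, mul_assoc, ← map_mul]
  · refine ObjectProperty.hom_ext _ (EndCat.hom_ext ?_)
    change adj.e * l 1 = adj.e
    rw [map_one, mul_one]

/-- The inverse `a ↦ e λ(a) ⊗_{λρ} m` of `fieldCounit`. -/
noncomputable def fieldCounitInv : A →+ FieldAlgebra C (fiberFunctor C r) :=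
  ((CoendTensor.mkHom (basicPresheaf C) (fiberFunctor C r) ⟨⟨l.comp r⟩, hγ⟩).flip adj.unit).comp
    ((AddMonoidHom.mulLeft adj.e).comp l.toAddMonoidHom)

theorem fieldCounitInv_apply (a : A) : adj.fieldCounitInv hγ a =
    fieldMk C (fiberFunctor C r) ⟨⟨l.comp r⟩, hγ⟩ (adj.e * l a) adj.unit := rfl

theorem fieldCounitInv_fieldCounit (z : FieldAlgebra C (fiberFunctor C r)) :
    adj.fieldCounitInv hγ (fieldCounit C r z) = z := by
  have h : (adj.fieldCounitInv hγ).comp (fieldCounitHom C r) = AddMonoidHom.id _ := by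
    refine CoendTensor.hom_ext fun α (b : B) x => ?_
    refine (congrArg (adj.fieldCounitInv hγ) (fieldCounitHom_mk C r α b x)).trans ?_
    refine Eq.trans ?_ (adj.coendTensor_mk_eq_transpose hγ (basicPresheaf C) α b x).symm
    rw [fieldCounitInv_apply, adj.transpose_r_mul]
    rfl
  exact DFunLike.congr_fun h z

theorem fieldCounit_fieldCounitInv (a : A) : fieldCounit C r (adj.fieldCounitInv hγ a) = a := by
  rw [fieldCounitInv_apply, fieldCounit_mk]
  exact adj.r_transpose_mul_m a

theorem fieldCounit_bijective (adj : RingAdjunction l r) (hγ : C ⟨l.comp r⟩) :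
    Function.Bijective (fieldCounit C r) :=
  Function.bijective_iff_has_inverse.2
    ⟨_, adj.fieldCounitInv_fieldCounit hγ, adj.fieldCounit_fieldCounitInv hγ⟩

/-- The isomorphism `Υ ⊗_C F ≃ A`. -/
noncomputable def fieldCounitEquiv : FieldAlgebra C (fiberFunctor C r) ≃+* A :=
  RingEquiv.ofBijective (fieldCounit C r) (adj.fieldCounit_bijective hγ)

theorem fieldCounitEquiv_mk (α : C.FullSubcategory) (b : B)
    (x : intertwiner r (r.comp α.obj.hom)) :
    adj.fieldCounitEquiv hγ (fieldMk C (fiberFunctor C r) α b x) = r b * x.1 :=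
  fieldCounit_mk C r α b x

theorem fieldUnit_isIso (adj : RingAdjunction l r) (hγ : C ⟨l.comp r⟩) :
    IsIso (fieldUnit C (fiberFunctor C r)) := by
  have hinj := (adj.fieldCounit_bijective hγ).1
  have hext : ∀ b, fieldCounit C r (fieldExt C (fiberFunctor C r) b) = r b :=
    DFunLike.congr_fun fieldCounit_comp_fieldExt
  have (α : C.FullSubcategory) : IsIso ((fieldUnit C (fiberFunctor C r)).app α) := by
    rw [ConcreteCategory.isIso_iff_bijective]
    refine ⟨fun x y hxy => Subtype.ext ?_, fun y => ?_⟩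
    · have h : fieldMk C (fiberFunctor C r) α 1 x = fieldMk C (fiberFunctor C r) α 1 y :=
        congrArg Subtype.val hxy
      exact (fieldCounit_fieldMk_one α x).symm.trans
        ((congrArg (fieldCounit C r) h).trans (fieldCounit_fieldMk_one α y))
    · have hy (b : B) : y.1 * fieldExt C (fiberFunctor C r) b =
        fieldExt C (fiberFunctor C r) (α.obj.hom b) * y.1 := y.2 b
      refine ⟨⟨fieldCounit C r y.1, fun b => ?_⟩,
        Subtype.ext (hinj (fieldCounit_fieldMk_one α _))⟩
      change fieldCounit C r y.1 * r b = r (α.obj.hom b) * fieldCounit C r y.1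
      rw [← hext b, ← map_mul, hy, map_mul, hext]
  exact NatIso.isIso_of_isIso_app _

end FiberFunctor

end RingAdjunction

/-! ## The bialgebroid `F^l ⊗_C F` -/

namespace RingAdjunction

section DualCoend

variable {A B : Type u} [Ring A] [Ring B] {l : A →+* B} {r : B →+* A} (adj : RingAdjunction l r)
  {C : ObjectProperty (EndCat B)} [C.IsMonoidal] (hγ : C ⟨l.comp r⟩)
  {n : ℕ} {p : Fin n → intertwiner (r.comp (l.comp r)) r}
  {q : Fin n → intertwiner r (r.comp (l.comp r))}

/-- The map `F^l ⊗_C F → End(ρλ)` that sends `f ⊗_α x` to the matrix coefficient of `f` and `x`. -/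
noncomputable def dualEndHom : DualCoend C r →+ endRing (r.comp l) :=
  CoendTensor.lift (G := dualFunctor C r) (F := fiberFunctor C r)
    (fun α => adj.matrixCoeff (α := α.obj.hom))
    (fun α β t f x => Subtype.ext (by
      change f.1 * r t.hom.1 * r (adj.e * l (x.1 * adj.m)) =
        f.1 * r (adj.e * l (r t.hom.1 * x.1 * adj.m))
      rw [mul_assoc (r _), adj.transpose_r_mul, map_mul r t.hom.1, mul_assoc]))

theorem dualEndHom_mk (α : C.FullSubcategory) (f : intertwiner (r.comp α.obj.hom) r)
    (x : intertwiner r (r.comp α.obj.hom)) :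
    adj.dualEndHom (dualMk C r α f x) = adj.matrixCoeff f x :=
  CoendTensor.lift_mk (G := dualFunctor C r) (F := fiberFunctor C r) _ _ α f x

theorem dualEndHom_mul (z w : DualCoend C r) :
    adj.dualEndHom (z * w) = adj.dualEndHom w * adj.dualEndHom z := by
  have h : CoendTensor.mulHom.compr₂ (adj.dualEndHom (C := C)) =
      (AddMonoidHom.mul.flip.comp (adj.dualEndHom (C := C))).compl₂ adj.dualEndHom := by
    refine CoendTensor.hom_ext fun α f x => CoendTensor.hom_ext fun β g y => ?_
    change adj.dualEndHom (CoendTensor.mulHom (dualMk C r α f x) (dualMk C r β g y)) =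
      adj.dualEndHom (dualMk C r β g y) * adj.dualEndHom (dualMk C r α f x)
    refine Eq.trans ?_
      (congrArg₂ (· * ·) (adj.dualEndHom_mk β g y) (adj.dualEndHom_mk α f x)).symm
    refine (congrArg adj.dualEndHom (CoendTensor.mulHom_mk α β _ _ _ _)).trans ?_
    refine (adj.dualEndHom_mk (α ⊗ β) _ _).trans (Subtype.ext ?_)
    exact (adj.coe_matrixCoeff_mul_matrixCoeff g y f x).symm
  exact DFunLike.congr_fun (DFunLike.congr_fun h z) w

/-- The inverse `h ↦ ρ(e) h ⊗_{λρ} m` of `dualEndHom`. -/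
noncomputable def endDualHom : endRing (r.comp l) →+ DualCoend C r :=
  ((CoendTensor.mkHom (dualFunctor C r) (fiberFunctor C r) ⟨⟨l.comp r⟩, hγ⟩).flip adj.unit).comp
    adj.mate.toAddMonoidHom

theorem endDualHom_apply (h : endRing (r.comp l)) : adj.endDualHom hγ h =
    dualMk C r ⟨⟨l.comp r⟩, hγ⟩ (adj.mate h) adj.unit := rfl

theorem dualEndHom_endDualHom (h : endRing (r.comp l)) :
    adj.dualEndHom (adj.endDualHom hγ h) = h := by
  rw [endDualHom_apply, dualEndHom_mk]
  exact adj.matrixCoeff_mate_unit h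

theorem endDualHom_dualEndHom (z : DualCoend C r) :
    adj.endDualHom hγ (adj.dualEndHom z) = z := by
  have h : (adj.endDualHom hγ).comp adj.dualEndHom = AddMonoidHom.id _ := by
    refine CoendTensor.hom_ext fun α f x => ?_
    refine (congrArg (adj.endDualHom hγ) (adj.dualEndHom_mk α f x)).trans ?_
    refine Eq.trans ?_ (adj.coendTensor_mk_eq_transpose hγ (dualFunctor C r) α f x).symm
    exact congrArg (fun y => dualMk C r ⟨⟨l.comp r⟩, hγ⟩ y adj.unit)
      (Subtype.ext (adj.r_e_mul_matrixCoeff f x))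
  exact DFunLike.congr_fun h z

/-- The isomorphism `F^l ⊗_C F ≃ End(ρλ)ᵒᵖ`. -/
noncomputable def dualEndEquiv : DualCoend C r ≃+* (endRing (r.comp l))ᵐᵒᵖ where
  toFun z := MulOpposite.op (adj.dualEndHom z)
  invFun h := adj.endDualHom hγ h.unop
  left_inv := adj.endDualHom_dualEndHom hγ
  right_inv h := congrArg MulOpposite.op (adj.dualEndHom_endDualHom hγ h.unop)
  map_mul' z w := congrArg MulOpposite.op (adj.dualEndHom_mul z w)
  map_add' z w := congrArg MulOpposite.op (map_add adj.dualEndHom z w)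

theorem dualEndEquiv_mk (α : C.FullSubcategory) (f : intertwiner (r.comp α.obj.hom) r)
    (x : intertwiner r (r.comp α.obj.hom)) :
    adj.dualEndEquiv hγ (dualMk C r α f x) = MulOpposite.op (adj.matrixCoeff f x) :=
  congrArg MulOpposite.op (adj.dualEndHom_mk α f x)

/-- The right bialgebroid `F^l ⊗_C F`. -/
noncomputable def dualBialgebroid (hpq : IsSummandDiagram p q) :
    RightBialgebroid (endRing r) (DualCoend C r) :=
  (adj.endBialgebroid hpq).opposite (adj.dualEndEquiv hγ)

theorem dualBialgebroid_isDualBialgebroid (hpq : IsSummandDiagram p q) :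
    IsDualBialgebroid C r (adj.dualBialgebroid hγ hpq) where
  source x := by
    refine ((adj.dualEndEquiv hγ).symm_apply_eq).2 ?_
    rw [dualEndEquiv_mk]
    rfl
  target x := by
    refine ((adj.dualEndEquiv hγ).symm_apply_eq).2 ?_
    rw [dualEndEquiv_mk]
    refine congrArg MulOpposite.op (Subtype.ext ?_)
    change x.1 = x.1 * r (adj.e * l (1 * adj.m))
    rw [one_mul, adj.e_mul_l_m, map_one, mul_one]
  counit α f x := by
    change r adj.e * (adj.dualEndHom (dualMk C r α f x)).1 * adj.m = f.1 * x.1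
    rw [dualEndHom_mk, r_e_mul_matrixCoeff, mul_assoc, adj.r_transpose_mul_m]
  comul α k p' q' hpq' f x := by
    let Φ := (adj.endBialgebroid hpq).oppositeIso (adj.dualEndEquiv hγ)
    apply (tensorEquiv Φ.toIso Φ).injective
    refine ((adj.endBialgebroid hpq).coring.tensorEquiv_transport_comul Φ _).trans ?_
    change adj.endComul p q (adj.dualEndHom (dualMk C r α f x)) = _
    rw [dualEndHom_mk, adj.endComul_matrixCoeff hpq hpq']
    refine Eq.trans ?_ (map_sum (tensorEquiv Φ.toIso Φ) _ _).symm
    exact Finset.sum_congr rfl fun i _ => congrArg₂ (BalTensor.tmul _ _)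
      (adj.dualEndHom_mk α f (q' i)).symm (adj.dualEndHom_mk α (p' i) x).symm

theorem fieldCounitEquiv_fieldBase (x : endRing r) :
    adj.fieldCounitEquiv hγ (fieldBase C r x) = (endRing r).subtype x :=
  fieldCounit_fieldMk_one (𝟙_ C.FullSubcategory) ⟨x.1, x.2⟩

/-- The comodule algebra `Υ ⊗_C F` over `F^l ⊗_C F`. -/
noncomputable def fieldComoduleAlgebra (hpq : IsSummandDiagram p q) :
    (adj.dualBialgebroid hγ hpq).ComoduleAlgebra (fieldBase C r) :=
  (adj.endComoduleAlgebra hpq).transport (adj.dualEndEquiv hγ) (adj.fieldCounitEquiv hγ)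
    (adj.fieldCounitEquiv_fieldBase hγ)

theorem fieldComoduleAlgebra_isFieldCoaction (hpq : IsSummandDiagram p q) :
    IsFieldCoaction C r (adj.dualBialgebroid hγ hpq) (adj.fieldComoduleAlgebra hγ hpq) := by
  intro α k p' q' hpq' b x
  apply (tensorEquiv (ringRightIso (adj.fieldCounitEquiv hγ) (adj.fieldCounitEquiv_fieldBase hγ))
    ((adj.endBialgebroid hpq).oppositeIso (adj.dualEndEquiv hγ))).injective
  refine ((adj.endComoduleAlgebra hpq).tensorEquiv_transport _ _ _ _).trans ?_
  rw [fieldCounitEquiv_mk]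
  refine (adj.endCoact_r_mul hpq hpq' b x).trans (Eq.trans ?_ (map_sum _ _ _).symm)
  exact Finset.sum_congr rfl fun i _ => congrArg₂ (BalTensor.tmul _ _)
    (adj.fieldCounitEquiv_mk hγ α b (q' i)).symm (adj.dualEndHom_mk α (p' i) x).symm

theorem fieldComoduleAlgebra_isGalois (hpq : IsSummandDiagram p q) :
    IsGalois (fieldExt C (fiberFunctor C r)) (adj.fieldComoduleAlgebra hγ hpq).coact :=
  (adj.endComoduleAlgebra hpq).isGalois_transport (adj.dualEndEquiv hγ) (adj.fieldCounitEquiv hγ)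
    (adj.fieldCounitEquiv_fieldBase hγ) (DFunLike.congr_fun fieldCounit_comp_fieldExt)
    (adj.endComoduleAlgebra_isGalois hpq)

end DualCoend

end RingAdjunction

end FieldAlg

theorem mainTheorem4 {A B : Type u} [Ring A] [Ring B] {l : A →+* B} {r : B →+* A}
    (adj : FieldAlg.RingAdjunction l r)
    (C : ObjectProperty (FieldAlg.EndCat B)) [C.IsMonoidal]
    (hC : ∀ σ : FieldAlg.EndCat B, C σ → FieldAlg.Implementable r σ.hom)
    (hγ : C ⟨l.comp r⟩) :
    -- `F = Hom(ρ, ρ-)` is representable, essentially strong, and `η_F` is an isomorphism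
    ((FieldAlg.fiberFunctor C r).Additive ∧
      FieldAlg.IsRepresentedBy (FieldAlg.fiberFunctor C r)
        (⟨⟨l.comp r⟩, hγ⟩ : C.FullSubcategory) ∧
      FieldAlg.EssentiallyStrong (FieldAlg.fiberFunctor C r) ∧
      FieldAlg.IsMonoidalNat (FieldAlg.fieldUnit C (FieldAlg.fiberFunctor C r)) ∧
      IsIso (FieldAlg.fieldUnit C (FieldAlg.fiberFunctor C r))) ∧
    -- the counit is an isomorphism of extensions of `B` from `ρ_F` to `ρ`
    ((FieldAlg.fieldCounit C r).comp (FieldAlg.fieldExt C (FieldAlg.fiberFunctor C r)) = r ∧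
      Function.Bijective (FieldAlg.fieldCounit C r)) ∧
    -- the bialgebroids `F^l ⊗_C F` and `End(ρλ)`
    ∃ (K : FieldAlg.RightBialgebroid (FieldAlg.endRing r) (FieldAlg.DualCoend C r))
      (L : FieldAlg.LeftBialgebroid (FieldAlg.endRing r) (FieldAlg.endRing (r.comp l))),
      FieldAlg.IsDualBialgebroid C r K ∧ FieldAlg.IsEndBialgebroid adj L ∧
      -- `F^l ⊗_C F` is the opposite of `End(ρλ)`
      (∃ Φ : FieldAlg.DualCoend C r ≃+* (FieldAlg.endRing (r.comp l))ᵐᵒᵖ,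
        FieldAlg.IsIsoToOpposite K L Φ) ∧
      -- `ρ_F` is a Galois extension over `F^l ⊗_C F` with coinvariants `ρ_F(B)`
      (∃ δ : K.ComoduleAlgebra (FieldAlg.fieldBase C r),
        FieldAlg.IsFieldCoaction C r K δ ∧
        FieldAlg.IsGalois (FieldAlg.fieldExt C (FieldAlg.fiberFunctor C r)) δ.coact) ∧
      -- `ρ` is a Galois extension over `End(ρλ)` with coinvariants `ρ(B)`
      (∃ δ : L.ComoduleAlgebra (FieldAlg.endRing r).subtype,
        FieldAlg.IsEndCoaction adj L δ ∧ FieldAlg.IsGalois r δ.coact) := by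
  obtain ⟨n, p, q, hpq⟩ := (hC _ hγ).exists_isSummandDiagram
  exact ⟨⟨FieldAlg.fiberFunctor_additive, adj.fiberFunctor_isRepresentedBy hγ,
      FieldAlg.fiberFunctor_essentiallyStrong hC, FieldAlg.fieldUnit_isMonoidalNat,
      adj.fieldUnit_isIso hγ⟩,
    ⟨FieldAlg.fieldCounit_comp_fieldExt, adj.fieldCounit_bijective hγ⟩,
    adj.dualBialgebroid hγ hpq, adj.endBialgebroid hpq,
    adj.dualBialgebroid_isDualBialgebroid hγ hpq, adj.endBialgebroid_isEndBialgebroid hpq,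
    ⟨adj.dualEndEquiv hγ, FieldAlg.LeftBialgebroid.opposite_isIsoToOpposite _ _⟩,
    ⟨adj.fieldComoduleAlgebra hγ hpq, adj.fieldComoduleAlgebra_isFieldCoaction hγ hpq,
      adj.fieldComoduleAlgebra_isGalois hγ hpq⟩,
    ⟨adj.endComoduleAlgebra hpq, adj.endComoduleAlgebra_isEndCoaction hpq,
      adj.endComoduleAlgebra_isGalois hpq⟩⟩
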